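/- **Setting.** Let experiments $X$ and $Y$ have pre-change densities $f_0^X,f_0^Y$ and post-change densities $f_1^X,f_1^Y$ with respect to $\sigma$-finite reference measures, such that for each experiment $f_0$ and $f_1$ vanish at the same points up to a null set, and put $\ell_X=\log(f_1^X/f_0^X)$, $\ell_Y=\log(f_1^Y/f_0^Y)$ (real-valued). Under $\mathsf P_\nu$ the pairs $(X_n,Y_n)$, $n\ge1$, are independent over time, have marginal densities $f_0^X,f_0^Y$ for $n<\nu$ and $f_1^X,f_1^Y$ for $n\ge\nu$, and have a fixed joint law before the change and a fixed joint law after it; $\mathsf P_\infty$ means no change. Write $D(\cdot\Vert\cdot)$ for the Kullback–Leibler divergence. At each time $n\ge 1$ at most one experiment is performed; let $S_n\in\{Y,X,\text{none}\}$ be the choice at time $n$ and $I_n$ the information consisting of $S_1,\dots,S_n$ and the observations made. A policy $\Psi$ chooses $S_{n+1}$ as a function of $I_n$ (possibly with independent randomization) and declares a change at a stopping time $\tau$ of $(I_n)$. Let $$\mathrm{ARLFA}(\Psi)=\mathsf E_\infty[\tau],\qquad \mathrm{WADD}(\Psi)=\sup_{\nu\ge1}\operatorname{ess\,sup}\mathsf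 E_\nu[(\tau-\nu+1)^+\mid I_{\nu-1}],\qquad \mathrm{POR}_i(\Psi)=\limsup_{n\to\infty}\mathsf E_\infty\Big[\tfrac1n\sum_{k=1}^{n-1}\mathbf 1\{S_k=i\}\Big],$$ the last being computed as if sampling continued forever. The CUSUM algorithm $\tau_C^Y(A)$ always performs $Y$ and stops at the first $n\ge 1$ with $C_n>A$, where $C_0=0$ and $C_{n+1}=\max\{C_n+\ell_Y(Y_{n+1}),0\}$. **DE2E-CUSUM algorithm** $\Psi_{\mathrm{DE2E}}(A,a_X,a_Y,N_0,N_X,\mu)$, where $A,a_X,a_Y,N_0,N_X,\mu>0$ are real. (a) Start with $D_0=0$. Perform $Y$ and update $D_{n+1}=D_n+\ell_Y(Y_{n+1})$ while the statistic is nonnegative. (b) When it falls to a value $U_Y<0$, set the statistic to the level $a_YU_Y$ and go to (c). (c) Perform $X$ and update $D_{n+1}=D_n+\ell_X(X_{n+1})$. If the statistic is $\ge0$, or if $N_X$ observations of $X$ have been used since it last entered (b), reset it to $0$ and return to (a). Otherwise, if it falls to a value $U_X<a_YU_Y$, set it to $a_XU_X$ and go to (d). (d) Perform no experiment and update $D_{n+1}=D_n+\mu$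 until the statistic exceeds $a_YU_Y$ or $N_0$ such updates have been made in this visit to (d); then reset it to $a_YU_Y$ and return to (c). A non-integer limit $N$ ($N_X$ in each visit below $0$, $N_0$ in each visit to (d)) means $\lfloor N\rfloor+1$ with probability $N-\lfloor N\rfloor$ and $\lfloor N\rfloor$ otherwise, drawn independently each time; a drawn limit of $0$ means that the corresponding phase is skipped. The algorithm stops at $\tau_{\mathrm{DE2E}}=\inf\{n\ge1:D_n>A\}$, where $D_n$ is the statistic after any reset. **Theorem.** Assume that $$0<D(f_0^X\Vert f_1^X)\le D(f_0^Y\Vert f_1^Y)<\infty\qquad\text{or}\qquad 0<D(f_1^X\Vert f_0^X)\le D(f_1^Y\Vert f_0^Y)<\infty .$$ 1. For all $a_X,a_Y,N_0,N_X,\mu>0$ and all $\gamma>1$, with $A=\log\gamma$, $\mathrm{ARLFA}(\Psi_{\mathrm{DE2E}})\ge\gamma$. 2. For all $\beta_X,\beta_Y\in(0,1)$ there are $a_X,a_Y,N_0,N_X,\mu>0$ such that for every $A>0$, $\mathrm{POR}_Y(\Psi_{\mathrm{DE2E}})\le\beta_Y$ and $\mathrm{POR}_X(\Psi_{\mathrm{DE2E}})\le\beta_X$;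 moreover, if $\beta_X+\beta_Y<1$, then the fraction of time at which no experiment is performed satisfies $\liminf_{n\to\infty}\mathsf E_\infty[\frac1n\sum_{k=1}^{n-1}\mathbf 1\{S_k=\text{none}\}]\ge1-\beta_X-\beta_Y$. 3. For all fixed $a_X,a_Y,N_0,N_X,\mu>0$ and each $A>0$, $$\mathrm{WADD}(\Psi_{\mathrm{DE2E}})\le\mathsf E_1[\tau_{\mathrm{DE2E}}]+N_X+N_XN_0 .$$ Also there is a finite constant $K_2$, not depending on $A$, with $\mathrm{WADD}(\Psi_{\mathrm{DE2E}})\le\mathrm{WADD}(\tau_C^Y(A))+K_2$ for all $A>0$. The DE2E-CUSUM algorithm is a policy in the above sense for every $A>0$, and if $0<D(f_1^X\Vert f_0^X)\le D(f_1^Y\Vert f_0^Y)<\infty$, then it is asymptotically optimal: for every $\varepsilon>0$ there is $\gamma_0>1$ such that for all $\gamma\ge\gamma_0$ and every policy $\Psi$ with $\mathrm{ARLFA}(\Psi)\ge\gamma$ (whatever its observation ratios), $\mathrm{WADD}(\Psi_{\mathrm{DE2E}})\le(1+\varepsilon)\,\mathrm{WADD}(\Psi)$, where $A=\log\gamma$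 in $\Psi_{\mathrm{DE2E}}$. -/

import Mathlib

open MeasureTheory Filter
open scoped ENNReal NNReal

namespace QCD

noncomputable section

/-- What the decision-maker does at one time step: perform the high-quality experiment `Y`,
perform the low-quality experiment `X`, or perform no experiment at all. -/
inductive Choice
  | expY
  | expX
  | idle
  deriving DecidableEq

instance : MeasurableSpace Choice := ⊤

/-- One experiment: a pre-change density `f₀` and a post-change density `f₁` with respect to a
σ-finite reference measure on the observation space. -/
structure Experiment (𝒳 : Type*) [MeasurableSpace 𝒳] where
  ref : Measure 𝒳
  sigmaFinite_ref : SigmaFinite ref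
  f₀ : 𝒳 → ℝ≥0
  f₁ : 𝒳 → ℝ≥0
  measurable_f₀ : Measurable f₀
  measurable_f₁ : Measurable f₁
  lintegral_f₀ : ∫⁻ x, (f₀ x : ℝ≥0∞) ∂ref = 1
  lintegral_f₁ : ∫⁻ x, (f₁ x : ℝ≥0∞) ∂ref = 1

namespace Experiment

variable {𝒳 : Type*} [MeasurableSpace 𝒳] (E : Experiment 𝒳)

/-- Law of one observation before the change. -/
def law₀ : Measure 𝒳 := E.ref.withDensity fun x => (E.f₀ x : ℝ≥0∞)

/-- Law of one observation after the change. -/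
def law₁ : Measure 𝒳 := E.ref.withDensity fun x => (E.f₁ x : ℝ≥0∞)

/-- The log-likelihood ratio `ℓ(x) = log (f₁ x / f₀ x)`. -/
def llr (x : 𝒳) : ℝ := Real.log ((E.f₁ x : ℝ) / (E.f₀ x : ℝ))

/-- The log-likelihood ratio is a genuine real number almost everywhere (where not both densities
vanish): the densities vanish at the same points, up to a null set. -/
def FiniteLLR : Prop := ∀ᵐ x ∂E.ref, E.f₀ x = 0 ↔ E.f₁ x = 0

end Experiment

/-- A pair of uniform random numbers, used only for the randomized rounding of non-integer
truncation limits. -/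
abbrev Seed : Type := unitInterval × unitInterval

/-- The sample space. The coordinate `ω n` holds the potential observations of `X` and of `Y` at
time `n` and the random seeds of time `n`. Observations start at time `1`; the observations in the
coordinate `ω 0` are never used. -/
abbrev Sample (𝒳 𝒴 : Type*) : Type _ := ℕ → (𝒳 × 𝒴) × Seed

/-- The two-experiment model. At a single time the pair of potential observations of `X` and `Y`
may have any joint law with the prescribed marginals (they need not be independent). -/
structure Model (𝒳 𝒴 : Type*) [MeasurableSpace 𝒳] [MeasurableSpace 𝒴] where
  X : Experiment 𝒳
  Y : Experiment 𝒴
  joint₀ : Measure (𝒳 × 𝒴)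
  joint₁ : Measure (𝒳 × 𝒴)
  fst_joint₀ : joint₀.map Prod.fst = X.law₀
  snd_joint₀ : joint₀.map Prod.snd = Y.law₀
  fst_joint₁ : joint₁.map Prod.fst = X.law₁
  snd_joint₁ : joint₁.map Prod.snd = Y.law₁

/-- A policy: which experiment is performed at each time `n ≥ 1` (the value at `n = 0` is never
used), and the time at which a change is declared (`⊤` if never). -/
structure Policy (𝒳 𝒴 : Type*) where
  select : ℕ → Sample 𝒳 𝒴 → Choice
  stopTime : Sample 𝒳 𝒴 → ℕ∞

namespace Policy

variable {𝒳 𝒴 : Type*} [MeasurableSpace 𝒳] [MeasurableSpace 𝒴] (Ψ : Policy 𝒳 𝒴)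

/-- What the decision-maker sees at time `k`: which experiment was performed (encoded by the
summand) and its outcome. -/
def record (k : ℕ) (ω : Sample 𝒳 𝒴) : 𝒳 ⊕ 𝒴 ⊕ Unit :=
  match Ψ.select k ω with
  | .expX => Sum.inl (ω k).1.1
  | .expY => Sum.inr (Sum.inl (ω k).1.2)
  | .idle => Sum.inr (Sum.inr ())

/-- The information `I_n` available at time `n`: the σ-algebra generated by the records of the
times `1, …, n`. -/
abbrev info (n : ℕ) : MeasurableSpace (Sample 𝒳 𝒴) :=
  ⨆ k ∈ Finset.Icc 1 n, MeasurableSpace.comap (Ψ.record k) inferInstance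

end Policy

/-- The σ-algebra generated by the random seeds of the times `0, …, n`. -/
abbrev seedInfo (𝒳 𝒴 : Type*) (n : ℕ) : MeasurableSpace (Sample 𝒳 𝒴) :=
  ⨆ k ∈ Finset.range (n + 1),
    MeasurableSpace.comap (fun ω : Sample 𝒳 𝒴 => (ω k).2) inferInstance

/-- Admissible policies: the experiment performed at time `n + 1` is a function of `I_n` (possibly
with the help of random seeds), and the declaration time is a stopping time of `(I_n)`. -/
def Policy.IsAdmissible {𝒳 𝒴 : Type*} [MeasurableSpace 𝒳] [MeasurableSpace 𝒴]
    (Ψ : Policy 𝒳 𝒴) : Prop :=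
  (∀ n : ℕ, Measurable[Ψ.info n ⊔ seedInfo 𝒳 𝒴 n] (Ψ.select (n + 1))) ∧
  (∀ n : ℕ, MeasurableSet[Ψ.info n] {ω | Ψ.stopTime ω ≤ (n : ℕ∞)})

/-- `firstPassage D A` is the first time `n ≥ 1` at which `D n > A`, and `⊤` if there is none. -/
def firstPassage (D : ℕ → ℝ) (A : ℝ) : ℕ∞ :=
  ⨅ (n : ℕ) (_ : 1 ≤ n) (_ : A < D n), (n : ℕ∞)

/-- Randomized rounding: a truncation limit `N` means `⌊N⌋ + 1` with probability `N - ⌊N⌋` and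
`⌊N⌋` otherwise, when `u` is uniform on `[0, 1]`. -/
def randRound (N : ℝ) (u : unitInterval) : ℕ :=
  ⌊N⌋₊ + if (u : ℝ) < Int.fract N then 1 else 0

/-- The parameters `a_X, a_Y, N_0, N_X, μ` of the DE2E-CUSUM algorithm. -/
structure DEParams where
  aX : ℝ
  aY : ℝ
  N0 : ℝ
  NX : ℝ
  μ : ℝ

/-- All parameters are positive. -/
def DEParams.Positive (p : DEParams) : Prop :=
  0 < p.aX ∧ 0 < p.aY ∧ 0 < p.N0 ∧ 0 < p.NX ∧ 0 < p.μ

/-- The state of the DE2E-CUSUM algorithm after some time step: what is done at the next step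
(`next`), the statistic `D` after any reset, the current zero level `a_Y * U_Y` for experiment `X`
(`level`), the number of observations of `X` used since the statistic last fell below `0`
(`usedX`), and the number of deterministic updates made in the current idle period (`usedIdle`). -/
structure DEState where
  next : Choice
  D : ℝ
  level : ℝ
  usedX : ℕ
  usedIdle : ℕ

/-- The state in which experiment `Y` is performed next, with statistic `d`. -/
def DEState.atY (d : ℝ) : DEState := ⟨.expY, d, 0, 0, 0⟩

namespace Model

variable {𝒳 𝒴 : Type*} [MeasurableSpace 𝒳] [MeasurableSpace 𝒴] (M : Model 𝒳 𝒴)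

/-- The law `P_ν` of the observations (and seeds) when the change happens at time `ν`: independent
across time, pre-change at times `n < ν` and post-change at times `n ≥ ν`. The law `P_∞` (no
change) is `M.P ⊤`. -/
def P (ν : ℕ∞) : Measure (Sample 𝒳 𝒴) :=
  Measure.infinitePi fun n : ℕ =>
    (if (n : ℕ∞) < ν then M.joint₀ else M.joint₁).prod (volume : Measure Seed)

/-- Average run length to false alarm, `E_∞[τ]`. -/
def ARLFA (Ψ : Policy 𝒳 𝒴) : ℝ≥0∞ :=
  ∫⁻ ω, ((Ψ.stopTime ω : ℕ∞) : ℝ≥0∞) ∂M.P ⊤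

/-- Mean delay `E_1[τ]` when the change is present from the first observation on. -/
def meanStop₁ (Ψ : Policy 𝒳 𝒴) : ℝ≥0∞ :=
  ∫⁻ ω, ((Ψ.stopTime ω : ℕ∞) : ℝ≥0∞) ∂M.P 1

/-- Worst-case average detection delay (Lorden):
`sup_{ν ≥ 1} ess sup E_ν[(τ - ν + 1)⁺ | I_{ν - 1}]`.
Subtraction in `ℝ≥0∞` is truncated, that is, the positive part. -/
def WADD (Ψ : Policy 𝒳 𝒴) : ℝ≥0∞ :=
  ⨆ (ν : ℕ) (_ : 1 ≤ ν),
    essSup (condLExp (Ψ.info (ν - 1)) (M.P (ν : ℕ∞))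
      fun ω => ((Ψ.stopTime ω : ℕ∞) : ℝ≥0∞) + 1 - (ν : ℝ≥0∞)) (M.P (ν : ℕ∞))

/-- Expected fraction of the time before `n` at which the choice `c` is made, when there is no
change and the policy never stops: `E_∞[(1/n) ∑_{k=1}^{n-1} 1{S_k = c}]`. -/
def meanFraction (Ψ : Policy 𝒳 𝒴) (c : Choice) (n : ℕ) : ℝ≥0∞ :=
  ∫⁻ ω, (∑ k ∈ Finset.Ico 1 n, if Ψ.select k ω = c then (1 : ℝ≥0∞) else 0) / (n : ℝ≥0∞) ∂M.P ⊤

/-- Pre-change observation ratio of the choice `c`. -/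
def POR (Ψ : Policy 𝒳 𝒴) (c : Choice) : ℝ≥0∞ :=
  limsup (M.meanFraction Ψ c) atTop

/-- The CUSUM statistic of experiment `Y`. -/
def cusumY (ω : Sample 𝒳 𝒴) : ℕ → ℝ
  | 0 => 0
  | n + 1 => max (cusumY ω n + M.Y.llr (ω (n + 1)).1.2) 0

/-- The CUSUM algorithm for experiment `Y` with threshold `A`. -/
def cusumPolicy (A : ℝ) : Policy 𝒳 𝒴 where
  select _ _ := .expY
  stopTime ω := firstPassage (M.cusumY ω) A

/-- One step of the DE2E-CUSUM algorithm from the state `s`, where `o` holds the (potential)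
observations `o.1.1` of `X` and `o.1.2` of `Y` and the seeds `o.2` of the new time step.

A limit `N` is exhausted after `c` uses if `randRound N u ≤ c`. For a non-integer `N` the answer is
random only at `c = ⌊N⌋`, and that comparison is made just once in each period counted by `c`; hence
the limit in force is `⌊N⌋ + 1` with probability `N - ⌊N⌋` and `⌊N⌋` otherwise, drawn afresh and
independently in each such period. -/
def deStep (p : DEParams) (s : DEState) (o : (𝒳 × 𝒴) × Seed) : DEState :=
  match s.next with
  | .expY =>
    let d := s.D + M.Y.llr o.1.2
    if 0 ≤ d then DEState.atY d
    else if randRound p.NX o.2.1 ≤ 0 then DEState.atY 0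
    else ⟨.expX, p.aY * d, p.aY * d, 0, 0⟩
  | .expX =>
    let d := s.D + M.X.llr o.1.1
    let c := s.usedX + 1
    if 0 ≤ d then DEState.atY 0
    else if randRound p.NX o.2.1 ≤ c then DEState.atY 0
    else if s.level ≤ d then ⟨.expX, d, s.level, c, 0⟩
    else if randRound p.N0 o.2.2 ≤ 0 then ⟨.expX, s.level, s.level, c, 0⟩
    else ⟨.idle, p.aX * d, s.level, c, 0⟩
  | .idle =>
    let d := s.D + p.μ
    let j := s.usedIdle + 1
    if s.level < d then ⟨.expX, s.level, s.level, s.usedX, 0⟩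
    else if randRound p.N0 o.2.2 ≤ j then ⟨.expX, s.level, s.level, s.usedX, 0⟩
    else ⟨.idle, d, s.level, s.usedX, j⟩

/-- The state of the DE2E-CUSUM algorithm after time `n`. As required for the observation ratios,
the evolution is continued forever, also after the threshold has been crossed. -/
def deState (p : DEParams) (ω : Sample 𝒳 𝒴) : ℕ → DEState
  | 0 => DEState.atY 0
  | n + 1 => M.deStep p (deState p ω n) (ω (n + 1))

/-- The DE2E-CUSUM algorithm with threshold `A` and parameters `p`. -/
def de2e (A : ℝ) (p : DEParams) : Policy 𝒳 𝒴 where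
  select n ω := (M.deState p ω (n - 1)).next
  stopTime ω := firstPassage (fun n => (M.deState p ω n).D) A

end Model

end

end QCD

open MeasureTheory Filter
open scoped ENNReal NNReal

/-! The algorithm is a Markov chain `run (M.deStep p)` driven by independent coordinates. Its mean
run length and its mean delay are mean hitting times `meanHit`, limits of iterates of a one-step
equation, so bounds on them follow from one-step inequalities.

False alarms. Before the change `exp ℓ_Y` has mean `1`, and the statistic cannot be positive right
after a step that uses `X` or nothing. Hence `h = e^A + 1 - e^(D⁺)` satisfies `h ≤ 1 + E[h; not
stopped]`, and `h = e^A` at the start (`exp_le_meanHit`). Likelihood ratios of `X` play no role.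

Observation ratios. `Y` has negative truncated drift, and an observation of `X` falls by a fixed `δ`
with positive probability. Slow climbing then buys long idle periods at a bounded mean number of
experiments; a Foster–Lyapunov function turns this into a bound on the total number of experiments
(`exists_sparse_params`).

Delay. Whatever the observations are, an excursion below `0` lasts at most `N_X (1 + N_0)` steps on
average over the randomized limits (`lintegral_seed_excursion_le`). Coupling the chain from a high
state with the chain from `0` shows that at most one such excursion separates the worst case from a
start at `0` (`meanHitTrunc_atY_le`, `setLIntegral_overrun_le`). Against CUSUM, which moves
identically above `0`, the excess is one excursion for each fall below `0`; since `E₁ exp(-ℓ_Y/2) <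
1`, the mean number of falls is bounded independently of the threshold (`delay_le_cusumDelay_add`).

Optimality. On what a policy sees, the two laws differ by the likelihood ratio of the performed
experiments (`setLIntegral_exp_neg_logLR`), whose logarithm grows in mean by at most `I =
D(f₁^Y‖f₀^Y)` per step. If the worst-case delay is `J`, then in each block of `m ≥ K J` times the
policy stops with conditional probability about `e^(-IJ)` at least even without a change, so `log
ARLFA ≤ (1 + o(1)) I J` (`ARLFA_le`). Wald's argument bounds the CUSUM delay by `(1 + o(1)) A / I`
(`cusumDelay_le`), and the two bounds match.

The seeds are not part of `I_n`. Admissibility holds because the next choice reveals their effect;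
the bound on the essential supremum holds because the seeds of time `n` are still fresh given `I_n`.
-/

namespace QCD

noncomputable section

/-! ### Product measures: splitting a sequence into past and future. -/

section Glue

variable {S : Type*}

/-- The sequence that starts with `o` and continues with `ω`. -/
def cons (o : S) (ω : ℕ → S) : ℕ → S
  | 0 => o
  | n + 1 => ω n

/-- The sequence that agrees with `ω` before `n` and continues with `ω'` from `n` on. -/
def glue (n : ℕ) (ω ω' : ℕ → S) : ℕ → S := fun k => if k < n then ω k else ω' (k - n)

lemma glue_lt {n k : ℕ} (h : k < n) (ω ω' : ℕ → S) : glue n ω ω' k = ω k := by simp [glue, h]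

lemma glue_add (n k : ℕ) (ω ω' : ℕ → S) : glue n ω ω' (n + k) = ω' k := by simp [glue]

lemma glue_self (n : ℕ) (ω ω' : ℕ → S) : glue n ω ω' n = ω' 0 := by simp [glue]

variable [MeasurableSpace S]

lemma measurable_cons : Measurable fun q : S × (ℕ → S) => cons q.1 q.2 := by
  refine measurable_pi_iff.2 fun k => ?_
  cases k with
  | zero => exact measurable_fst
  | succ k => exact (measurable_pi_apply k).comp measurable_snd

lemma measurable_glue (n : ℕ) :
    Measurable fun q : (ℕ → S) × (ℕ → S) => glue n q.1 q.2 := by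
  refine measurable_pi_iff.2 fun k => ?_
  by_cases h : k < n
  · simp only [glue, h, if_true]
    exact (measurable_pi_apply k).comp measurable_fst
  · simp only [glue, h, if_false]
    exact (measurable_pi_apply _).comp measurable_snd

variable (μ : ℕ → Measure S) [∀ i, IsProbabilityMeasure (μ i)]

/-- The preimage of a finite rectangle is the product of a rectangle in the coordinates before `n`
and a shifted rectangle, so the product formula gives the claim, and rectangles determine a product
measure. This is the source of all conditioning on the past below. -/
lemma map_glue (n : ℕ) :
    ((Measure.infinitePi μ).prod (Measure.infinitePi fun k => μ (n + k))).map
      (fun q => glue n q.1 q.2) = Measure.infinitePi μ := by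
  refine Measure.eq_infinitePi μ fun s t ht => ?_
  have hpre : (fun q : (ℕ → S) × (ℕ → S) => glue n q.1 q.2) ⁻¹' (Set.pi s t) =
      (Set.pi (s.filter (· < n) : Finset ℕ) t) ×ˢ
      (Set.pi ((s.filter (¬ · < n)).image (· - n) : Finset ℕ) fun k => t (n + k)) := by
    ext ⟨ω, ω'⟩
    simp only [Set.mem_preimage, Set.mem_pi, Finset.mem_coe, Set.mem_prod, Finset.mem_filter,
      Finset.mem_image]
    constructor
    · intro h
      refine ⟨fun i hi => ?_, ?_⟩
      · have := h i hi.1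
        rwa [glue_lt hi.2] at this
      · rintro k ⟨i, ⟨his, hin⟩, rfl⟩
        have := h i his
        rw [glue, if_neg hin] at this
        rwa [Nat.add_sub_cancel' (not_lt.1 hin)]
    · rintro ⟨h1, h2⟩ i hi
      by_cases hin : i < n
      · rw [glue_lt hin]; exact h1 i ⟨hi, hin⟩
      · have := h2 (i - n) ⟨i, ⟨hi, hin⟩, rfl⟩
        rw [Nat.add_sub_cancel' (not_lt.1 hin)] at this
        rwa [glue, if_neg hin]
  rw [Measure.map_apply (measurable_glue n)
    (MeasurableSet.pi s.countable_toSet fun i _ => ht i), hpre, Measure.prod_prod,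
    Measure.infinitePi_pi _ (fun i _ => ht i), Measure.infinitePi_pi _ (fun i _ => ht _),
    ← Finset.prod_filter_mul_prod_filter_not s (· < n)]
  congr 1
  rw [Finset.prod_image]
  · refine Finset.prod_congr rfl fun i hi => ?_
    rw [Nat.add_sub_cancel' (not_lt.1 (Finset.mem_filter.1 hi).2)]
  · intro a ha b hb hab
    have h1 := not_lt.1 (Finset.mem_filter.1 ha).2
    have h2 := not_lt.1 (Finset.mem_filter.1 hb).2
    simp only at hab
    omega

lemma lintegral_glue (n : ℕ) {F : (ℕ → S) → ℝ≥0∞} (hF : Measurable F) :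
    ∫⁻ ω, F ω ∂Measure.infinitePi μ =
      ∫⁻ ω, ∫⁻ ω', F (glue n ω ω') ∂Measure.infinitePi (fun k => μ (n + k))
        ∂Measure.infinitePi μ := by
  conv_lhs => rw [← map_glue μ n]
  rw [lintegral_map hF (measurable_glue n),
    lintegral_prod]
  exact (hF.comp (measurable_glue n)).aemeasurable

lemma lintegral_cons {F : (ℕ → S) → ℝ≥0∞} (hF : Measurable F) :
    ∫⁻ ω, F ω ∂Measure.infinitePi μ =
      ∫⁻ o, ∫⁻ ω', F (cons o ω') ∂Measure.infinitePi (fun k => μ (k + 1)) ∂μ 0 := by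
  have hg : ∀ ω ω' : ℕ → S, glue 1 ω ω' = cons (ω 0) ω' := by
    intro ω ω'
    funext k
    cases k <;> simp [glue, cons]
  have h1 : (fun k => μ (1 + k)) = fun k => μ (k + 1) := by funext k; rw [add_comm]
  rw [lintegral_glue μ 1 hF]
  simp only [hg, h1]
  have hm : Measurable fun o : S =>
      ∫⁻ ω', F (cons o ω') ∂Measure.infinitePi (fun k => μ (k + 1)) :=
    (hF.comp measurable_cons).lintegral_prod_right'
  conv_rhs => rw [← Measure.infinitePi_map_eval μ 0]
  rw [lintegral_map hm (measurable_pi_apply 0)]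

/-- Integration of a function of the past before `n`, the coordinate `n` and the future. -/
lemma lintegral_glue_cons (n : ℕ) {F : (ℕ → S) → ℝ≥0∞} (hF : Measurable F) :
    ∫⁻ ω, F ω ∂Measure.infinitePi μ =
      ∫⁻ ω, ∫⁻ o, ∫⁻ ω', F (glue n ω (cons o ω'))
        ∂Measure.infinitePi (fun k => μ (n + (k + 1))) ∂μ n ∂Measure.infinitePi μ := by
  rw [lintegral_glue μ n hF]
  refine lintegral_congr fun ω => ?_
  have hm : Measurable fun ω' => F (glue n ω ω') :=
    hF.comp ((measurable_glue n).comp (measurable_const.prodMk measurable_id))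
  exact lintegral_cons (fun k => μ (n + k)) hm

lemma map_shift : (Measure.infinitePi μ).map (fun ω k => ω (k + 1)) =
    Measure.infinitePi fun k => μ (k + 1) :=
  Measure.map_infinitePi_infinitePi_of_inj (P := μ) (f := fun k => k + 1)
    (add_left_injective 1)

/-- A function of the coordinates before `n` and a function of coordinate `n` are independent. -/
lemma lintegral_mul_eval (n : ℕ) {f : (ℕ → S) → ℝ≥0∞} (hf : Measurable f)
    (hd : DependsOn f (Set.Iio n)) {g : S → ℝ≥0∞} (hg : Measurable g) :
    ∫⁻ ω, f ω * g (ω n) ∂Measure.infinitePi μ =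
      (∫⁻ ω, f ω ∂Measure.infinitePi μ) * ∫⁻ o, g o ∂μ n := by
  rw [lintegral_glue_cons μ n (F := fun ω => f ω * g (ω n))
    (hf.mul (hg.comp (measurable_pi_apply n))), ← lintegral_mul_const _ hf]
  refine lintegral_congr fun ω => ?_
  rw [← lintegral_const_mul _ hg]
  refine lintegral_congr fun o => ?_
  have h1 : ∀ ω', f (glue n ω (cons o ω')) = f ω := fun ω' =>
    hd fun k hk => glue_lt hk _ _
  simp [h1, glue_self, cons]

end Glue

/-! ### Chains driven by independent input and their mean hitting times. -/

section Chain

variable {S Ω : Type*} (step : S → Ω → S)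

/-- The trajectory, started at `s`, of the chain driven by the sequence `ω`. -/
def run (s : S) (ω : ℕ → Ω) : ℕ → S
  | 0 => s
  | n + 1 => step (run s ω n) (ω n)

lemma run_cons (s : S) (o : Ω) (ω : ℕ → Ω) (n : ℕ) :
    run step s (cons o ω) (n + 1) = run step (step s o) ω n := by
  induction n with
  | zero => rfl
  | succ n ih => rw [run, ih]; rfl

lemma run_add (s : S) (ω : ℕ → Ω) (m n : ℕ) :
    run step s ω (m + n) = run step (run step s ω m) (fun k => ω (m + k)) n := by
  induction n with
  | zero => rfl
  | succ n ih => rw [← add_assoc, run, ih]; rfl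

variable {step} in
lemma run_mem {R : Set S} (hR : ∀ s ∈ R, ∀ o, step s o ∈ R) {s : S} (hs : s ∈ R) (ω : ℕ → Ω)
    (n : ℕ) : run step s ω n ∈ R := by
  induction n with
  | zero => exact hs
  | succ n ih => exact hR _ ih _

variable [MeasurableSpace S] [MeasurableSpace Ω]

variable {step} in
lemma measurable_run (hstep : Measurable fun q : S × Ω => step q.1 q.2) (n : ℕ) :
    Measurable fun q : S × (ℕ → Ω) => run step q.1 q.2 n := by
  induction n with
  | zero => exact measurable_fst
  | succ n ih =>
    exact hstep.comp (ih.prodMk ((measurable_pi_apply n).comp measurable_snd))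

variable (κ : Measure Ω) (halt : Set S)

/-- The probability that the chain started at `s` does not visit `halt` at the times
`1, …, n`. -/
def hitTail : ℕ → S → ℝ≥0∞
  | 0 => 1
  | n + 1 => fun s => ∫⁻ o, haltᶜ.indicator (hitTail n) (step s o) ∂κ

/-- The mean of the first time `n ≥ 1` at which the chain started at `s` is in `halt`. -/
def meanHit (s : S) : ℝ≥0∞ := ∑' n, hitTail step κ halt n s

/-- The truncated mean hitting time. -/
def meanHitTrunc (n : ℕ) (s : S) : ℝ≥0∞ := ∑ k ∈ Finset.range n, hitTail step κ halt k s

variable {step halt} (hstep : Measurable fun q : S × Ω => step q.1 q.2)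
  (hhalt : MeasurableSet halt) [IsProbabilityMeasure κ]

include hstep hhalt

lemma measurable_hitTail (n : ℕ) : Measurable (hitTail step κ halt n) := by
  induction n with
  | zero => exact measurable_const
  | succ n ih =>
    exact Measurable.lintegral_prod_right'
      (f := fun q : S × Ω => haltᶜ.indicator (hitTail step κ halt n) (step q.1 q.2))
      ((ih.indicator hhalt.compl).comp hstep)

lemma measurable_meanHit : Measurable (meanHit step κ halt) :=
  Measurable.tsum fun n => measurable_hitTail κ hstep hhalt n

lemma measurable_meanHitTrunc (n : ℕ) : Measurable (meanHitTrunc step κ halt n) :=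
  Finset.measurable_fun_sum _ fun k _ => measurable_hitTail κ hstep hhalt k

lemma meanHitTrunc_succ (n : ℕ) (s : S) : meanHitTrunc step κ halt (n + 1) s =
    1 + ∫⁻ o, haltᶜ.indicator (meanHitTrunc step κ halt n) (step s o) ∂κ := by
  rw [meanHitTrunc, Finset.sum_range_succ', add_comm]
  congr 1
  simp only [hitTail]
  rw [← lintegral_finsetSum]
  · refine lintegral_congr fun o => ?_
    by_cases h : step s o ∈ halt <;> simp [h, meanHitTrunc]
  · intro k _
    exact ((measurable_hitTail κ hstep hhalt k).indicator hhalt.compl).comp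
      (hstep.comp (measurable_const.prodMk measurable_id))

omit hstep hhalt [MeasurableSpace S] [IsProbabilityMeasure κ] in
lemma meanHit_eq_iSup (s : S) : meanHit step κ halt s = ⨆ n, meanHitTrunc step κ halt n s :=
  ENNReal.tsum_eq_iSup_nat

omit hstep hhalt [MeasurableSpace S] [IsProbabilityMeasure κ] in
lemma meanHitTrunc_le_meanHit (n : ℕ) (s : S) :
    meanHitTrunc step κ halt n s ≤ meanHit step κ halt s :=
  ENNReal.sum_le_tsum _

lemma meanHit_eq (s : S) : meanHit step κ halt s =
    1 + ∫⁻ o, haltᶜ.indicator (meanHit step κ halt) (step s o) ∂κ := by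
  rw [meanHit, tsum_eq_zero_add' ENNReal.summable]
  congr 1
  simp only [hitTail]
  rw [← lintegral_tsum]
  · refine lintegral_congr fun o => ?_
    by_cases h : step s o ∈ halt <;> simp [h, meanHit]
  · intro k
    exact (((measurable_hitTail κ hstep hhalt k).indicator hhalt.compl).comp
      (hstep.comp (measurable_const.prodMk measurable_id))).aemeasurable

/-- The truncated means are the iterates, started at zero, of the monotone one-step operator, so
they stay below any supersolution. Monotonicity of the lower integral suffices, so `Φ` may be an
arbitrary function, and it matters only on an invariant set `R`. -/
lemma meanHit_le_of_supersolution {R : Set S} (hR : ∀ s ∈ R, ∀ o, step s o ∈ R)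
    {Φ : S → ℝ≥0∞}
    (hΦ : ∀ s ∈ R, s ∉ halt → 1 + ∫⁻ o, haltᶜ.indicator Φ (step s o) ∂κ ≤ Φ s) {s : S}
    (hs : s ∈ R) (hs' : s ∉ halt) : meanHit step κ halt s ≤ Φ s := by
  rw [meanHit_eq_iSup]
  refine iSup_le fun n => ?_
  induction n generalizing s with
  | zero => simp [meanHitTrunc]
  | succ n ih =>
    rw [meanHitTrunc_succ κ hstep hhalt]
    refine le_trans ?_ (hΦ s hs hs')
    refine add_le_add le_rfl (lintegral_mono fun o => ?_)
    by_cases h : step s o ∈ halt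
    · simp [h]
    · simpa [h] using ih (hR s hs o) h

/-- Conditioning on the first input identifies the recursively defined tail with a probability on
path space. -/
lemma measure_forall_notMem_halt (n : ℕ) (s : S) :
    Measure.infinitePi (fun _ : ℕ => κ) {ω | ∀ k < n, run step s ω (k + 1) ∉ halt} =
      hitTail step κ halt n s := by
  have hmeas : ∀ (n : ℕ), MeasurableSet
      {q : S × (ℕ → Ω) | ∀ k < n, run step q.1 q.2 (k + 1) ∉ halt} := by
    intro n
    have : {q : S × (ℕ → Ω) | ∀ k < n, run step q.1 q.2 (k + 1) ∉ halt} =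
        ⋂ k : ℕ, ⋂ _ : k < n, (fun q : S × (ℕ → Ω) => run step q.1 q.2 (k + 1)) ⁻¹' haltᶜ := by
      ext q; simp
    rw [this]
    exact MeasurableSet.iInter fun k => MeasurableSet.iInter fun _ =>
      measurable_run hstep (k + 1) hhalt.compl
  have hmeas' : ∀ (n : ℕ) (s : S), MeasurableSet
      {ω : ℕ → Ω | ∀ k < n, run step s ω (k + 1) ∉ halt} := fun n s =>
    (measurable_const.prodMk measurable_id : Measurable fun ω : ℕ → Ω => (s, ω)) (hmeas n)
  induction n generalizing s with
  | zero => simp [hitTail]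
  | succ n ih =>
    rw [← lintegral_indicator_one (hmeas' _ _), lintegral_cons _
      (measurable_one.indicator (hmeas' _ _)), hitTail]
    refine lintegral_congr fun o => ?_
    by_cases h : step s o ∈ halt
    · rw [Set.indicator_of_notMem (by simpa using h)]
      rw [lintegral_eq_zero_iff' ]
      · refine Eventually.of_forall fun ω' => ?_
        refine Set.indicator_of_notMem ?_ _
        intro hc
        exact hc 0 (Nat.succ_pos n) h
      · exact ((measurable_one.indicator (hmeas' _ _)).comp
          (measurable_cons.comp (measurable_const.prodMk measurable_id))).aemeasurable
    · rw [Set.indicator_of_mem (by simpa using h), ← ih, ← lintegral_indicator_one (hmeas' _ _)]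
      refine lintegral_congr fun ω' => ?_
      have : cons o ω' ∈ {ω : ℕ → Ω | ∀ k < n + 1, run step s ω (k + 1) ∉ halt} ↔
          ω' ∈ {ω : ℕ → Ω | ∀ k < n, run step (step s o) ω (k + 1) ∉ halt} := by
        constructor
        · intro hh k hk
          rw [← run_cons]; exact hh (k + 1) (Nat.succ_lt_succ hk)
        · intro hh k hk
          rw [run_cons]
          cases k with
          | zero => exact h
          | succ k => exact hh k (Nat.lt_of_succ_lt_succ hk)
      by_cases hω : ω' ∈ {ω : ℕ → Ω | ∀ k < n, run step (step s o) ω (k + 1) ∉ halt}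
      · rw [Set.indicator_of_mem hω, Set.indicator_of_mem (this.2 hω)]
        rfl
      · rw [Set.indicator_of_notMem hω, Set.indicator_of_notMem (fun hc => hω (this.1 hc))]

end Chain

/-! ### First passage times and their means. -/

section FirstPassage

lemma firstPassage_le_iff {D : ℕ → ℝ} {A : ℝ} {n : ℕ} :
    firstPassage D A ≤ n ↔ ∃ k, 1 ≤ k ∧ k ≤ n ∧ A < D k := by
  constructor
  · intro h
    by_contra hc
    push Not at hc
    have h1 : ((n + 1 : ℕ) : ℕ∞) ≤ firstPassage D A := by
      refine le_iInf fun k => le_iInf fun hk => le_iInf fun hA => ?_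
      have : n < k := by
        by_contra hkn
        exact absurd (hc k hk (not_lt.1 hkn)) (not_le.2 hA)
      exact_mod_cast this
    have h2 : ((n + 1 : ℕ) : ℕ∞) ≤ n := h1.trans h
    have : n + 1 ≤ n := by exact_mod_cast h2
    omega
  · rintro ⟨k, h1, h2, h3⟩
    refine le_trans (iInf_le_of_le k (iInf_le_of_le h1 (iInf_le_of_le h3 le_rfl))) ?_
    exact_mod_cast h2

lemma lt_firstPassage_iff {D : ℕ → ℝ} {A : ℝ} {n : ℕ} :
    (n : ℕ∞) < firstPassage D A ↔ ∀ k < n, ¬ A < D (k + 1) := by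
  rw [← not_le, firstPassage_le_iff]
  push Not
  constructor
  · intro h k hk
    exact h (k + 1) (by omega) (by omega)
  · intro h k h1 h2
    obtain ⟨j, rfl⟩ := Nat.exists_eq_add_of_le' h1
    exact h j (by omega)

lemma toENNReal_eq_tsum (τ : ℕ∞) :
    ((τ : ℕ∞) : ℝ≥0∞) = ∑' n : ℕ, if (n : ℕ∞) < τ then (1 : ℝ≥0∞) else 0 := by
  induction τ using ENat.recTopCoe with
  | top => simp
  | coe t =>
    rw [tsum_eq_sum (s := Finset.range t)]
    · rw [Finset.sum_congr rfl (g := fun _ => (1 : ℝ≥0∞))]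
      · simp
      · intro n hn
        simp only [Finset.mem_range] at hn
        rw [if_pos (by exact_mod_cast hn)]
    · intro n hn
      simp only [Finset.mem_range] at hn
      rw [if_neg (by exact_mod_cast hn)]

lemma lintegral_toENNReal_eq_tsum {Ω : Type*} [MeasurableSpace Ω] (P : Measure Ω)
    {τ : Ω → ℕ∞} (hτ : ∀ n : ℕ, MeasurableSet {ω | τ ω ≤ n}) :
    ∫⁻ ω, ((τ ω : ℕ∞) : ℝ≥0∞) ∂P = ∑' n : ℕ, P {ω | (n : ℕ∞) < τ ω} := by
  have hm : ∀ n : ℕ, MeasurableSet {ω | (n : ℕ∞) < τ ω} := fun n => by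
    have : {ω | (n : ℕ∞) < τ ω} = {ω | τ ω ≤ n}ᶜ := by ext; simp
    rw [this]; exact (hτ n).compl
  simp_rw [toENNReal_eq_tsum]
  rw [lintegral_tsum]
  · refine tsum_congr fun n => ?_
    rw [← lintegral_indicator_one (hm n)]
    exact lintegral_congr fun ω => by simp [Set.indicator_apply]
  · intro n
    exact (Measurable.ite (hm n) measurable_const measurable_const).aemeasurable

lemma measurable_of_measurableSet_le {Ω : Type*} {mΩ : MeasurableSpace Ω} {τ : Ω → ℕ∞}
    (hτ : ∀ n : ℕ, MeasurableSet {ω | τ ω ≤ n}) : Measurable τ := by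
  refine ENat.measurable_iff.2 fun n => ?_
  cases n with
  | zero =>
    convert hτ 0 using 1
    ext ω; simp
  | succ n =>
    convert (hτ (n + 1)).diff (hτ n) using 1
    ext ω
    simp only [Set.mem_preimage, Set.mem_singleton_iff, Set.mem_sdiff, Set.mem_ofPred_eq, not_le]
    constructor
    · intro h; rw [h]; exact ⟨le_rfl, by exact_mod_cast Nat.lt_succ_self n⟩
    · rintro ⟨h1, h2⟩
      exact le_antisymm h1 (by simpa using Order.add_one_le_of_lt h2)

variable {S Ω : Type*} [MeasurableSpace S] [MeasurableSpace Ω] {step : S → Ω → S}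
  (κ : Measure Ω) [IsProbabilityMeasure κ]

lemma measurable_firstPassage_run (hstep : Measurable fun q : S × Ω => step q.1 q.2) {D : S → ℝ}
    (hD : Measurable D) (A : ℝ) :
    Measurable fun q : S × (ℕ → Ω) => firstPassage (fun n => D (run step q.1 q.2 n)) A := by
  refine measurable_of_measurableSet_le fun n => ?_
  have : {q : S × (ℕ → Ω) | firstPassage (fun n => D (run step q.1 q.2 n)) A ≤ n} =
      ⋃ k : ℕ, ⋃ _ : 1 ≤ k, ⋃ _ : k ≤ n,
        (fun q : S × (ℕ → Ω) => D (run step q.1 q.2 k)) ⁻¹' Set.Ioi A := by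
    ext q
    simp only [firstPassage_le_iff, Set.mem_ofPred_eq, Set.mem_iUnion, Set.mem_preimage,
      Set.mem_Ioi, exists_prop]
  rw [this]
  exact MeasurableSet.iUnion fun k => MeasurableSet.iUnion fun _ => MeasurableSet.iUnion fun _ =>
    (hD.comp (measurable_run hstep k)) measurableSet_Ioi

lemma measurable_toENNReal_firstPassage_run (hstep : Measurable fun q : S × Ω => step q.1 q.2)
    {D : S → ℝ} (hD : Measurable D) (A : ℝ) :
    Measurable fun q : S × (ℕ → Ω) =>
      ((firstPassage (fun n => D (run step q.1 q.2 n)) A : ℕ∞) : ℝ≥0∞) := by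
  have h : Measurable fun τ : ℕ∞ => (τ : ℝ≥0∞) := Measurable.of_discrete
  exact h.comp (measurable_firstPassage_run hstep hD A)

lemma measurable_toENNReal_firstPassage_run_left
    (hstep : Measurable fun q : S × Ω => step q.1 q.2)
    {D : S → ℝ} (hD : Measurable D) (A : ℝ) (s : S) :
    Measurable fun ω : ℕ → Ω => ((firstPassage (fun n => D (run step s ω n)) A : ℕ∞) : ℝ≥0∞) :=
  (measurable_toENNReal_firstPassage_run hstep hD A).of_uncurry_left (x := s)
    (f := fun s ω => ((firstPassage (fun n => D (run step s ω n)) A : ℕ∞) : ℝ≥0∞))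

/-- The layer-cake sum `E τ = ∑ P(τ > n)` turns a mean over paths into a quantity governed by
one-step equations. -/
lemma lintegral_firstPassage_run (hstep : Measurable fun q : S × Ω => step q.1 q.2) {D : S → ℝ}
    (hD : Measurable D) (A : ℝ) (s : S) :
    ∫⁻ ω, ((firstPassage (fun n => D (run step s ω n)) A : ℕ∞) : ℝ≥0∞)
      ∂Measure.infinitePi (fun _ : ℕ => κ) = meanHit step κ {s | A < D s} s := by
  rw [lintegral_toENNReal_eq_tsum, meanHit]
  · refine tsum_congr fun n => ?_
    rw [← measure_forall_notMem_halt κ hstep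
      (show MeasurableSet {s | A < D s} from hD measurableSet_Ioi)]
    congr 1
    ext ω
    simp only [Set.mem_ofPred_eq, lt_firstPassage_iff]
  · intro n
    exact ((measurable_firstPassage_run hstep hD A).comp
      (measurable_const.prodMk measurable_id : Measurable fun ω : ℕ → Ω => (s, ω)))
      (MeasurableSet.of_discrete (s := Set.Iic (n : ℕ∞)))

end FirstPassage

/-! ### Likelihood ratios of a single experiment. -/

namespace Experiment

variable {𝒳 : Type*} [MeasurableSpace 𝒳] (E : Experiment 𝒳)

instance isProbabilityMeasure_law₀ : IsProbabilityMeasure E.law₀ :=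
  ⟨by rw [law₀, withDensity_apply _ MeasurableSet.univ, Measure.restrict_univ, E.lintegral_f₀]⟩

instance isProbabilityMeasure_law₁ : IsProbabilityMeasure E.law₁ :=
  ⟨by rw [law₁, withDensity_apply _ MeasurableSet.univ, Measure.restrict_univ, E.lintegral_f₁]⟩

lemma measurable_llr : Measurable E.llr :=
  Real.measurable_log.comp
    (E.measurable_f₁.coe_nnreal_real.div E.measurable_f₀.coe_nnreal_real)

variable {E} (hE : E.FiniteLLR)
include hE

lemma lintegral_law₀_mul_exp {g : 𝒳 → ℝ≥0∞} (hg : Measurable g) :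
    ∫⁻ x, g x * ENNReal.ofReal (Real.exp (E.llr x)) ∂E.law₀ = ∫⁻ x, g x ∂E.law₁ := by
  have hm : Measurable fun x => ENNReal.ofReal (Real.exp (E.llr x)) :=
    (Real.measurable_exp.comp E.measurable_llr).ennreal_ofReal
  rw [law₀, law₁, lintegral_withDensity_eq_lintegral_mul _ E.measurable_f₀.coe_nnreal_ennreal
    (hg.fun_mul hm), lintegral_withDensity_eq_lintegral_mul _ E.measurable_f₁.coe_nnreal_ennreal hg]
  refine lintegral_congr_ae ?_
  filter_upwards [hE] with x hx
  simp only [Pi.mul_apply]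
  -- Where `f₀` vanishes, so does `f₁`, and both sides are `0` whatever the default value of `log (0
  -- / 0)` is.
  by_cases h0 : E.f₀ x = 0
  · simp [h0, hx.1 h0]
  · have h1 : E.f₁ x ≠ 0 := fun h => h0 (hx.2 h)
    have hp0 : (0 : ℝ) < E.f₀ x := by positivity
    have hp1 : (0 : ℝ) < E.f₁ x := by positivity
    have : (E.f₀ x : ℝ≥0∞) * ENNReal.ofReal (Real.exp (E.llr x)) = E.f₁ x := by
      rw [llr, Real.exp_log (by positivity), ← ENNReal.ofReal_coe_nnreal,
        ← ENNReal.ofReal_mul hp0.le, mul_div_cancel₀ _ hp0.ne', ENNReal.ofReal_coe_nnreal]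
    rw [mul_comm (g x), ← mul_assoc, this]

lemma lintegral_law₁_mul_exp_neg {g : 𝒳 → ℝ≥0∞} (hg : Measurable g) :
    ∫⁻ x, g x * ENNReal.ofReal (Real.exp (-E.llr x)) ∂E.law₁ = ∫⁻ x, g x ∂E.law₀ := by
  have hm : Measurable fun x => ENNReal.ofReal (Real.exp (-E.llr x)) :=
    (Real.measurable_exp.comp E.measurable_llr.neg).ennreal_ofReal
  rw [← lintegral_law₀_mul_exp hE (hg.fun_mul hm)]
  refine lintegral_congr fun x => ?_
  rw [mul_assoc, ← ENNReal.ofReal_mul (Real.exp_pos _).le, ← Real.exp_add]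
  simp

lemma lintegral_exp_llr : ∫⁻ x, ENNReal.ofReal (Real.exp (E.llr x)) ∂E.law₀ = 1 := by
  simpa using lintegral_law₀_mul_exp hE (g := fun _ => 1) measurable_const

lemma lintegral_exp_neg_llr : ∫⁻ x, ENNReal.ofReal (Real.exp (-E.llr x)) ∂E.law₁ = 1 := by
  simpa using lintegral_law₁_mul_exp_neg hE (g := fun _ => 1) measurable_const

lemma integrable_exp_llr : Integrable (fun x => Real.exp (E.llr x)) E.law₀ := by
  refine ⟨(Real.measurable_exp.comp E.measurable_llr).aestronglyMeasurable, ?_⟩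
  rw [hasFiniteIntegral_iff_ofReal (Eventually.of_forall fun x => (Real.exp_pos _).le),
    lintegral_exp_llr hE]
  exact ENNReal.one_lt_top

lemma integrable_exp_neg_llr : Integrable (fun x => Real.exp (-E.llr x)) E.law₁ := by
  refine ⟨(Real.measurable_exp.comp E.measurable_llr.neg).aestronglyMeasurable, ?_⟩
  rw [hasFiniteIntegral_iff_ofReal (Eventually.of_forall fun x => (Real.exp_pos _).le),
    lintegral_exp_neg_llr hE]
  exact ENNReal.one_lt_top

lemma integral_exp_llr : ∫ x, Real.exp (E.llr x) ∂E.law₀ = 1 := by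
  rw [integral_eq_lintegral_of_nonneg_ae (Eventually.of_forall fun x => (Real.exp_pos _).le)
    (integrable_exp_llr hE).1, lintegral_exp_llr hE, ENNReal.toReal_one]

lemma integral_exp_neg_llr : ∫ x, Real.exp (-E.llr x) ∂E.law₁ = 1 := by
  rw [integral_eq_lintegral_of_nonneg_ae (Eventually.of_forall fun x => (Real.exp_pos _).le)
    (integrable_exp_neg_llr hE).1, lintegral_exp_neg_llr hE, ENNReal.toReal_one]

lemma law₁_eq_withDensity :
    E.law₁ = E.law₀.withDensity fun x => ENNReal.ofReal (Real.exp (E.llr x)) := by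
  ext s hs
  rw [withDensity_apply _ hs, ← lintegral_indicator hs, ← lintegral_indicator_one hs,
    ← lintegral_law₀_mul_exp hE (measurable_one.indicator hs)]
  refine lintegral_congr fun x => ?_
  by_cases h : x ∈ s <;> simp [h]

lemma law₀_eq_withDensity :
    E.law₀ = E.law₁.withDensity fun x => ENNReal.ofReal (Real.exp (-E.llr x)) := by
  ext s hs
  rw [withDensity_apply _ hs, ← lintegral_indicator hs, ← lintegral_indicator_one hs,
    ← lintegral_law₁_mul_exp_neg hE (measurable_one.indicator hs)]
  refine lintegral_congr fun x => ?_
  by_cases h : x ∈ s <;> simp [h]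

lemma law₁_absolutelyContinuous : E.law₁ ≪ E.law₀ := by
  rw [law₁_eq_withDensity hE]; exact withDensity_absolutelyContinuous _ _

/-- This links the pointwise definition of `ℓ` to the log-likelihood ratio inside `klDiv`, so that a
finite divergence means integrability of `ℓ` and is its mean. -/
lemma llr_law₁_law₀ : MeasureTheory.llr E.law₁ E.law₀ =ᵐ[E.law₁] E.llr := by
  have h : E.law₁.rnDeriv E.law₀ =ᵐ[E.law₀] fun x => ENNReal.ofReal (Real.exp (E.llr x)) := by
    conv_lhs => rw [law₁_eq_withDensity hE]
    exact Measure.rnDeriv_withDensity _ (Real.measurable_exp.comp E.measurable_llr).ennreal_ofReal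
  filter_upwards [(law₁_absolutelyContinuous hE).ae_eq h] with x hx
  rw [MeasureTheory.llr, hx, ENNReal.toReal_ofReal (Real.exp_pos _).le, Real.log_exp]

lemma integrable_llr (hfin : InformationTheory.klDiv E.law₁ E.law₀ ≠ ∞) :
    Integrable E.llr E.law₁ :=
  (integrable_congr (llr_law₁_law₀ hE)).1 (InformationTheory.klDiv_ne_top_iff.1 hfin).2

lemma integral_llr :
    ∫ x, E.llr x ∂E.law₁ = (InformationTheory.klDiv E.law₁ E.law₀).toReal := by
  rw [InformationTheory.toReal_klDiv_of_measure_eq (law₁_absolutelyContinuous hE) (by simp)]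
  exact integral_congr_ae (llr_law₁_law₀ hE).symm

lemma law_eq_of_llr_eq_zero₀ (h : ∀ᵐ x ∂E.law₀, E.llr x = 0) : E.law₁ = E.law₀ := by
  rw [law₁_eq_withDensity hE]
  have : (fun x => ENNReal.ofReal (Real.exp (E.llr x))) =ᵐ[E.law₀] 1 := by
    filter_upwards [h] with x hx; simp [hx]
  rw [withDensity_congr_ae this, withDensity_one]

lemma law_eq_of_llr_eq_zero₁ (h : ∀ᵐ x ∂E.law₁, E.llr x = 0) : E.law₀ = E.law₁ := by
  rw [law₀_eq_withDensity hE]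
  have : (fun x => ENNReal.ofReal (Real.exp (-E.llr x))) =ᵐ[E.law₁] 1 := by
    filter_upwards [h] with x hx; simp [hx]
  rw [withDensity_congr_ae this, withDensity_one]

/-- Before the change the negative part of `ℓ` need not be integrable, hence the cut at `-1`. The
positive part is harmless because `t ≤ exp t` and `exp ℓ` has mean `1`. -/
lemma integrable_max_llr : Integrable (fun x => max (E.llr x) (-1)) E.law₀ := by
  refine Integrable.mono' ((integrable_const 1).add (integrable_exp_llr hE))
    (E.measurable_llr.max measurable_const).aestronglyMeasurable
    (Eventually.of_forall fun x => ?_)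
  have h1 := Real.add_one_le_exp (E.llr x)
  have h2 := Real.exp_pos (E.llr x)
  simp only [Pi.add_apply, Real.norm_eq_abs]
  rw [abs_le]
  constructor
  · linarith [le_max_right (E.llr x) (-1)]
  · exact max_le (by linarith) (by linarith)

omit hE in
lemma one_add_max_le_exp (t : ℝ) : 1 + max t (-1) ≤ Real.exp t := by
  have h1 := Real.add_one_le_exp t
  have h2 := Real.exp_pos t
  rcases max_cases t (-1 : ℝ) with h | h <;> rw [h.1] <;> linarith

/-- The drift of the log-likelihood ratio, truncated from below, is negative before the change. -/
lemma integral_max_llr_neg (hne : E.law₁ ≠ E.law₀) :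
    ∫ x, max (E.llr x) (-1) ∂E.law₀ < 0 := by
  by_contra hc
  push Not at hc
  refine hne (law_eq_of_llr_eq_zero₀ hE ?_)
  -- The function `exp t - (1 + max t (-1))` is nonnegative and vanishes only at `t = 0`. Its mean
  -- is minus the truncated drift; were that drift nonnegative, `ℓ` would vanish almost everywhere
  -- and the laws would agree.
  have hint : Integrable (fun x => Real.exp (E.llr x) - (1 + max (E.llr x) (-1))) E.law₀ :=
    (integrable_exp_llr hE).sub ((integrable_const 1).add (integrable_max_llr hE))
  have hnn : 0 ≤ᵐ[E.law₀] fun x => Real.exp (E.llr x) - (1 + max (E.llr x) (-1)) :=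
    Eventually.of_forall fun x => sub_nonneg.2 (one_add_max_le_exp _)
  have h0 : ∫ x, (Real.exp (E.llr x) - (1 + max (E.llr x) (-1))) ∂E.law₀ = 0 := by
    refine le_antisymm ?_ (integral_nonneg_of_ae hnn)
    rw [integral_sub (integrable_exp_llr hE)
        (g := fun x => 1 + max (E.llr x) (-1)) ((integrable_const 1).add (integrable_max_llr hE)),
      integral_add (integrable_const 1) (integrable_max_llr hE), integral_exp_llr hE]
    simp only [integral_const, probReal_univ, smul_eq_mul, mul_one]
    linarith
  filter_upwards [(integral_eq_zero_iff_of_nonneg_ae hnn hint).1 h0] with x hx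
  simp only [Pi.zero_apply] at hx
  by_contra hne0
  have h1 := Real.add_one_lt_exp hne0
  have h2 := Real.exp_pos (E.llr x)
  rcases max_cases (E.llr x) (-1 : ℝ) with h | h <;> rw [h.1] at hx <;> linarith

/-- Otherwise `ℓ > -1/(n+1)` almost surely for every `n`, so `ℓ ≥ 0` and the truncated drift could
not be negative. -/
lemma exists_law₀_llr_le_pos (hne : E.law₁ ≠ E.law₀) :
    ∃ δ : ℝ, 0 < δ ∧ E.law₀ {x | E.llr x ≤ -δ} ≠ 0 := by
  by_contra hc
  push Not at hc
  have h1 : ∀ᵐ x ∂E.law₀, ∀ n : ℕ, -(1 / ((n : ℝ) + 1)) < E.llr x := by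
    refine ae_all_iff.2 fun n => ?_
    have := hc (1 / ((n : ℝ) + 1)) (by positivity)
    rw [ae_iff]
    simpa using this
  have h2 : ∀ᵐ x ∂E.law₀, 0 ≤ max (E.llr x) (-1) := by
    filter_upwards [h1] with x hx
    refine le_trans ?_ (le_max_left _ _)
    have ht : Tendsto (fun n : ℕ => -(1 / ((n : ℝ) + 1))) atTop (nhds (-0)) :=
      tendsto_one_div_add_atTop_nhds_zero_nat.neg
    rw [neg_zero] at ht
    exact le_of_tendsto' ht fun n => (hx n).le
  exact absurd (integral_nonneg_of_ae h2) (not_le.2 (integral_max_llr_neg hE hne))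

/-- The Hellinger affinity of two different laws is less than one. -/
lemma exists_hellinger_lt_one (hne : E.law₁ ≠ E.law₀) :
    ∃ ρ : ℝ, 0 ≤ ρ ∧ ρ < 1 ∧
      ∫⁻ x, ENNReal.ofReal (Real.exp (-E.llr x / 2)) ∂E.law₁ = ENNReal.ofReal ρ := by
  have hsq : ∀ x, Real.exp (-E.llr x) = Real.exp (-E.llr x / 2) ^ 2 := fun x => by
    rw [← Real.exp_nat_mul]; congr 1; push_cast; ring
  have hI : Integrable (fun x => Real.exp (-E.llr x / 2)) E.law₁ := by
    refine Integrable.mono' ((integrable_const 1).add (integrable_exp_neg_llr hE))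
      (Real.measurable_exp.comp (E.measurable_llr.neg.div_const 2)).aestronglyMeasurable
      (Eventually.of_forall fun x => ?_)
    simp only [Pi.add_apply, Real.norm_eq_abs, Real.abs_exp, hsq]
    nlinarith [sq_nonneg (Real.exp (-E.llr x / 2) - 1), Real.exp_pos (-E.llr x / 2)]
  refine ⟨∫ x, Real.exp (-E.llr x / 2) ∂E.law₁,
    integral_nonneg fun x => (Real.exp_pos _).le, ?_, ?_⟩
  · by_contra hc
    push Not at hc
    refine hne (law_eq_of_llr_eq_zero₁ hE ?_).symm
    -- The integrand is the square of `exp(-ℓ/2) - 1`, with mean `2 - 2ρ`. If `ρ ≥ 1` it vanishes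
    -- almost everywhere and the laws agree.
    have hint : Integrable (fun x => (1 + Real.exp (-E.llr x)) - 2 * Real.exp (-E.llr x / 2))
        E.law₁ := ((integrable_const 1).add (integrable_exp_neg_llr hE)).sub (hI.const_mul 2)
    have hnn : 0 ≤ᵐ[E.law₁] fun x => (1 + Real.exp (-E.llr x)) - 2 * Real.exp (-E.llr x / 2) :=
      Eventually.of_forall fun x => by
        simp only [Pi.zero_apply, hsq]
        nlinarith [sq_nonneg (Real.exp (-E.llr x / 2) - 1)]
    have h0 : ∫ x, ((1 + Real.exp (-E.llr x)) - 2 * Real.exp (-E.llr x / 2)) ∂E.law₁ = 0 := by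
      refine le_antisymm ?_ (integral_nonneg_of_ae hnn)
      rw [integral_sub (f := fun x => 1 + Real.exp (-E.llr x)) ((integrable_const 1).add (integrable_exp_neg_llr hE)) (hI.const_mul 2),
        integral_add (integrable_const 1) (integrable_exp_neg_llr hE), integral_exp_neg_llr hE,
        integral_const_mul]
      simp only [integral_const, probReal_univ, smul_eq_mul, mul_one]
      linarith
    filter_upwards [(integral_eq_zero_iff_of_nonneg_ae hnn hint).1 h0] with x hx
    simp only [Pi.zero_apply, hsq] at hx
    have h1 : (Real.exp (-E.llr x / 2) - 1) ^ 2 = 0 := by rw [← hx]; ring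
    have h2 : Real.exp (-E.llr x / 2) = 1 := by
      have := pow_eq_zero_iff (two_ne_zero) |>.1 h1
      linarith
    have h3 := Real.exp_eq_one_iff _ |>.1 h2
    linarith
  · rw [ofReal_integral_eq_lintegral_ofReal hI (Eventually.of_forall fun x => (Real.exp_pos _).le)]

omit hE in
-- Dominated convergence: capping the increments loses arbitrarily little drift. The cap will bound
-- the overshoot of CUSUM over its threshold.
lemma exists_lt_integral_min_llr (hint : Integrable E.llr E.law₁) {I' : ℝ}
    (hI' : I' < ∫ x, E.llr x ∂E.law₁) :
    ∃ M : ℝ, 0 ≤ M ∧ Integrable (fun x => min (E.llr x) M) E.law₁ ∧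
      I' < ∫ x, min (E.llr x) M ∂E.law₁ := by
  have hbound : ∀ n : ℕ, ∀ x, ‖min (E.llr x) (n : ℝ)‖ ≤ ‖E.llr x‖ := fun n x => by
    rw [Real.norm_eq_abs, Real.norm_eq_abs, abs_le]
    constructor
    · exact le_min (neg_abs_le _) (le_trans (neg_nonpos.2 (abs_nonneg _)) n.cast_nonneg)
    · exact (min_le_left _ _).trans (le_abs_self _)
  have hmeas : ∀ n : ℕ, AEStronglyMeasurable (fun x => min (E.llr x) (n : ℝ)) E.law₁ := fun n =>
    (E.measurable_llr.min measurable_const).aestronglyMeasurable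
  have ht : Tendsto (fun n : ℕ => ∫ x, min (E.llr x) (n : ℝ) ∂E.law₁) atTop
      (nhds (∫ x, E.llr x ∂E.law₁)) := by
    refine tendsto_integral_of_dominated_convergence (fun x => ‖E.llr x‖) hmeas hint.norm
      (fun n => Eventually.of_forall (hbound n)) (Eventually.of_forall fun x => ?_)
    refine tendsto_const_nhds.congr' ?_
    filter_upwards [eventually_ge_atTop ⌈E.llr x⌉₊] with n hn
    exact (min_eq_left ((Nat.le_ceil _).trans (by exact_mod_cast hn))).symm
  obtain ⟨n, hn⟩ := ((tendsto_order.1 ht).1 I' hI').exists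
  exact ⟨n, n.cast_nonneg, hint.norm.mono' (hmeas n) (Eventually.of_forall (hbound n)), hn⟩

end Experiment

/-! ### Measurability of the states and of the transition. -/

instance : MeasurableSpace DEState :=
  MeasurableSpace.comap (fun s : DEState => (s.next, s.D, s.level, s.usedX, s.usedIdle))
    inferInstance

namespace DEState

lemma measurable_toProd :
    Measurable fun s : DEState => (s.next, s.D, s.level, s.usedX, s.usedIdle) :=
  comap_measurable _

lemma measurable_next : Measurable DEState.next := measurable_fst.comp measurable_toProd

lemma measurable_D : Measurable DEState.D :=
  measurable_fst.comp (measurable_snd.comp measurable_toProd)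

lemma measurable_level : Measurable DEState.level :=
  measurable_fst.comp (measurable_snd.comp (measurable_snd.comp measurable_toProd))

lemma measurable_usedX : Measurable DEState.usedX :=
  measurable_fst.comp (measurable_snd.comp (measurable_snd.comp
    (measurable_snd.comp measurable_toProd)))

lemma measurable_usedIdle : Measurable DEState.usedIdle :=
  measurable_snd.comp (measurable_snd.comp (measurable_snd.comp
    (measurable_snd.comp measurable_toProd)))

lemma measurable_mk {α : Type*} {mα : MeasurableSpace α} {a : α → Choice} {b c : α → ℝ}
    {d e : α → ℕ} (ha : Measurable a) (hb : Measurable b) (hc : Measurable c) (hd : Measurable d)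
    (he : Measurable e) : Measurable fun x => (⟨a x, b x, c x, d x, e x⟩ : DEState) :=
  measurable_comap_iff.2 (ha.prodMk (hb.prodMk (hc.prodMk (hd.prodMk he))))

lemma measurable_atY {α : Type*} {mα : MeasurableSpace α} {b : α → ℝ} (hb : Measurable b) :
    Measurable fun x => DEState.atY (b x) :=
  measurable_mk measurable_const hb measurable_const measurable_const measurable_const

end DEState

lemma measurable_randRound (N : ℝ) : Measurable (randRound N) := by
  refine measurable_const.add (Measurable.ite ?_ measurable_const measurable_const)
  exact measurableSet_lt measurable_subtype_coe measurable_const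

/-- The transition of the algorithm as a function of the increment `x` and of the two answers
whether the limits of `X` and of the idle period are exhausted. -/
def stepB (p : DEParams) (s : DEState) (x : ℝ) (bX bI : Bool) : DEState :=
  if s.next = .expY then
    if 0 ≤ s.D + x then DEState.atY (s.D + x)
    else if bX = true then DEState.atY 0
    else ⟨.expX, p.aY * (s.D + x), p.aY * (s.D + x), 0, 0⟩
  else if s.next = .expX then
    if 0 ≤ s.D + x then DEState.atY 0
    else if bX = true then DEState.atY 0
    else if s.level ≤ s.D + x then ⟨.expX, s.D + x, s.level, s.usedX + 1, 0⟩
    else if bI = true then ⟨.expX, s.level, s.level, s.usedX + 1, 0⟩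
    else ⟨.idle, p.aX * (s.D + x), s.level, s.usedX + 1, 0⟩
  else
    if s.level < s.D + p.μ then ⟨.expX, s.level, s.level, s.usedX, 0⟩
    else if bI = true then ⟨.expX, s.level, s.level, s.usedX, 0⟩
    else ⟨.idle, s.D + p.μ, s.level, s.usedX, s.usedIdle + 1⟩

/-- The number of uses of `X` after the next step. -/
def DEState.cntX (s : DEState) : ℕ := if s.next = .expX then s.usedX + 1 else 0

/-- The number of updates in the current idle period after the next step. -/
def DEState.cntI (s : DEState) : ℕ := if s.next = .idle then s.usedIdle + 1 else 0

lemma measurable_stepB (p : DEParams) : Measurable fun q : DEState × ℝ × Bool × Bool =>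
    stepB p q.1 q.2.1 q.2.2.1 q.2.2.2 := by
  have hn : Measurable fun q : DEState × ℝ × Bool × Bool => q.1.next :=
    DEState.measurable_next.comp measurable_fst
  have hD : Measurable fun q : DEState × ℝ × Bool × Bool => q.1.D :=
    DEState.measurable_D.comp measurable_fst
  have hl : Measurable fun q : DEState × ℝ × Bool × Bool => q.1.level :=
    DEState.measurable_level.comp measurable_fst
  have hu : Measurable fun q : DEState × ℝ × Bool × Bool => q.1.usedX :=
    DEState.measurable_usedX.comp measurable_fst
  have hi : Measurable fun q : DEState × ℝ × Bool × Bool => q.1.usedIdle :=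
    DEState.measurable_usedIdle.comp measurable_fst
  have hx : Measurable fun q : DEState × ℝ × Bool × Bool => q.2.1 :=
    measurable_fst.comp measurable_snd
  have hb : Measurable fun q : DEState × ℝ × Bool × Bool => q.2.2.1 :=
    measurable_fst.comp (measurable_snd.comp measurable_snd)
  have hc : Measurable fun q : DEState × ℝ × Bool × Bool => q.2.2.2 :=
    measurable_snd.comp (measurable_snd.comp measurable_snd)
  have hd := hD.add hx
  have hb' : MeasurableSet {q : DEState × ℝ × Bool × Bool | q.2.2.1 = true} :=
    hb (measurableSet_singleton true)
  have hc' : MeasurableSet {q : DEState × ℝ × Bool × Bool | q.2.2.2 = true} :=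
    hc (measurableSet_singleton true)
  have hd' : MeasurableSet {q : DEState × ℝ × Bool × Bool | 0 ≤ q.1.D + q.2.1} :=
    measurableSet_le measurable_const hd
  refine Measurable.ite (hn (measurableSet_singleton _)) ?_
    (Measurable.ite (hn (measurableSet_singleton _)) ?_ ?_)
  · exact Measurable.ite hd' (DEState.measurable_atY hd) (Measurable.ite hb' measurable_const
      (DEState.measurable_mk measurable_const (hd.const_mul _) (hd.const_mul _) measurable_const
        measurable_const))
  · refine Measurable.ite hd' measurable_const (Measurable.ite hb' measurable_const
      (Measurable.ite (measurableSet_le hl hd) ?_ (Measurable.ite hc' ?_ ?_)))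
    · exact DEState.measurable_mk measurable_const hd hl (hu.add measurable_const) measurable_const
    · exact DEState.measurable_mk measurable_const hl hl (hu.add measurable_const) measurable_const
    · exact DEState.measurable_mk measurable_const (hd.const_mul _) hl (hu.add measurable_const)
        measurable_const
  · refine Measurable.ite (measurableSet_lt hl (hD.add measurable_const)) ?_
      (Measurable.ite hc' ?_ ?_)
    · exact DEState.measurable_mk measurable_const hl hl hu measurable_const
    · exact DEState.measurable_mk measurable_const hl hl hu measurable_const
    · exact DEState.measurable_mk measurable_const (hD.add measurable_const) hl hu
        (hi.add measurable_const)

lemma DEState.measurable_cntX : Measurable DEState.cntX :=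
  Measurable.ite (DEState.measurable_next (measurableSet_singleton _))
    (DEState.measurable_usedX.add measurable_const) measurable_const

lemma DEState.measurable_cntI : Measurable DEState.cntI :=
  Measurable.ite (DEState.measurable_next (measurableSet_singleton _))
    (DEState.measurable_usedIdle.add measurable_const) measurable_const

lemma measurable_decide_le {α : Type*} {mα : MeasurableSpace α} {f g : α → ℕ}
    (hf : Measurable f) (hg : Measurable g) : Measurable fun x => decide (f x ≤ g x) := by
  have h := measurableSet_le hf hg
  have : (fun x => decide (f x ≤ g x)) = fun x => if f x ≤ g x then true else false := by
    funext x; by_cases hx : f x ≤ g x <;> simp [hx]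
  rw [this]
  exact Measurable.ite h measurable_const measurable_const

lemma measurable_obsY {𝒳 𝒴 : Type*} [MeasurableSpace 𝒳] [MeasurableSpace 𝒴] :
    Measurable fun o : (𝒳 × 𝒴) × Seed => o.1.2 := measurable_snd.comp measurable_fst

lemma measurable_obsX {𝒳 𝒴 : Type*} [MeasurableSpace 𝒳] [MeasurableSpace 𝒴] :
    Measurable fun o : (𝒳 × 𝒴) × Seed => o.1.1 := measurable_fst.comp measurable_fst

namespace Model

variable {𝒳 𝒴 : Type*} [MeasurableSpace 𝒳] [MeasurableSpace 𝒴] (M : Model 𝒳 𝒴)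

/-- The log-likelihood ratio of the observation made when the choice is `c`. -/
def obsLLR (c : Choice) (o : 𝒳 × 𝒴) : ℝ :=
  match c with
  | .expY => M.Y.llr o.2
  | .expX => M.X.llr o.1
  | .idle => 0

/-- The observation enters only through its log-likelihood ratio, the seeds only through two yes/no
answers. This factorization gives joint measurability of the step and, later, adaptedness to the
information of the policy. -/
lemma deStep_eq (p : DEParams) (s : DEState) (o : (𝒳 × 𝒴) × Seed) :
    M.deStep p s o = stepB p s (M.obsLLR s.next o.1) (decide (randRound p.NX o.2.1 ≤ s.cntX))
      (decide (randRound p.N0 o.2.2 ≤ s.cntI)) := by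
  cases h : s.next <;>
    simp only [deStep, stepB, DEState.cntX, DEState.cntI, obsLLR, h, reduceCtorEq, if_true,
      if_false, decide_eq_true_eq]

lemma measurable_obsLLR : Measurable fun q : Choice × (𝒳 × 𝒴) => M.obsLLR q.1 q.2 := by
  have : (fun q : Choice × (𝒳 × 𝒴) => M.obsLLR q.1 q.2) = fun q =>
      if q.1 = .expY then M.Y.llr q.2.2 else if q.1 = .expX then M.X.llr q.2.1 else 0 := by
    funext ⟨c, o⟩
    cases c <;> simp [obsLLR]
  rw [this]
  refine Measurable.ite (measurable_fst (measurableSet_singleton _)) ?_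
    (Measurable.ite (measurable_fst (measurableSet_singleton _)) ?_ measurable_const)
  · exact M.Y.measurable_llr.comp (measurable_snd.comp measurable_snd)
  · exact M.X.measurable_llr.comp (measurable_fst.comp measurable_snd)

lemma measurable_deStep (p : DEParams) :
    Measurable fun q : DEState × ((𝒳 × 𝒴) × Seed) => M.deStep p q.1 q.2 := by
  simp only [deStep_eq]
  refine (measurable_stepB p).comp (measurable_fst.prodMk (Measurable.prodMk ?_
    (Measurable.prodMk ?_ ?_)))
  · exact M.measurable_obsLLR.comp ((DEState.measurable_next.comp measurable_fst).prodMk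
      (measurable_fst.comp measurable_snd))
  · exact measurable_decide_le ((measurable_randRound _).comp
      (measurable_fst.comp (measurable_snd.comp measurable_snd)))
      (DEState.measurable_cntX.comp measurable_fst)
  · exact measurable_decide_le ((measurable_randRound _).comp
      (measurable_snd.comp (measurable_snd.comp measurable_snd)))
      (DEState.measurable_cntI.comp measurable_fst)

end Model

/-! ### Invariants of the reachable states. -/

/-- The properties of the states that the algorithm reaches. -/
def DEState.Reachable (p : DEParams) : Set DEState :=
  {s | (s.next = .expY → 0 ≤ s.D ∧ s = DEState.atY s.D) ∧
    (s.next ≠ .expY → s.D < 0 ∧ s.level < 0) ∧ (s.next = .idle → 1 ≤ s.usedX ∧ 1 ≤ p.NX)}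

lemma DEState.atY_mem {p : DEParams} {d : ℝ} (hd : 0 ≤ d) :
    DEState.atY d ∈ DEState.Reachable p := by
  simp [DEState.Reachable, DEState.atY, hd]

lemma randRound_le (N : ℝ) (u : unitInterval) : randRound N u ≤ ⌊N⌋₊ + 1 := by
  rw [randRound]; split_ifs <;> omega

namespace Model

variable {𝒳 𝒴 : Type*} [MeasurableSpace 𝒳] [MeasurableSpace 𝒴] (M : Model 𝒳 𝒴)
  {p : DEParams}

lemma deStep_mem (hp : p.Positive) (s : DEState) (hs : s ∈ DEState.Reachable p)
    (o : (𝒳 × 𝒴) × Seed) : M.deStep p s o ∈ DEState.Reachable p := by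
  obtain ⟨haX, haY, hN0, hNX, hμ⟩ := hp
  obtain ⟨h1, h2, h3⟩ := hs
  cases h : s.next
  · simp only [deStep, h]
    split_ifs with hd hr
    · exact DEState.atY_mem hd
    · exact DEState.atY_mem le_rfl
    · push Not at hd
      simp [DEState.Reachable, mul_neg_of_pos_of_neg haY hd]
  · simp only [deStep, h]
    have hl := (h2 (by simp [h])).2
    split_ifs with hd hr hld hr'
    · exact DEState.atY_mem le_rfl
    · exact DEState.atY_mem le_rfl
    · push Not at hd
      simp [DEState.Reachable, hd, hl]
    · simp [DEState.Reachable, hl]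
    · push Not at hd hr
      -- The limit has survived at least one use, so its rounding is at least `2`; it is at most
      -- `⌊N_X⌋ + 1`.
      have h4 : 1 ≤ p.NX := by
        have := randRound_le p.NX o.2.1
        exact (Nat.one_le_floor_iff _).1 (by omega)
      simp [DEState.Reachable, hl, mul_neg_of_pos_of_neg haX hd, h4]
  · simp only [deStep, h]
    have hl := (h2 (by simp [h])).2
    split_ifs with hld hr
    · simp [DEState.Reachable, hl]
    · simp [DEState.Reachable, hl]
    · push Not at hld
      have := h3 h
      simp [DEState.Reachable, hl, hld.trans_lt hl, this]

lemma deStep_atY_of_nonneg (d : ℝ) (o : (𝒳 × 𝒴) × Seed) (h : 0 ≤ d + M.Y.llr o.1.2) :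
    M.deStep p (DEState.atY d) o = DEState.atY (d + M.Y.llr o.1.2) := by
  simp [deStep, DEState.atY, h]

lemma deStep_atY_of_neg (d : ℝ) (o : (𝒳 × 𝒴) × Seed) (h : d + M.Y.llr o.1.2 < 0) :
    M.deStep p (DEState.atY d) o = DEState.atY 0 ∨
      (M.deStep p (DEState.atY d) o).next ≠ .expY := by
  simp only [deStep, DEState.atY, not_le.2 h, if_false]
  split_ifs <;> simp

lemma deStep_of_ne (s : DEState) (hs : s.next ≠ .expY) (o : (𝒳 × 𝒴) × Seed) :
    M.deStep p s o = DEState.atY 0 ∨ (M.deStep p s o).next ≠ .expY := by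
  cases h : s.next
  · exact absurd h hs
  · simp only [deStep, h]
    split_ifs <;> simp
  · simp only [deStep, h]
    split_ifs <;> simp

lemma deState_eq_run (p : DEParams) (ω : Sample 𝒳 𝒴) (n : ℕ) :
    M.deState p ω n = run (M.deStep p) (DEState.atY 0) (fun k => ω (k + 1)) n := by
  induction n with
  | zero => rfl
  | succ n ih => rw [deState, ih]; rfl

/-! ### Laws of the coordinates. -/

instance isProbabilityMeasure_joint₀ : IsProbabilityMeasure M.joint₀ := by
  constructor
  have h := congrArg (fun m => m Set.univ) M.fst_joint₀
  simpa [Measure.map_apply measurable_fst MeasurableSet.univ] using h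

instance isProbabilityMeasure_joint₁ : IsProbabilityMeasure M.joint₁ := by
  constructor
  have h := congrArg (fun m => m Set.univ) M.fst_joint₁
  simpa [Measure.map_apply measurable_fst MeasurableSet.univ] using h

/-- The law of one coordinate of the sample before the change. -/
def coord₀ : Measure ((𝒳 × 𝒴) × Seed) := M.joint₀.prod volume

/-- The law of one coordinate of the sample after the change. -/
def coord₁ : Measure ((𝒳 × 𝒴) × Seed) := M.joint₁.prod volume

instance isProbabilityMeasure_coord₀ : IsProbabilityMeasure M.coord₀ := by
  unfold coord₀; infer_instance

instance isProbabilityMeasure_coord₁ : IsProbabilityMeasure M.coord₁ := by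
  unfold coord₁; infer_instance

/-- The law of the coordinate `n` of the sample when the change happens at time `ν`. -/
def coord (ν : ℕ∞) (n : ℕ) : Measure ((𝒳 × 𝒴) × Seed) :=
  if (n : ℕ∞) < ν then M.coord₀ else M.coord₁

instance isProbabilityMeasure_coord (ν : ℕ∞) (n : ℕ) : IsProbabilityMeasure (M.coord ν n) := by
  unfold coord; split_ifs <;> infer_instance

lemma P_eq (ν : ℕ∞) : M.P ν = Measure.infinitePi (M.coord ν) := by
  unfold P
  congr 1
  funext n
  unfold coord coord₀ coord₁
  split_ifs <;> rfl

instance isProbabilityMeasure_P (ν : ℕ∞) : IsProbabilityMeasure (M.P ν) := by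
  rw [P_eq]; infer_instance

lemma coord_top : M.coord ⊤ = fun _ => M.coord₀ := by
  funext n; simp [coord]

lemma coord_of_le (ν n : ℕ) (h : ν ≤ n) : M.coord ν n = M.coord₁ := by
  rw [coord, if_neg (by exact_mod_cast not_lt.2 h)]

lemma coord_of_lt (ν n : ℕ) (h : n < ν) : M.coord ν n = M.coord₀ := by
  rw [coord, if_pos (by exact_mod_cast h)]

lemma lintegral_shift (ν : ℕ∞) {G : (ℕ → (𝒳 × 𝒴) × Seed) → ℝ≥0∞} (hG : Measurable G) :
    ∫⁻ ω, G (fun k => ω (k + 1)) ∂M.P ν =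
      ∫⁻ ω, G ω ∂Measure.infinitePi fun k => M.coord ν (k + 1) := by
  rw [P_eq, ← map_shift, lintegral_map hG]
  exact measurable_pi_iff.2 fun k => measurable_pi_apply (k + 1)

lemma map_Y₀ : M.coord₀.map (fun o => o.1.2) = M.Y.law₀ := by
  have h : (fun o : (𝒳 × 𝒴) × Seed => o.1.2) = Prod.snd ∘ Prod.fst := rfl
  rw [h, ← Measure.map_map measurable_snd measurable_fst, coord₀, Measure.map_fst_prod]
  simp [M.snd_joint₀]

lemma lintegral_Y₀ {g : 𝒴 → ℝ≥0∞} (hg : Measurable g) :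
    ∫⁻ o, g o.1.2 ∂M.coord₀ = ∫⁻ x, g x ∂M.Y.law₀ := by
  rw [← M.map_Y₀, lintegral_map hg measurable_obsY]

lemma map_X₀ : M.coord₀.map (fun o => o.1.1) = M.X.law₀ := by
  have h : (fun o : (𝒳 × 𝒴) × Seed => o.1.1) = Prod.fst ∘ Prod.fst := rfl
  rw [h, ← Measure.map_map measurable_fst measurable_fst, coord₀, Measure.map_fst_prod]
  simp [M.fst_joint₀]

lemma map_Y₁ : M.coord₁.map (fun o => o.1.2) = M.Y.law₁ := by
  have h : (fun o : (𝒳 × 𝒴) × Seed => o.1.2) = Prod.snd ∘ Prod.fst := rfl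
  rw [h, ← Measure.map_map measurable_snd measurable_fst, coord₁, Measure.map_fst_prod]
  simp [M.snd_joint₁]

lemma lintegral_Y₁ {g : 𝒴 → ℝ≥0∞} (hg : Measurable g) :
    ∫⁻ o, g o.1.2 ∂M.coord₁ = ∫⁻ x, g x ∂M.Y.law₁ := by
  rw [← M.map_Y₁, lintegral_map hg measurable_obsY]

lemma map_X₁ : M.coord₁.map (fun o => o.1.1) = M.X.law₁ := by
  have h : (fun o : (𝒳 × 𝒴) × Seed => o.1.1) = Prod.fst ∘ Prod.fst := rfl
  rw [h, ← Measure.map_map measurable_fst measurable_fst, coord₁, Measure.map_fst_prod]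
  simp [M.fst_joint₁]

/-! ### Stopping as a hitting time, and the mean time to false alarm. -/

/-- The states in which the algorithm with threshold `A` stops. -/
def stopSet (A : ℝ) : Set DEState := {s | A < s.D}

lemma measurableSet_stopSet (A : ℝ) : MeasurableSet (stopSet A) :=
  DEState.measurable_D measurableSet_Ioi

lemma lintegral_stopTime_de2e (ν : ℕ∞) {κ : Measure ((𝒳 × 𝒴) × Seed)} [IsProbabilityMeasure κ]
    (hκ : ∀ k, M.coord ν (k + 1) = κ) (A : ℝ) :
    ∫⁻ ω, (((M.de2e A p).stopTime ω : ℕ∞) : ℝ≥0∞) ∂M.P ν =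
      meanHit (M.deStep p) κ (stopSet A) (DEState.atY 0) := by
  have h := lintegral_firstPassage_run κ (M.measurable_deStep p) DEState.measurable_D A
    (DEState.atY 0)
  rw [stopSet, ← h]
  have hG : Measurable fun ω : Sample 𝒳 𝒴 =>
      ((firstPassage (fun n => (run (M.deStep p) (DEState.atY 0) ω n).D) A : ℕ∞) : ℝ≥0∞) :=
    measurable_toENNReal_firstPassage_run_left (M.measurable_deStep p) DEState.measurable_D A _
  have h2 := M.lintegral_shift ν hG
  simp only [hκ] at h2
  rw [← h2]
  simp only [de2e, deState_eq_run]

lemma ARLFA_de2e (A : ℝ) : M.ARLFA (M.de2e A p) =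
    meanHit (M.deStep p) M.coord₀ (stopSet A) (DEState.atY 0) :=
  M.lintegral_stopTime_de2e ⊤ (fun k => by rw [coord_top]) A

lemma meanStop₁_de2e (A : ℝ) : M.meanStop₁ (M.de2e A p) =
    meanHit (M.deStep p) M.coord₁ (stopSet A) (DEState.atY 0) := by
  refine M.lintegral_stopTime_de2e 1 (fun k => ?_) A
  exact M.coord_of_le 1 (k + 1) (by omega)

/-- Optional stopping for `e^(D⁺)`, written as an induction. The truncated mean plus `e^A P(τ > n)`
obeys the one-step recursion, and `e^A + 1 - e^(D⁺)` stays below it. The second term is the boundary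
term of the truncation: it makes the case `n = 0` trivial and disappears in the limit. -/
lemma exp_le_meanHit (hX : M.Y.FiniteLLR) (hp : p.Positive) {A : ℝ} (hA : 0 ≤ A) (n : ℕ)
    {s : DEState} (hs : s ∈ DEState.Reachable p) :
    ENNReal.ofReal (Real.exp A) + 1 ≤ ENNReal.ofReal (Real.exp (max s.D 0)) +
      (meanHitTrunc (M.deStep p) M.coord₀ (stopSet A) n s +
        ENNReal.ofReal (Real.exp A) * hitTail (M.deStep p) M.coord₀ (stopSet A) n s) := by
  have hstep := M.measurable_deStep p
  have hhalt := measurableSet_stopSet A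
  induction n generalizing s with
  | zero =>
    simp only [hitTail, meanHitTrunc, Finset.range_zero, Finset.sum_empty, zero_add, Pi.one_apply,
      mul_one]
    rw [add_comm]
    gcongr
    rw [← ENNReal.ofReal_one]
    exact ENNReal.ofReal_le_ofReal (Real.one_le_exp (le_max_right _ _))
  | succ n ih =>
    set V : DEState → ℝ≥0∞ := fun s => meanHitTrunc (M.deStep p) M.coord₀ (stopSet A) n s +
        ENNReal.ofReal (Real.exp A) * hitTail (M.deStep p) M.coord₀ (stopSet A) n s with hV
    have hrec : meanHitTrunc (M.deStep p) M.coord₀ (stopSet A) (n + 1) s +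
        ENNReal.ofReal (Real.exp A) * hitTail (M.deStep p) M.coord₀ (stopSet A) (n + 1) s =
        1 + ∫⁻ o, (stopSet A)ᶜ.indicator V (M.deStep p s o) ∂M.coord₀ := by
      have hm1 : Measurable fun o => (stopSet A)ᶜ.indicator
          (meanHitTrunc (M.deStep p) M.coord₀ (stopSet A) n) (M.deStep p s o) :=
        ((measurable_meanHitTrunc _ hstep hhalt n).indicator hhalt.compl).comp
          (hstep.comp (measurable_const.prodMk measurable_id))
      have hm2 : Measurable fun o => (stopSet A)ᶜ.indicator
          (hitTail (M.deStep p) M.coord₀ (stopSet A) n) (M.deStep p s o) :=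
        ((measurable_hitTail _ hstep hhalt n).indicator hhalt.compl).comp
          (hstep.comp (measurable_const.prodMk measurable_id))
      rw [meanHitTrunc_succ _ hstep hhalt, hitTail, add_assoc, ← lintegral_const_mul _ hm2,
        ← lintegral_add_left hm1]
      congr 1
      refine lintegral_congr fun o => ?_
      by_cases h : M.deStep p s o ∈ stopSet A <;> simp [h, hV]
    rw [hrec]
    -- At or below `0` one has `e^(D⁺) = 1`, which cancels the extra `1` in the induction
    -- hypothesis.
    have key : ∀ s' ∈ DEState.Reachable p, s'.D ≤ 0 →
        ENNReal.ofReal (Real.exp A) ≤ (stopSet A)ᶜ.indicator V s' := by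
      intro s' hs' hD
      have h1 := ih hs'
      rw [max_eq_right hD, Real.exp_zero, ENNReal.ofReal_one, add_comm 1] at h1
      rw [Set.indicator_of_mem (by simpa [stopSet] using hD.trans hA)]
      exact (ENNReal.add_le_add_iff_right ENNReal.one_ne_top).1 h1
    have hle0 : ∀ o, (M.deStep p s o = DEState.atY 0 ∨ (M.deStep p s o).next ≠ .expY) →
        (M.deStep p s o).D ≤ 0 := by
      rintro o (h | h)
      · rw [h]; rfl
      · exact ((M.deStep_mem hp s hs o).2.1 h).1.le
    by_cases hnext : s.next = .expY
    · obtain ⟨hD, hsD⟩ := hs.1 hnext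
      set d := s.D with hd
      have hm : Measurable fun o : (𝒳 × 𝒴) × Seed =>
          ENNReal.ofReal (Real.exp (d + M.Y.llr o.1.2)) :=
        (Real.measurable_exp.comp (measurable_const.add
          (M.Y.measurable_llr.comp (measurable_snd.comp measurable_fst)))).ennreal_ofReal
      have hint : ∫⁻ o, ENNReal.ofReal (Real.exp (d + M.Y.llr o.1.2)) ∂M.coord₀ =
          ENNReal.ofReal (Real.exp (max d 0)) := by
        rw [M.lintegral_Y₀ (g := fun y => ENNReal.ofReal (Real.exp (d + M.Y.llr y)))
          (Real.measurable_exp.comp (measurable_const.add M.Y.measurable_llr)).ennreal_ofReal]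
        simp only [Real.exp_add, ENNReal.ofReal_mul (Real.exp_pos _).le]
        rw [lintegral_const_mul _ M.Y.measurable_llr.exp.ennreal_ofReal,
          M.Y.lintegral_exp_llr hX, mul_one, max_eq_left hD]
      rw [← hint, add_comm 1, ← add_assoc, ← lintegral_add_left hm]
      gcongr
      calc ENNReal.ofReal (Real.exp A) = ∫⁻ _, ENNReal.ofReal (Real.exp A) ∂M.coord₀ := by simp
        _ ≤ _ := lintegral_mono fun o => ?_
      -- With `d' = d + ℓ_Y`, the bound by `e^(d')` plus the continuation value holds pointwise: if
      -- `d' > A`, the first term suffices; if `0 ≤ d' ≤ A`, the induction hypothesis applies; if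
      -- `d' < 0`, the continuation value alone is at least `e^A`.
      by_cases h0 : 0 ≤ d + M.Y.llr o.1.2
      · have hst : M.deStep p s o = DEState.atY (d + M.Y.llr o.1.2) := by
          rw [hsD]; exact M.deStep_atY_of_nonneg d o h0
        by_cases hA' : A < d + M.Y.llr o.1.2
        · exact le_add_right (ENNReal.ofReal_le_ofReal (Real.exp_le_exp.2 hA'.le))
        · have h1 := ih (DEState.atY_mem (p := p) h0)
          rw [show (DEState.atY (d + M.Y.llr o.1.2)).D = d + M.Y.llr o.1.2 from rfl,
            max_eq_left h0] at h1
          rw [hst, Set.indicator_of_mem (by simpa [stopSet, DEState.atY] using hA')]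
          exact le_self_add.trans h1
      · push Not at h0
        refine le_add_left (key _ (M.deStep_mem hp s hs o) (hle0 o ?_))
        rw [hsD]
        exact M.deStep_atY_of_neg d o h0
    · have hD := (hs.2.1 hnext).1
      rw [max_eq_right hD.le, Real.exp_zero, ENNReal.ofReal_one, add_comm]
      gcongr
      refine le_add_left ?_
      calc ENNReal.ofReal (Real.exp A) = ∫⁻ _, ENNReal.ofReal (Real.exp A) ∂M.coord₀ := by simp
        _ ≤ _ := lintegral_mono fun o =>
          key _ (M.deStep_mem hp s hs o) (hle0 o (M.deStep_of_ne s hnext o))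

/-- The mean time to false alarm is at least the exponential of the threshold. -/
theorem exp_le_ARLFA (hX : M.Y.FiniteLLR) (hp : p.Positive) {A : ℝ} (hA : 0 ≤ A) :
    ENNReal.ofReal (Real.exp A) ≤ M.ARLFA (M.de2e A p) := by
  rw [ARLFA_de2e]
  by_cases htop : meanHit (M.deStep p) M.coord₀ (stopSet A) (DEState.atY 0) = ∞
  · simp [htop]
  -- A finite mean is a convergent sum of tails, so the boundary term tends to `0`.
  have h0 : Tendsto (fun n => hitTail (M.deStep p) M.coord₀ (stopSet A) n (DEState.atY 0)) atTop
      (nhds 0) := ENNReal.tendsto_atTop_zero_of_tsum_ne_top htop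
  have h1 : ∀ n, ENNReal.ofReal (Real.exp A) ≤
      meanHit (M.deStep p) M.coord₀ (stopSet A) (DEState.atY 0) +
      ENNReal.ofReal (Real.exp A) *
        hitTail (M.deStep p) M.coord₀ (stopSet A) n (DEState.atY 0) := fun n => by
    have h := M.exp_le_meanHit hX hp hA n (DEState.atY_mem (p := p) le_rfl)
    simp only [DEState.atY, max_self, Real.exp_zero, ENNReal.ofReal_one] at h
    rw [add_comm 1] at h
    refine ((ENNReal.add_le_add_iff_right ENNReal.one_ne_top).1 h).trans ?_
    exact add_le_add (meanHitTrunc_le_meanHit _ _ _) le_rfl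
  have h2 := (ENNReal.Tendsto.const_mul h0 (Or.inr (ENNReal.ofReal_ne_top (r := Real.exp A)))).const_add
    (meanHit (M.deStep p) M.coord₀ (stopSet A) (DEState.atY 0))
  simp only [mul_zero, add_zero] at h2
  exact ge_of_tendsto' h2 h1

end Model

/-! ### Observation ratios before the change. -/

/-- A Foster–Lyapunov bound for the mean of an additive functional of a chain. -/
lemma lintegral_sum_run_le {S Ω : Type*} [MeasurableSpace S] [MeasurableSpace Ω]
    {step : S → Ω → S} (κ : Measure Ω) [IsProbabilityMeasure κ]
    (hstep : Measurable fun q : S × Ω => step q.1 q.2) {R : Set S}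
    (hR : ∀ s ∈ R, ∀ o, step s o ∈ R) {f Ψ : S → ℝ≥0∞} (hf : Measurable f) {β : ℝ≥0∞}
    (hΨ : ∀ s ∈ R, ∫⁻ o, Ψ (step s o) ∂κ + f s ≤ Ψ s + β) (n : ℕ) {s : S} (hs : s ∈ R) :
    ∫⁻ ω, ∑ k ∈ Finset.range n, f (run step s ω k) ∂Measure.infinitePi (fun _ : ℕ => κ) ≤
      Ψ s + n * β := by
  induction n generalizing s with
  | zero => simp
  | succ n ih =>
    have hm : ∀ (m : ℕ) (s : S), Measurable fun ω : ℕ → Ω =>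
        ∑ k ∈ Finset.range m, f (run step s ω k) := fun m s =>
      Finset.measurable_fun_sum _ fun k _ =>
        hf.comp ((measurable_run hstep k).of_uncurry_left (x := s) (f := fun s ω => run step s ω k))
    rw [lintegral_cons _ (hm _ _)]
    have h1 : ∀ o, ∫⁻ ω', ∑ k ∈ Finset.range (n + 1), f (run step s (cons o ω') k)
        ∂Measure.infinitePi (fun _ : ℕ => κ) ≤ f s + (Ψ (step s o) + n * β) := by
      intro o
      refine le_trans (le_of_eq ?_) (add_le_add le_rfl (ih (hR s hs o)))
      simp only [Finset.sum_range_succ', run_cons]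
      have h0 : ∀ ω', f (run step s (cons o ω') 0) = f s := fun _ => rfl
      simp only [h0]
      rw [lintegral_add_right _ measurable_const]
      simp [add_comm]
    refine (lintegral_mono h1).trans ?_
    rw [lintegral_add_left measurable_const, lintegral_add_right _ measurable_const]
    simp only [lintegral_const, measure_univ, mul_one]
    calc f s + (∫⁻ o, Ψ (step s o) ∂κ + n * β) = (∫⁻ o, Ψ (step s o) ∂κ + f s) + n * β := by ring
      _ ≤ (Ψ s + β) + n * β := add_le_add (hΨ s hs) le_rfl
      _ = Ψ s + ((n + 1 : ℕ) : ℝ≥0∞) * β := by push_cast; ring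

/-- Drift computations need increments of both signs and so are made with real integrals; the
nonnegative majorant `f` carries them to `ℝ≥0∞`. -/
lemma lintegral_ofReal_add_le {Ω : Type*} [MeasurableSpace Ω] {κ : Measure Ω} {g f : Ω → ℝ}
    {c x b : ℝ} (hf : Integrable f κ) (hf0 : ∀ o, 0 ≤ f o) (hgf : ∀ o, g o ≤ f o) (hc : 0 ≤ c)
    (hx : 0 ≤ x) (hb : 0 ≤ b) (h : ∫ o, f o ∂κ + c ≤ x + b) :
    ∫⁻ o, ENNReal.ofReal (g o) ∂κ + ENNReal.ofReal c ≤ ENNReal.ofReal x + ENNReal.ofReal b := by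
  refine le_trans (add_le_add (lintegral_mono fun o => ENNReal.ofReal_le_ofReal (hgf o)) le_rfl) ?_
  rw [← ofReal_integral_eq_lintegral_ofReal hf (Eventually.of_forall hf0),
    ← ENNReal.ofReal_add (integral_nonneg hf0) hc, ← ENNReal.ofReal_add hx hb]
  exact ENNReal.ofReal_le_ofReal h

lemma randRound_natCast (n : ℕ) (u : unitInterval) : randRound (n : ℝ) u = n := by
  simp [randRound, not_lt.2 u.2.1]

lemma randRound_two (u : unitInterval) : randRound 2 u = 2 := by
  exact_mod_cast randRound_natCast 2 u

/-- A Lyapunov function of the algorithm with `N_X = 2` and `N_0 = K` before the change. -/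
def lyapunov (m v₀ v₁ β δ : ℝ) (K : ℕ) (s : DEState) : ℝ :=
  match s.next with
  | .expY => (s.D + 1) / m + v₀
  | .expX => if s.usedX = 0 then v₀ else v₁
  | .idle => if s.D - s.usedIdle * (δ / K) ≤ s.level - δ ∧ s.usedIdle < K
      then v₁ - β * (K - s.usedIdle) else v₁

namespace Model

variable {𝒳 𝒴 : Type*} [MeasurableSpace 𝒳] [MeasurableSpace 𝒴] (M : Model 𝒳 𝒴)

set_option maxHeartbeats 1000000 in
/-- With suitable parameters the mean number of experiments grows arbitrarily slowly. -/
lemma exists_sparse_params (hX : M.X.FiniteLLR) (hY : M.Y.FiniteLLR)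
    (hneX : M.X.law₁ ≠ M.X.law₀) (hneY : M.Y.law₁ ≠ M.Y.law₀) {β : ℝ} (hβ : 0 < β) :
    ∃ p : DEParams, p.Positive ∧ ∃ C : ℝ, 0 ≤ C ∧ ∀ n : ℕ,
      ∫⁻ ω, ∑ k ∈ Finset.range n,
        (if (run (M.deStep p) (DEState.atY 0) ω k).next ≠ .idle then (1 : ℝ≥0∞) else 0)
        ∂Measure.infinitePi (fun _ : ℕ => M.coord₀) ≤
      ENNReal.ofReal C + n * ENNReal.ofReal β := by
  obtain ⟨δ, hδ, hq⟩ := Experiment.exists_law₀_llr_le_pos hX hneX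
  have hm0 := Experiment.integral_max_llr_neg hY hneY
  set m : ℝ := -∫ x, max (M.Y.llr x) (-1) ∂M.Y.law₀ with hm
  have hmpos : 0 < m := by rw [hm]; linarith
  set q : ℝ := M.X.law₀.real {x | M.X.llr x ≤ -δ} with hqdef
  have hqpos : 0 < q := ENNReal.toReal_pos hq (measure_ne_top _ _)
  have hq1 : q ≤ 1 := measureReal_le_one
  -- One cycle costs on average at most about `1/m` observations of `Y` and two of `X`, and with
  -- probability at least `q` it earns an idle period of `K` steps. Each idle step allows `β`
  -- experiments, so `q β K` must exceed `1/m + 2`.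
  obtain ⟨K, hK⟩ := exists_nat_gt ((1 / m + 2) / (q * β))
  have hK' : 1 / m + 2 < q * β * K := by
    rw [div_lt_iff₀ (by positivity)] at hK; linarith
  have hm1 : 0 < 1 / m := by positivity
  have hK0 : 0 < K := by
    rcases Nat.eq_zero_or_pos K with h | h
    · subst h; rw [Nat.cast_zero, mul_zero] at hK'; linarith
    · exact h
  have hKr : (0 : ℝ) < K := by exact_mod_cast hK0
  -- The potential gains `β` per idle step, from `0` to `v₁ = βK` over a full idle period. The value
  -- `v₀` balances the first use of `X`: `v₀ = (1 - q) v₁ + 1`.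
  set v₁ : ℝ := β * K with hv1
  set v₀ : ℝ := v₁ + 1 - q * β * K with hv0
  have hv1pos : 0 < v₁ := by positivity
  have hqb : q * β * K ≤ β * K := by
    have : q * β ≤ 1 * β := by gcongr
    rw [one_mul] at this
    gcongr
  have hv0pos : 0 < v₀ := by rw [hv0, hv1]; linarith
  have hv01 : 1 / m + v₀ ≤ v₁ - 1 := by rw [hv0]; linarith
  -- Integer limits make the randomized rounding deterministic. From a depth of at least `δ`,
  -- updates of size `δ/K` do not exceed the level before the limit of `K` updates is reached.
  set p : DEParams := ⟨1, 1, K, 2, δ / K⟩ with hp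
  have hpos : p.Positive := ⟨one_pos, one_pos, hKr, two_pos, by positivity⟩
  -- The first observation of `X` after a fall starts exactly at the level, so `ℓ_X ≤ -δ` puts the
  -- statistic at least `δ` below it.
  set R : Set DEState := DEState.Reachable p ∩ {s | s.next = .expX → s.usedX = 0 → s.D = s.level}
    with hRdef
  set ψ := lyapunov m v₀ v₁ β δ K with hψ
  have hR : ∀ s ∈ R, ∀ o, M.deStep p s o ∈ R := by
    rintro s ⟨hs, hs2⟩ o
    refine ⟨M.deStep_mem hpos s hs o, ?_⟩
    cases h : s.next
    · simp only [deStep, h]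
      split_ifs <;> simp [DEState.atY]
    · simp only [deStep, h]
      split_ifs <;> simp [DEState.atY]
    · have := (hs.2.2 h).1
      simp only [deStep, h]
      split_ifs <;> simp
  have hψ0 : ∀ s ∈ R, 0 ≤ ψ s := by
    rintro s ⟨hs, -⟩
    simp only [hψ, lyapunov]
    cases h : s.next
    · have := (hs.1 h).1
      simp only
      positivity
    · simp only
      split_ifs
      exacts [hv0pos.le, hv1pos.le]
    · simp only
      split_ifs with hh
      · rw [hv1]
        have : (0 : ℝ) ≤ s.usedIdle := Nat.cast_nonneg _
        nlinarith
      · exact hv1pos.le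
  have hdrift : ∀ s ∈ R, ∫⁻ o, ENNReal.ofReal (ψ (M.deStep p s o)) ∂M.coord₀ +
      (if s.next ≠ .idle then (1 : ℝ≥0∞) else 0) ≤ ENNReal.ofReal (ψ s) + ENNReal.ofReal β := by
    rintro s ⟨hs, hs2⟩
    have hind : (if s.next ≠ .idle then (1 : ℝ≥0∞) else 0) =
        ENNReal.ofReal (if s.next ≠ .idle then (1 : ℝ) else 0) := by
      split_ifs <;> simp
    rw [hind]
    have hc0 : (0 : ℝ) ≤ if s.next ≠ .idle then (1 : ℝ) else 0 := by split_ifs <;> norm_num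
    have hψs := hψ0 s ⟨hs, hs2⟩
    cases h : s.next
    · obtain ⟨hD, hsD⟩ := hs.1 h
      have hψe : ψ s = (s.D + 1) / m + v₀ := by simp [hψ, lyapunov, h]
      have hint : Integrable (fun o : (𝒳 × 𝒴) × Seed => max (M.Y.llr o.1.2) (-1)) M.coord₀ := by
        have := Experiment.integrable_max_llr hY
        rw [← M.map_Y₀] at this
        exact this.comp_measurable measurable_obsY
      have hint2 : ∫ o : (𝒳 × 𝒴) × Seed, max (M.Y.llr o.1.2) (-1) ∂M.coord₀ = -m := by
        rw [hm, neg_neg, ← M.map_Y₀, integral_map measurable_obsY.aemeasurable]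
        exact (M.Y.measurable_llr.max measurable_const).aestronglyMeasurable
      have hint3 : Integrable (fun o : (𝒳 × 𝒴) × Seed =>
          (s.D + 1) / m + v₀ + max (M.Y.llr o.1.2) (-1) / m) M.coord₀ :=
        (integrable_const _).add (hint.div_const m)
      -- The `+ 1` in the potential compensates the cut at `-1`: however far `Y` falls, the majorant
      -- stays at least `v₀`, the value of the state entered.
      have hge : ∀ o : (𝒳 × 𝒴) × Seed,
          v₀ ≤ (s.D + 1) / m + v₀ + max (M.Y.llr o.1.2) (-1) / m := by
        intro o
        have h1 := le_max_right (M.Y.llr o.1.2) (-1)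
        have : 0 ≤ (s.D + 1 + max (M.Y.llr o.1.2) (-1)) / m := by
          apply div_nonneg _ hmpos.le; linarith
        have h2 : (s.D + 1 + max (M.Y.llr o.1.2) (-1)) / m =
          (s.D + 1) / m + max (M.Y.llr o.1.2) (-1) / m := by ring
        linarith
      refine lintegral_ofReal_add_le hint3 (fun o => hv0pos.le.trans (hge o)) (fun o => ?_) ?_ hψs
        hβ.le ?_
      · rw [hsD]
        by_cases h0 : 0 ≤ s.D + M.Y.llr o.1.2
        · rw [M.deStep_atY_of_nonneg _ _ h0]
          simp only [hψ, lyapunov, DEState.atY]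
          have : M.Y.llr o.1.2 / m ≤ max (M.Y.llr o.1.2) (-1) / m := by
            gcongr; exact le_max_left _ _
          have h2 : (s.D + M.Y.llr o.1.2 + 1) / m = (s.D + 1) / m + M.Y.llr o.1.2 / m := by ring
          linarith
        · refine le_trans (le_of_eq ?_) (hge o)
          simp [hψ, lyapunov, deStep, DEState.atY, h0, hp, randRound_two]
      · simp
      · rw [integral_add (integrable_const _) (hint.div_const m), integral_div, hint2, hψe,
          neg_div, div_self hmpos.ne']
        simp only [integral_const, probReal_univ, smul_eq_mul, one_mul, ne_eq, reduceCtorEq,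
          not_false_eq_true, if_true]
        linarith
    · by_cases hu : s.usedX = 0
      · have hψe : ψ s = v₀ := by simp [hψ, lyapunov, h, hu]
        have hDl := hs2 h hu
        have hl := (hs.2.1 (by simp [h])).2
        have hms : MeasurableSet {o : (𝒳 × 𝒴) × Seed | M.X.llr o.1.1 ≤ -δ} :=
          (M.X.measurable_llr.comp measurable_obsX) measurableSet_Iic
        have hint : Integrable (Set.indicator {o : (𝒳 × 𝒴) × Seed | M.X.llr o.1.1 ≤ -δ}
            fun _ => v₁) M.coord₀ := (integrable_const v₁).indicator hms
        refine lintegral_ofReal_add_le (f := fun o => v₁ -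
          Set.indicator {o : (𝒳 × 𝒴) × Seed | M.X.llr o.1.1 ≤ -δ} (fun _ => v₁) o)
          ((integrable_const v₁).sub hint) (fun o => ?_) (fun o => ?_) ?_ hψs hβ.le ?_
        · rw [sub_nonneg]
          exact Set.indicator_le_self' (fun _ _ => hv1pos.le) o
        · by_cases hd : M.X.llr o.1.1 ≤ -δ
          · rw [Set.indicator_of_mem (show o ∈ {o : (𝒳 × 𝒴) × Seed | M.X.llr o.1.1 ≤ -δ} from hd)]
            have e1 : ¬ (0 ≤ s.level + M.X.llr o.1.1) := by linarith
            have e2 : ¬ (s.level ≤ s.level + M.X.llr o.1.1) := by linarith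
            have e3 : s.level + M.X.llr o.1.1 ≤ s.level - δ := by linarith
            simp [hψ, lyapunov, deStep, h, hDl, hu, hp, randRound_two, randRound_natCast, e1, e2,
              e3, hK0.ne', hK0, hv1]
          · rw [Set.indicator_of_notMem
              (show o ∉ {o : (𝒳 × 𝒴) × Seed | M.X.llr o.1.1 ≤ -δ} from hd), sub_zero]
            have e0 : 1 / m + v₀ ≤ v₁ := by linarith
            have e4 : v₁ - β * K ≤ v₁ := by linarith
            simp only [hψ, lyapunov, deStep, h, hDl, hu, hp, randRound_two, randRound_natCast]
            split_ifs <;> simp_all [DEState.atY]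
        · simp
        · rw [integral_sub (integrable_const _) hint, integral_indicator hms, setIntegral_const,
            hψe]
          have hpre : M.coord₀.real {o : (𝒳 × 𝒴) × Seed | M.X.llr o.1.1 ≤ -δ} = q := by
            rw [hqdef, ← M.map_X₀, map_measureReal_apply measurable_obsX
              (show MeasurableSet {x | M.X.llr x ≤ -δ} from M.X.measurable_llr measurableSet_Iic)]
            rfl
          rw [hpre]
          simp only [integral_const, probReal_univ, smul_eq_mul, one_mul, ne_eq, reduceCtorEq,
            not_false_eq_true, if_true]
          rw [hv0, hv1]
          nlinarith
      · have hψe : ψ s = v₁ := by simp [hψ, lyapunov, h, hu]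
        -- The second use exhausts `N_X = 2`, so the chain restarts at `0` for every outcome.
        have hnext : ∀ o, ψ (M.deStep p s o) = 1 / m + v₀ := by
          intro o
          have h2 : 2 ≤ s.usedX + 1 := by omega
          simp [hψ, lyapunov, deStep, h, hp, randRound_two, h2, DEState.atY]
        refine lintegral_ofReal_add_le (f := fun _ => 1 / m + v₀) (integrable_const _)
          (fun o => by positivity) (fun o => (hnext o).le) ?_ hψs hβ.le ?_
        · simp
        · rw [hψe]
          simp only [integral_const, probReal_univ, smul_eq_mul, one_mul, ne_eq, reduceCtorEq,
            not_false_eq_true, if_true]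
          linarith
    · refine lintegral_ofReal_add_le (f := fun _ => ψ s + β) (integrable_const _)
        (fun o => by positivity) (fun o => ?_) ?_ hψs hβ.le ?_
      · have hu := (hs.2.2 h).1
        have hu0 : s.usedX ≠ 0 := by omega
        set j := s.usedIdle with hj
        have hμ : δ / K * K = δ := div_mul_cancel₀ _ hKr.ne'
        have hμpos : 0 < δ / K := by positivity
        have hψe : ψ s = if s.D - j * (δ / K) ≤ s.level - δ ∧ j < K
            then v₁ - β * (K - j) else v₁ := by simp [hψ, lyapunov, h, hj]
        -- A sufficiently deep idle period can end only by exhausting its limit, at `j + 1 = K`,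
        -- when the potential has already reached `v₁ - β`. Shallow idle periods carry the value
        -- `v₁` from the beginning.
        have hexit : (s.level < s.D + δ / K ∨ K ≤ j + 1) → v₁ ≤ ψ s + β := by
          intro hor
          rw [hψe]
          split_ifs with hg
          · have hlt : (j : ℝ) + 1 ≤ K := by exact_mod_cast hg.2
            have h1 : K ≤ j + 1 := by
              rcases hor with h1 | h1
              · exfalso
                have h3 : ((j : ℝ) + 1) * (δ / K) ≤ K * (δ / K) :=
                  mul_le_mul_of_nonneg_right hlt hμpos.le
                have := hg.1
                nlinarith
              · exact h1
            have h2 : (K : ℝ) ≤ j + 1 := by exact_mod_cast h1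
            nlinarith
          · linarith
        by_cases h1 : s.level < s.D + δ / K
        · simpa [hψ, lyapunov, deStep, h, hp, h1, hu0] using hexit (Or.inl h1)
        · by_cases h2 : K ≤ j + 1
          · simpa [hψ, lyapunov, deStep, h, hp, h1, hu0, randRound_natCast, h2, ← hj] using
              hexit (Or.inr h2)
          · have e : M.deStep p s o = ⟨.idle, s.D + δ / K, s.level, s.usedX, j + 1⟩ := by
              simp [deStep, h, hp, h1, randRound_natCast, h2, ← hj]
            rw [e, hψe]
            simp only [hψ, lyapunov]
            push_cast
            have e5 : s.D + δ / K - (j + 1) * (δ / K) = s.D - j * (δ / K) := by ring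
            rw [e5]
            have hjK : j < K := by omega
            have hjK' : j + 1 < K := by omega
            split_ifs with g1 g2 g2
            · linarith
            · exact absurd ⟨g1.1, hjK⟩ g2
            · exact absurd ⟨g2.1, hjK'⟩ g1
            · linarith
      · simp
      · simp
  refine ⟨p, hpos, ψ (DEState.atY 0), hψ0 _ ⟨DEState.atY_mem le_rfl, by simp [DEState.atY]⟩,
    fun n => ?_⟩
  exact lintegral_sum_run_le M.coord₀ (M.measurable_deStep p) hR
    (f := fun s => if s.next ≠ .idle then (1 : ℝ≥0∞) else 0)
    (Ψ := fun s => ENNReal.ofReal (ψ s))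
    (Measurable.ite (show MeasurableSet {s : DEState | s.next ≠ .idle} from
      DEState.measurable_next (t := {c | c ≠ .idle}) trivial)
      measurable_const measurable_const) hdrift n
    ⟨DEState.atY_mem le_rfl, by simp [DEState.atY]⟩

/-- The number of times before `n` at which the choice `c` is made. -/
def choiceCount (Ψ : Policy 𝒳 𝒴) (c : Choice) (n : ℕ) (ω : Sample 𝒳 𝒴) : ℝ≥0∞ :=
  ∑ k ∈ Finset.Ico 1 n, if Ψ.select k ω = c then (1 : ℝ≥0∞) else 0

lemma measurable_run_next (p : DEParams) (k : ℕ) :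
    Measurable fun ω : ℕ → (𝒳 × 𝒴) × Seed => (run (M.deStep p) (DEState.atY 0) ω k).next :=
  ((DEState.measurable_next.comp (measurable_run (M.measurable_deStep p) k)).of_uncurry_left
    (x := DEState.atY 0) (f := fun s ω => (run (M.deStep p) s ω k).next))

lemma measurable_select_de2e (A : ℝ) (p : DEParams) (k : ℕ) :
    Measurable ((M.de2e A p).select k) := by
  have h : (M.de2e A p).select k = (fun ω : ℕ → (𝒳 × 𝒴) × Seed =>
      (run (M.deStep p) (DEState.atY 0) ω (k - 1)).next) ∘ fun ω j => ω (j + 1) := by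
    funext ω
    simp [de2e, deState_eq_run]
  rw [h]
  exact (M.measurable_run_next p _).comp
    (measurable_pi_iff.2 fun j => measurable_pi_apply (j + 1))

lemma measurable_choiceCount (A : ℝ) (p : DEParams) (c : Choice) (n : ℕ) :
    Measurable (choiceCount (M.de2e A p) c n) :=
  Finset.measurable_fun_sum _ fun k _ => Measurable.ite
    (M.measurable_select_de2e A p k (measurableSet_singleton c)) measurable_const measurable_const

lemma meanFraction_eq (A : ℝ) (p : DEParams) (c : Choice) (n : ℕ) :
    M.meanFraction (M.de2e A p) c n =
      (∫⁻ ω, choiceCount (M.de2e A p) c n ω ∂M.P ⊤) * (n : ℝ≥0∞)⁻¹ := by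
  rw [← lintegral_mul_const _ (M.measurable_choiceCount A p c n)]
  rfl

omit [MeasurableSpace 𝒳] [MeasurableSpace 𝒴] in
lemma choiceCount_add (Ψ : Policy 𝒳 𝒴) (n : ℕ) (ω : Sample 𝒳 𝒴) :
    choiceCount Ψ .expY n ω + choiceCount Ψ .expX n ω + choiceCount Ψ .idle n ω =
      ((n - 1 : ℕ) : ℝ≥0∞) := by
  simp only [choiceCount]
  rw [← Finset.sum_add_distrib, ← Finset.sum_add_distrib,
    Finset.sum_congr rfl (g := fun _ => (1 : ℝ≥0∞))]
  · simp
  · intro k _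
    cases Ψ.select k ω <;> simp

lemma lintegral_choiceCount_le {p : DEParams} {C β : ℝ}
    (h : ∀ n : ℕ, ∫⁻ ω, ∑ k ∈ Finset.range n,
        (if (run (M.deStep p) (DEState.atY 0) ω k).next ≠ .idle then (1 : ℝ≥0∞) else 0)
        ∂Measure.infinitePi (fun _ : ℕ => M.coord₀) ≤
      ENNReal.ofReal C + n * ENNReal.ofReal β) (A : ℝ) (n : ℕ) :
    ∫⁻ ω, choiceCount (M.de2e A p) .expY n ω ∂M.P ⊤ +
      ∫⁻ ω, choiceCount (M.de2e A p) .expX n ω ∂M.P ⊤ ≤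
      ENNReal.ofReal C + n * ENNReal.ofReal β := by
  rw [← lintegral_add_left (M.measurable_choiceCount A p _ n)]
  have hm : Measurable fun ω : ℕ → (𝒳 × 𝒴) × Seed => ∑ k ∈ Finset.range (n - 1),
      (if (run (M.deStep p) (DEState.atY 0) ω k).next ≠ .idle then (1 : ℝ≥0∞) else 0) :=
    Finset.measurable_fun_sum _ fun k _ => Measurable.ite
      ((M.measurable_run_next p k) (t := {c | c ≠ .idle}) trivial) measurable_const
      measurable_const
  have h1 := M.lintegral_shift ⊤ hm
  have h2 := h (n - 1)
  simp only [coord_top] at h1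
  rw [← h1] at h2
  refine le_trans (le_of_eq (lintegral_congr fun ω => ?_)) (h2.trans ?_)
  · simp only [choiceCount]
    rw [← Finset.sum_add_distrib, Finset.sum_Ico_eq_sum_range]
    refine Finset.sum_congr rfl fun k _ => ?_
    simp only [de2e, deState_eq_run, Nat.add_sub_cancel_left]
    cases (run (M.deStep p) (DEState.atY 0) (fun k => ω (k + 1)) k).next <;> simp
  · gcongr
    omega

/-- The observation ratios and the idle fraction for sparse parameters. -/
theorem por_le (A : ℝ) {p : DEParams} {C β : ℝ} (hC : 0 ≤ C) (hβ : 0 ≤ β)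
    (h : ∀ n : ℕ, ∫⁻ ω, ∑ k ∈ Finset.range n,
        (if (run (M.deStep p) (DEState.atY 0) ω k).next ≠ .idle then (1 : ℝ≥0∞) else 0)
        ∂Measure.infinitePi (fun _ : ℕ => M.coord₀) ≤
      ENNReal.ofReal C + n * ENNReal.ofReal β) :
    M.POR (M.de2e A p) .expY ≤ ENNReal.ofReal β ∧ M.POR (M.de2e A p) .expX ≤ ENNReal.ofReal β ∧
      ENNReal.ofReal (1 - β) ≤ liminf (M.meanFraction (M.de2e A p) .idle) atTop := by
  have hYX := M.lintegral_choiceCount_le h A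
  have hlim : Tendsto (fun n : ℕ => ENNReal.ofReal (C / n + β)) atTop
      (nhds (ENNReal.ofReal β)) := by
    have := (tendsto_const_div_atTop_nhds_zero_nat C).add_const β
    rw [zero_add] at this
    exact ENNReal.tendsto_ofReal this
  have hbound : ∀ n : ℕ, 1 ≤ n → (ENNReal.ofReal C + n * ENNReal.ofReal β) * (n : ℝ≥0∞)⁻¹ =
      ENNReal.ofReal (C / n + β) := by
    intro n hn
    have hn' : (0 : ℝ) < n := by exact_mod_cast hn
    rw [← ENNReal.ofReal_natCast, ← ENNReal.ofReal_inv_of_pos hn',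
      ← ENNReal.ofReal_mul hn'.le, ← ENNReal.ofReal_add hC (by positivity),
      ← ENNReal.ofReal_mul (by positivity)]
    congr 1
    field_simp
  have hlimsup : ∀ u : ℕ → ℝ≥0∞, (∀ n, 1 ≤ n → u n ≤ ENNReal.ofReal (C / n + β)) →
      limsup u atTop ≤ ENNReal.ofReal β := by
    intro u hu
    rw [← hlim.limsup_eq]
    refine limsup_le_limsup ?_
    filter_upwards [eventually_ge_atTop 1] with n hn using hu n hn
  refine ⟨hlimsup _ fun n hn => ?_, hlimsup _ fun n hn => ?_, ?_⟩
  · rw [meanFraction_eq, ← hbound n hn]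
    gcongr
    exact le_self_add.trans (hYX n)
  · rw [meanFraction_eq, ← hbound n hn]
    gcongr
    exact le_add_self.trans (hYX n)
  · have hlim2 : Tendsto (fun n : ℕ => ENNReal.ofReal (1 - (C + 1) / n - β)) atTop
        (nhds (ENNReal.ofReal (1 - β))) := by
      have := ((tendsto_const_div_atTop_nhds_zero_nat (C + 1)).const_sub 1).sub_const β
      rw [sub_zero] at this
      exact ENNReal.tendsto_ofReal this
    rw [← hlim2.liminf_eq]
    refine liminf_le_liminf ?_
    filter_upwards [eventually_ge_atTop 1] with n hn
    have hn' : (0 : ℝ) < n := by exact_mod_cast hn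
    -- The three choices share the `n - 1` times in `[1, n)`, so a bound on both experiments
    -- together is a lower bound on idleness.
    have hsum : ∫⁻ ω, choiceCount (M.de2e A p) .expY n ω ∂M.P ⊤ +
        ∫⁻ ω, choiceCount (M.de2e A p) .expX n ω ∂M.P ⊤ +
        ∫⁻ ω, choiceCount (M.de2e A p) .idle n ω ∂M.P ⊤ = ((n - 1 : ℕ) : ℝ≥0∞) := by
      rw [← lintegral_add_left (M.measurable_choiceCount A p _ n), ← lintegral_add_left
        ((M.measurable_choiceCount A p _ n).fun_add (M.measurable_choiceCount A p _ n))]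
      simp only [choiceCount_add]
      simp
    rw [meanFraction_eq]
    have h1 : ((n - 1 : ℕ) : ℝ≥0∞) * (n : ℝ≥0∞)⁻¹ ≤ ENNReal.ofReal (C / n + β) +
        (∫⁻ ω, choiceCount (M.de2e A p) .idle n ω ∂M.P ⊤) * (n : ℝ≥0∞)⁻¹ := by
      rw [← hsum, add_mul, ← hbound n hn]
      exact add_le_add (mul_le_mul_left (hYX n) _) le_rfl
    have h2 : ((n - 1 : ℕ) : ℝ≥0∞) * (n : ℝ≥0∞)⁻¹ = ENNReal.ofReal (1 - 1 / n) := by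
      rw [← ENNReal.ofReal_natCast, ← ENNReal.ofReal_natCast, ← ENNReal.ofReal_inv_of_pos hn',
        ← ENNReal.ofReal_mul (by positivity), Nat.cast_sub hn]
      congr 1
      field_simp
      simp
    rw [h2] at h1
    have h3 : 1 - (C + 1) / n - β = (1 - 1 / n) - (C / n + β) := by ring
    rw [h3, ENNReal.ofReal_sub _ (by positivity)]
    exact tsub_le_iff_left.2 h1

end Model

/-! ### Mean length of an excursion below zero. -/

lemma hitTail_le_one {S Ω : Type*} [MeasurableSpace Ω] {step : S → Ω → S} {halt : Set S}
    (κ : Measure Ω) [IsProbabilityMeasure κ] (n : ℕ) (s : S) : hitTail step κ halt n s ≤ 1 := by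
  induction n generalizing s with
  | zero => exact le_rfl
  | succ n ih =>
    rw [hitTail]
    calc _ ≤ ∫⁻ _, 1 ∂κ := lintegral_mono fun o =>
          (Set.indicator_le_self _ _ _).trans (ih _)
      _ = 1 := by simp

/-- This half of Tonelli's theorem needs no measurability, which spares measurability proofs for
functions defined by cases on the state. -/
lemma lintegral_prod_le_lintegral_lintegral {α β : Type*} [MeasurableSpace α] [MeasurableSpace β]
    (μ : Measure α) (ν : Measure β) [SFinite ν] (f : α × β → ℝ≥0∞) :
    ∫⁻ z, f z ∂μ.prod ν ≤ ∫⁻ x, ∫⁻ y, f (x, y) ∂ν ∂μ := by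
  obtain ⟨g, hg, hgf, h⟩ := exists_measurable_le_lintegral_eq (μ.prod ν) f
  rw [h, lintegral_prod _ hg.aemeasurable]
  exact lintegral_mono fun x => lintegral_mono fun y => hgf _

/-- The event that a limit `N` is not exhausted after `c` uses. -/
def passSet (N : ℝ) (c : ℕ) : Set unitInterval := {u | ¬ randRound N u ≤ c}

lemma measurableSet_passSet (N : ℝ) (c : ℕ) : MeasurableSet (passSet N c) :=
  (measurableSet_le (measurable_randRound N) measurable_const).compl

/-- The limit survives `c` uses with probability `1` for `c < ⌊N⌋`, `N - ⌊N⌋` for `c = ⌊N⌋`, and `0`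
afterwards. In all cases this is the recursion for the mean number `(N - c)⁺` of remaining uses, so
a real limit behaves in mean like an integer one. -/
lemma volume_passSet_mul_le {N : ℝ} (hN : 0 ≤ N) (c : ℕ) :
    volume (passSet N c) * (1 + ENNReal.ofReal (N - (c + 1))) ≤ ENNReal.ofReal (N - c) := by
  have hfl := Nat.floor_le hN
  rcases lt_trichotomy c ⌊N⌋₊ with h | h | h
  · have h1 : ((c : ℝ) + 1) ≤ N := by
      have : ((c + 1 : ℕ) : ℝ) ≤ ⌊N⌋₊ := by exact_mod_cast h
      push_cast at this; linarith
    calc _ ≤ 1 * (1 + ENNReal.ofReal (N - (c + 1))) := by gcongr; exact prob_le_one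
      _ = ENNReal.ofReal (N - c) := by
        rw [one_mul, ← ENNReal.ofReal_one, ← ENNReal.ofReal_add zero_le_one (by linarith)]
        congr 1; ring
  · have h1 : N - (c + 1) ≤ 0 := by
      have := Nat.lt_floor_add_one N
      rw [h]; linarith
    have h2 : passSet N c = Set.Iio ⟨Int.fract N, Int.fract_nonneg N, (Int.fract_lt_one N).le⟩ := by
      ext u
      simp only [passSet, randRound, h, Set.mem_ofPred_eq, Set.mem_Iio, ← Subtype.coe_lt_coe]
      split_ifs with hu <;> simp [hu]
    rw [ENNReal.ofReal_of_nonpos h1, add_zero, mul_one, h2, unitInterval.volume_Iio]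
    refine ENNReal.ofReal_le_ofReal ?_
    change Int.fract N ≤ _
    rw [h, ← Int.self_sub_floor, natCast_floor_eq_intCast_floor hN]
  · have h2 : passSet N c = ∅ := by
      refine Set.eq_empty_of_forall_notMem fun u hu => hu ?_
      have := randRound_le N u
      omega
    simp [h2]

lemma volume_passSet_mul_le_mul {N : ℝ} (hN : 0 ≤ N) (c : ℕ) {K : ℝ≥0∞} (hK : 1 ≤ K) :
    volume (passSet N c) * (1 + ENNReal.ofReal (N - (c + 1)) * K) ≤ ENNReal.ofReal (N - c) * K := by
  calc _ ≤ volume (passSet N c) * ((1 + ENNReal.ofReal (N - (c + 1))) * K) := by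
        gcongr
        rw [add_mul, one_mul]
        gcongr
    _ ≤ _ := by
      rw [← mul_assoc]
      exact mul_le_mul_left (volume_passSet_mul_le hN c) K

namespace DEParams

/-- The mean number of steps spent per permitted observation of `X`. -/
def costX (p : DEParams) : ℝ≥0∞ := 1 + ENNReal.ofReal p.N0

/-- A bound for the mean number of steps that the algorithm spends below zero. -/
def maxExcursion (p : DEParams) : ℝ≥0∞ := ENNReal.ofReal p.NX * p.costX

/-- A bound for the mean number of steps, after the next one, until the algorithm returns to
performing `Y`. -/
def remaining (p : DEParams) (s : DEState) : ℝ≥0∞ :=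
  match s.next with
  | .expY => p.maxExcursion
  | .expX => ENNReal.ofReal (p.NX - (s.usedX + 1 : ℕ)) * p.costX
  | .idle => ENNReal.ofReal (p.N0 - (s.usedIdle + 1 : ℕ)) +
      (1 + ENNReal.ofReal (p.NX - (s.usedX + 1 : ℕ)) * p.costX)

/-- A bound for the mean number of steps until the algorithm returns to performing `Y`. -/
def excursion (p : DEParams) (s : DEState) : ℝ≥0∞ :=
  if s.next = .expY then 0 else 1 + p.remaining s

lemma one_le_costX (p : DEParams) : 1 ≤ p.costX := le_self_add

lemma maxExcursion_ne_top (p : DEParams) : p.maxExcursion ≠ ∞ :=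
  ENNReal.mul_ne_top ENNReal.ofReal_ne_top (by simp [costX])

/-- An idle period is paid for by the observation of `X` that led to it: the at most `N_0` updates
and the return to `X` fit into one unit `1 + N_0`, and a reachable idle state has `N_X ≥ 1` and has
used such a unit. -/
lemma remaining_le {p : DEParams} {s : DEState} (hs : s ∈ DEState.Reachable p) :
    p.remaining s ≤ p.maxExcursion := by
  cases h : s.next
  · simp [remaining, h]
  · simp only [remaining, h, maxExcursion]
    gcongr
    have : (0 : ℝ) ≤ (s.usedX + 1 : ℕ) := Nat.cast_nonneg _
    linarith
  · simp only [remaining, h, maxExcursion]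
    obtain ⟨h1, h2⟩ := hs.2.2 h
    have h1' : (1 : ℝ) ≤ s.usedX := by exact_mod_cast h1
    have e1 : ENNReal.ofReal (p.N0 - (s.usedIdle + 1 : ℕ)) ≤ ENNReal.ofReal p.N0 := by
      refine ENNReal.ofReal_le_ofReal ?_
      have : (0 : ℝ) ≤ (s.usedIdle + 1 : ℕ) := Nat.cast_nonneg _
      linarith
    have e2 : ENNReal.ofReal (p.NX - (s.usedX + 1 : ℕ)) ≤ ENNReal.ofReal (p.NX - 1) := by
      refine ENNReal.ofReal_le_ofReal ?_
      push_cast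
      linarith
    calc _ ≤ ENNReal.ofReal p.N0 + (1 + ENNReal.ofReal (p.NX - 1) * p.costX) := by gcongr
      _ = (1 + ENNReal.ofReal (p.NX - 1)) * p.costX := by
        rw [add_mul, one_mul, ← add_assoc, costX]; congr 1; exact add_comm _ _
      _ = ENNReal.ofReal p.NX * p.costX := by
        rw [← ENNReal.ofReal_one, ← ENNReal.ofReal_add zero_le_one (by linarith)]
        congr 2; ring

end DEParams

lemma lintegral_seed_fst (f : unitInterval → ℝ≥0∞) (hf : Measurable f) :
    ∫⁻ u : Seed, f u.1 = ∫⁻ u, f u := by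
  rw [Measure.volume_eq_prod]
  have := lintegral_prod_mul (μ := (volume : Measure unitInterval))
    (ν := (volume : Measure unitInterval)) hf.aemeasurable
    (measurable_const (a := (1 : ℝ≥0∞))).aemeasurable
  simpa using this

lemma lintegral_seed_snd (f : unitInterval → ℝ≥0∞) (hf : Measurable f) :
    ∫⁻ u : Seed, f u.2 = ∫⁻ u, f u := by
  rw [Measure.volume_eq_prod]
  have := lintegral_prod_mul (μ := (volume : Measure unitInterval))
    (ν := (volume : Measure unitInterval))
    (measurable_const (a := (1 : ℝ≥0∞))).aemeasurable hf.aemeasurable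
  simpa using this

namespace Model

variable {𝒳 𝒴 : Type*} [MeasurableSpace 𝒳] [MeasurableSpace 𝒴] (M : Model 𝒳 𝒴)
  {p : DEParams}

/-- The observation is held fixed and only the seeds are averaged. Favourable observations merely
shorten the excursion; in the worst case every observation of `X` starts an idle period. The
pointwise form is essential: in the worst-case delay one conditions on the observation but not on
the seeds of the same time. -/
lemma lintegral_seed_excursion_le (hp : p.Positive) (s : DEState) (ob : 𝒳 × 𝒴)
    (hnot : s.next = .expY → s.D + M.Y.llr ob.2 < 0) :
    ∫⁻ u : Seed, p.excursion (M.deStep p s (ob, u)) ≤ p.remaining s := by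
  obtain ⟨haX, haY, hN0, hNX, hμ⟩ := hp
  have hmp : ∀ (N : ℝ) (c : ℕ) (a : ℝ≥0∞), Measurable ((passSet N c).indicator fun _ => a) :=
    fun N c a => measurable_const.indicator (measurableSet_passSet N c)
  cases h : s.next
  · have hb : ∀ u : Seed, p.excursion (M.deStep p s (ob, u)) ≤ (passSet p.NX 0).indicator
        (fun _ => 1 + ENNReal.ofReal (p.NX - ((0 : ℕ) + 1)) * p.costX) u.1 := by
      intro u
      have h0 := not_le.2 (hnot h)
      by_cases hu : randRound p.NX u.1 ≤ 0
      · simp only [deStep, h, h0, hu, if_true, if_false]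
        simp [DEParams.excursion, DEState.atY]
      · rw [Set.indicator_of_mem (show u.1 ∈ passSet p.NX 0 from hu)]
        simp only [deStep, h, h0, hu, if_false]
        simp [DEParams.excursion, DEParams.remaining]
    refine (lintegral_mono hb).trans ?_
    rw [lintegral_seed_fst _ (hmp _ _ _), lintegral_indicator_const (measurableSet_passSet _ _),
      mul_comm]
    refine (volume_passSet_mul_le_mul hNX.le 0 p.one_le_costX).trans ?_
    simp [DEParams.remaining, h, DEParams.maxExcursion]
  · set c := s.usedX + 1 with hc
    set x := 1 + ENNReal.ofReal (p.NX - ((c : ℝ) + 1)) * p.costX with hx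
    have hb : ∀ u : Seed, p.excursion (M.deStep p s (ob, u)) ≤
        (passSet p.NX c).indicator (fun _ => (1 : ℝ≥0∞)) u.1 *
          (x + (passSet p.N0 0).indicator
            (fun _ => 1 + ENNReal.ofReal (p.N0 - ((0 : ℕ) + 1))) u.2) := by
      intro u
      by_cases h0 : 0 ≤ s.D + M.X.llr ob.1
      · simp only [deStep, h, h0, if_true]
        simp [DEParams.excursion, DEState.atY]
      by_cases hu : randRound p.NX u.1 ≤ c
      · simp only [deStep, h, h0, hu, ← hc, if_true, if_false]
        simp [DEParams.excursion, DEState.atY]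
      rw [Set.indicator_of_mem (show u.1 ∈ passSet p.NX c from hu), one_mul]
      by_cases hl : s.level ≤ s.D + M.X.llr ob.1
      · simp only [deStep, h, h0, hu, ← hc, hl, if_true, if_false]
        simp [DEParams.excursion, DEParams.remaining, hx]
      by_cases hu2 : randRound p.N0 u.2 ≤ 0
      · simp only [deStep, h, h0, hu, ← hc, hl, hu2, if_true, if_false]
        simp [DEParams.excursion, DEParams.remaining, hx]
      · rw [Set.indicator_of_mem (show u.2 ∈ passSet p.N0 0 from hu2)]
        simp only [deStep, h, h0, hu, ← hc, hl, hu2, if_false]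
        refine le_of_eq ?_
        simp only [DEParams.excursion, DEParams.remaining, reduceCtorEq, if_false, hx]
        push_cast
        rw [zero_add]
        simp only [add_comm, add_left_comm, add_assoc]
    refine (lintegral_mono hb).trans ?_
    -- The two seeds are independent, so the survival probability of `N_X` factors out, and a new
    -- idle period adds at most `N_0` in mean.
    rw [Measure.volume_eq_prod, lintegral_prod_mul (f := (passSet p.NX c).indicator fun _ => 1)
      (g := fun u => x + (passSet p.N0 0).indicator
        (fun _ => 1 + ENNReal.ofReal (p.N0 - ((0 : ℕ) + 1))) u) (hmp _ _ _).aemeasurable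
      ((hmp _ _ _).const_add _).aemeasurable, lintegral_add_left measurable_const,
      lintegral_indicator_const (measurableSet_passSet _ _),
      lintegral_indicator_const (measurableSet_passSet _ _), one_mul, lintegral_const, measure_univ,
      mul_one, mul_comm _ (volume (passSet p.N0 0))]
    have h2 : volume (passSet p.N0 0) * (1 + ENNReal.ofReal (p.N0 - ((0 : ℕ) + 1))) ≤
        ENNReal.ofReal p.N0 := (volume_passSet_mul_le hN0.le 0).trans (by simp)
    calc _ ≤ volume (passSet p.NX c) * (x + ENNReal.ofReal p.N0) := by gcongr
      _ = volume (passSet p.NX c) * (1 + ENNReal.ofReal (p.NX - ((c : ℝ) + 1))) * p.costX := by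
        rw [mul_assoc]
        congr 1
        rw [add_mul, one_mul, hx, add_right_comm]
        rfl
      _ ≤ ENNReal.ofReal (p.NX - c) * p.costX :=
        mul_le_mul_left (volume_passSet_mul_le hNX.le c) _
      _ = p.remaining s := by simp [DEParams.remaining, h, hc]
  · set j := s.usedIdle + 1 with hj
    set x := 1 + ENNReal.ofReal (p.NX - (s.usedX + 1 : ℕ)) * p.costX with hx
    have hb : ∀ u : Seed, p.excursion (M.deStep p s (ob, u)) ≤
          x + (passSet p.N0 j).indicator
            (fun _ => 1 + ENNReal.ofReal (p.N0 - ((j : ℝ) + 1))) u.2 := by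
      intro u
      by_cases h0 : s.level < s.D + p.μ
      · simp only [deStep, h, h0, if_true]
        simp [DEParams.excursion, DEParams.remaining, hx]
      by_cases hu2 : randRound p.N0 u.2 ≤ j
      · simp only [deStep, h, h0, hu2, ← hj, if_true, if_false]
        simp [DEParams.excursion, DEParams.remaining, hx]
      · rw [Set.indicator_of_mem (show u.2 ∈ passSet p.N0 j from hu2)]
        simp only [deStep, h, h0, hu2, ← hj, if_false]
        refine le_of_eq ?_
        simp only [DEParams.excursion, DEParams.remaining, reduceCtorEq, if_false, hx]
        push_cast
        simp only [add_comm, add_left_comm, add_assoc]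
    refine (lintegral_mono hb).trans ?_
    rw [lintegral_add_left measurable_const, lintegral_seed_snd _ (hmp _ _ _),
      lintegral_indicator_const (measurableSet_passSet _ _), lintegral_const, measure_univ, mul_one,
      mul_comm, add_comm]
    refine (add_le_add (volume_passSet_mul_le hN0.le j) le_rfl).trans (le_of_eq ?_)
    simp [DEParams.remaining, h, hj, hx]

end Model

/-! ### Delay after the change: starting states and comparison with CUSUM. -/

namespace Model

variable {𝒳 𝒴 : Type*} [MeasurableSpace 𝒳] [MeasurableSpace 𝒴] (M : Model 𝒳 𝒴)
  {p : DEParams}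

/-- The mean delay of the algorithm started in the state `s`, after the change. -/
def delay (p : DEParams) (A : ℝ) : DEState → ℝ≥0∞ := meanHit (M.deStep p) M.coord₁ (stopSet A)

lemma measurable_delay (A : ℝ) : Measurable (M.delay p A) :=
  measurable_meanHit _ (M.measurable_deStep p) (measurableSet_stopSet A)

lemma lintegral_coord₁ {F : (𝒳 × 𝒴) × Seed → ℝ≥0∞} (hF : Measurable F) :
    ∫⁻ o, F o ∂M.coord₁ = ∫⁻ ob, (∫⁻ u : Seed, F (ob, u)) ∂M.joint₁ := by
  rw [coord₁, lintegral_prod _ hF.aemeasurable]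

lemma measurable_deStep_left (p : DEParams) (s : DEState) : Measurable (M.deStep p s) :=
  (M.measurable_deStep p).of_uncurry_left (x := s) (f := M.deStep p)

lemma atY_notMem_stopSet {A d : ℝ} (h : d ≤ A) : DEState.atY d ∉ stopSet A := by
  simpa [stopSet, DEState.atY] using h

lemma notMem_stopSet_of_ne {A : ℝ} (hA : 0 ≤ A) {s : DEState} (hs : s ∈ DEState.Reachable p)
    (h : s = DEState.atY 0 ∨ s.next ≠ .expY) : s ∉ stopSet A := by
  rcases h with rfl | h
  · exact atY_notMem_stopSet hA
  · have := (hs.2.1 h).1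
    simp only [stopSet, Set.mem_ofPred_eq]
    linarith

/-- An excursion never stops the algorithm and can return to `Y` only at `0`, so it merely postpones
a start from `0`. In the induction, shortening the horizon by one step costs at most `1`, which pays
for the step. -/
lemma meanHitTrunc_atY_zero_le (hp : p.Positive) {A : ℝ} (hA : 0 ≤ A) (n : ℕ) {s : DEState}
    (hs : s ∈ DEState.Reachable p) (h : s = DEState.atY 0 ∨ s.next ≠ .expY) :
    meanHitTrunc (M.deStep p) M.coord₁ (stopSet A) n (DEState.atY 0) ≤
      meanHitTrunc (M.deStep p) M.coord₁ (stopSet A) n s := by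
  induction n generalizing s with
  | zero => simp [meanHitTrunc]
  | succ n ih =>
    rcases h with rfl | h
    · exact le_rfl
    rw [meanHitTrunc_succ _ (M.measurable_deStep p) (measurableSet_stopSet A) n s]
    calc meanHitTrunc (M.deStep p) M.coord₁ (stopSet A) (n + 1) (DEState.atY 0)
        ≤ 1 + meanHitTrunc (M.deStep p) M.coord₁ (stopSet A) n (DEState.atY 0) := by
          rw [meanHitTrunc, Finset.sum_range_succ, add_comm]
          exact add_le_add (hitTail_le_one _ _ _) le_rfl
      _ = 1 + ∫⁻ _, meanHitTrunc (M.deStep p) M.coord₁ (stopSet A) n (DEState.atY 0)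
            ∂M.coord₁ := by simp
      _ ≤ _ := by
        refine add_le_add le_rfl (lintegral_mono fun o => ?_)
        have hmem := M.deStep_mem hp s hs o
        have hor := M.deStep_of_ne (p := p) s h o
        rw [Set.indicator_of_mem (show _ ∈ (stopSet A)ᶜ from notMem_stopSet_of_ne hA hmem hor)]
        exact ih hmem hor

lemma delay_atY_zero_le (hp : p.Positive) {A : ℝ} (hA : 0 ≤ A) {s : DEState}
    (hs : s ∈ DEState.Reachable p) (h : s = DEState.atY 0 ∨ s.next ≠ .expY) :
    M.delay p A (DEState.atY 0) ≤ M.delay p A s := by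
  rw [delay, meanHit_eq_iSup, meanHit_eq_iSup]
  exact iSup_mono fun n => M.meanHitTrunc_atY_zero_le hp hA n hs h

lemma meanHitTrunc_le_excursion_add (hp : p.Positive) {A : ℝ} (n : ℕ) {s : DEState}
    (hs : s ∈ DEState.Reachable p) (h : s = DEState.atY 0 ∨ s.next ≠ .expY) :
    meanHitTrunc (M.deStep p) M.coord₁ (stopSet A) n s ≤
      p.excursion s + M.delay p A (DEState.atY 0) := by
  induction n generalizing s with
  | zero => simp [meanHitTrunc]
  | succ n ih =>
    rcases h with rfl | h
    · exact le_add_left (meanHitTrunc_le_meanHit _ _ _)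
    have hm : Measurable fun o => (stopSet A)ᶜ.indicator
        (meanHitTrunc (M.deStep p) M.coord₁ (stopSet A) n) (M.deStep p s o) :=
      ((measurable_meanHitTrunc _ (M.measurable_deStep p) (measurableSet_stopSet A) n).indicator
        (measurableSet_stopSet A).compl).comp (M.measurable_deStep_left p s)
    rw [meanHitTrunc_succ _ (M.measurable_deStep p) (measurableSet_stopSet A) n s,
      M.lintegral_coord₁ hm]
    calc _ ≤ 1 + ∫⁻ _, (p.remaining s + M.delay p A (DEState.atY 0)) ∂M.joint₁ := by
          refine add_le_add le_rfl (lintegral_mono fun ob => ?_)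
          calc _ ≤ ∫⁻ u : Seed, (p.excursion (M.deStep p s (ob, u)) +
                M.delay p A (DEState.atY 0)) := lintegral_mono fun u =>
                (Set.indicator_le_self _ _ _).trans
                  (ih (M.deStep_mem hp s hs _) (M.deStep_of_ne s h _))
            _ ≤ _ := by
              rw [lintegral_add_right _ measurable_const, lintegral_const, measure_univ, mul_one]
              exact add_le_add (M.lintegral_seed_excursion_le hp s ob fun hc => absurd hc h) le_rfl
      _ = _ := by
        rw [lintegral_const, measure_univ, mul_one, DEParams.excursion, if_neg h, add_assoc]

lemma delay_le_excursion_add (hp : p.Positive) {A : ℝ} {s : DEState}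
    (hs : s ∈ DEState.Reachable p) (h : s = DEState.atY 0 ∨ s.next ≠ .expY) :
    M.delay p A s ≤ p.excursion s + M.delay p A (DEState.atY 0) := by
  rw [delay, meanHit_eq_iSup]
  exact iSup_le fun n => M.meanHitTrunc_le_excursion_add hp n hs h

/-- After the next step, with the seeds averaged out, the delay of an excursion state is at most
the delay from zero plus the mean length of an excursion. -/
lemma lintegral_seed_delay_le (hp : p.Positive) {A : ℝ} {s : DEState}
    (hs : s ∈ DEState.Reachable p) (ob : 𝒳 × 𝒴)
    (hnot : s.next = .expY → s.D + M.Y.llr ob.2 < 0) :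
    ∫⁻ u : Seed, (stopSet A)ᶜ.indicator (M.delay p A) (M.deStep p s (ob, u)) ≤
      p.maxExcursion + M.delay p A (DEState.atY 0) := by
  calc _ ≤ ∫⁻ u : Seed, (p.excursion (M.deStep p s (ob, u)) + M.delay p A (DEState.atY 0)) := by
        refine lintegral_mono fun u => (Set.indicator_le_self _ _ _).trans
          (M.delay_le_excursion_add hp (M.deStep_mem hp s hs _) ?_)
        by_cases h : s.next = .expY
        · rw [(hs.1 h).2]
          exact M.deStep_atY_of_neg _ _ (hnot h)
        · exact M.deStep_of_ne s h _
    _ ≤ _ := by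
      rw [lintegral_add_right _ measurable_const, lintegral_const, measure_univ, mul_one]
      exact add_le_add ((M.lintegral_seed_excursion_le hp s ob hnot).trans
        (DEParams.remaining_le hs)) le_rfl

/-- Both chains are driven by the same observations. While neither falls, the order is kept; if only
the lower one falls, its delay is at least that from `0` and the induction goes on with `c = 0`. If
both fall, the lower one is again at least as slow as a start from `0`, while the upper one exceeds
that start by one excursion; the argument ends there, so the constant is charged once. -/
lemma meanHitTrunc_atY_le (hp : p.Positive) {A : ℝ} (hA : 0 ≤ A) (n : ℕ) {c d : ℝ} (hc : 0 ≤ c)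
    (hcd : c ≤ d) :
    meanHitTrunc (M.deStep p) M.coord₁ (stopSet A) n (DEState.atY d) ≤
      M.delay p A (DEState.atY c) + p.maxExcursion := by
  induction n generalizing c d with
  | zero => simp [meanHitTrunc]
  | succ n ih =>
    have hd : 0 ≤ d := hc.trans hcd
    have hm : Measurable fun o => (stopSet A)ᶜ.indicator
        (meanHitTrunc (M.deStep p) M.coord₁ (stopSet A) n) (M.deStep p (DEState.atY d) o) :=
      ((measurable_meanHitTrunc _ (M.measurable_deStep p) (measurableSet_stopSet A) n).indicator
        (measurableSet_stopSet A).compl).comp (M.measurable_deStep_left p _)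
    have hm' : Measurable fun o => (stopSet A)ᶜ.indicator
        (M.delay p A) (M.deStep p (DEState.atY c) o) :=
      ((M.measurable_delay A).indicator
        (measurableSet_stopSet A).compl).comp (M.measurable_deStep_left p _)
    rw [meanHitTrunc_succ _ (M.measurable_deStep p) (measurableSet_stopSet A) n,
      M.lintegral_coord₁ hm, delay,
      meanHit_eq _ (M.measurable_deStep p) (measurableSet_stopSet A), ← delay,
      M.lintegral_coord₁ hm', add_assoc]
    refine add_le_add le_rfl ?_
    calc _ ≤ ∫⁻ ob, ((∫⁻ u : Seed, (stopSet A)ᶜ.indicator (M.delay p A)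
          (M.deStep p (DEState.atY c) (ob, u))) + p.maxExcursion) ∂M.joint₁ := ?_
      _ = _ := by
        rw [lintegral_add_right _ measurable_const, lintegral_const, measure_univ, mul_one]
    refine lintegral_mono fun ob => ?_
    have hzero : c + M.Y.llr ob.2 < 0 → M.delay p A (DEState.atY 0) ≤
        ∫⁻ u : Seed, (stopSet A)ᶜ.indicator (M.delay p A)
          (M.deStep p (DEState.atY c) (ob, u)) := by
      intro hneg
      calc M.delay p A (DEState.atY 0) = ∫⁻ _ : Seed, M.delay p A (DEState.atY 0) := by simp
        _ ≤ _ := by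
          refine lintegral_mono fun u => ?_
          have hor := M.deStep_atY_of_neg (p := p) c (ob, u) hneg
          have hmem := M.deStep_mem hp _ (DEState.atY_mem (p := p) hc) (ob, u)
          rw [Set.indicator_of_mem (show _ ∈ (stopSet A)ᶜ from notMem_stopSet_of_ne hA hmem hor)]
          exact M.delay_atY_zero_le hp hA hmem hor
    by_cases h0 : 0 ≤ d + M.Y.llr ob.2
    · have hstep : ∀ u : Seed, M.deStep p (DEState.atY d) (ob, u) =
          DEState.atY (d + M.Y.llr ob.2) := fun u => M.deStep_atY_of_nonneg d (ob, u) h0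
      simp only [hstep, lintegral_const, measure_univ, mul_one]
      by_cases hst : A < d + M.Y.llr ob.2
      · rw [Set.indicator_of_notMem (by simpa [stopSet, DEState.atY] using hst)]
        exact zero_le
      push Not at hst
      rw [Set.indicator_of_mem (show _ ∈ (stopSet A)ᶜ from atY_notMem_stopSet hst)]
      by_cases h1 : 0 ≤ c + M.Y.llr ob.2
      · have hstep' : ∀ u : Seed, M.deStep p (DEState.atY c) (ob, u) =
            DEState.atY (c + M.Y.llr ob.2) := fun u => M.deStep_atY_of_nonneg c (ob, u) h1
        simp only [hstep', lintegral_const, measure_univ, mul_one]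
        rw [Set.indicator_of_mem (show _ ∈ (stopSet A)ᶜ from
          atY_notMem_stopSet (le_trans (by linarith) hst))]
        exact ih h1 (by linarith)
      · push Not at h1
        exact (ih le_rfl h0).trans (add_le_add (hzero h1) le_rfl)
    · push Not at h0
      calc _ ≤ ∫⁻ u : Seed, (stopSet A)ᶜ.indicator (M.delay p A)
            (M.deStep p (DEState.atY d) (ob, u)) := lintegral_mono fun u =>
              Set.indicator_le_indicator (meanHitTrunc_le_meanHit _ _ _)
        _ ≤ p.maxExcursion + M.delay p A (DEState.atY 0) :=
          M.lintegral_seed_delay_le hp (DEState.atY_mem hd) ob fun _ => h0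
        _ ≤ _ := by
          rw [add_comm]
          exact add_le_add (hzero (by linarith)) le_rfl

lemma delay_atY_le (hp : p.Positive) {A : ℝ} (hA : 0 ≤ A) {d : ℝ} (hd : 0 ≤ d) :
    M.delay p A (DEState.atY d) ≤ M.delay p A (DEState.atY 0) + p.maxExcursion := by
  rw [delay, meanHit_eq_iSup]
  exact iSup_le fun n => M.meanHitTrunc_atY_le hp hA n le_rfl hd

/-- The worst remaining delay after a step, with the seeds of that step averaged out. -/
lemma lintegral_seed_delay_le_of_reachable (hp : p.Positive) {A : ℝ} (hA : 0 ≤ A) {s : DEState}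
    (hs : s ∈ DEState.Reachable p) (ob : 𝒳 × 𝒴) :
    ∫⁻ u : Seed, (stopSet A)ᶜ.indicator (M.delay p A) (M.deStep p s (ob, u)) ≤
      M.delay p A (DEState.atY 0) + p.maxExcursion := by
  by_cases h : s.next = .expY ∧ 0 ≤ s.D + M.Y.llr ob.2
  · calc _ ≤ ∫⁻ _ : Seed, (M.delay p A (DEState.atY 0) + p.maxExcursion) := by
          refine lintegral_mono fun u => (Set.indicator_le_self _ _ _).trans ?_
          rw [(hs.1 h.1).2, M.deStep_atY_of_nonneg _ (ob, u) h.2]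
          exact M.delay_atY_le hp hA h.2
      _ = _ := by simp
  · rw [add_comm]
    exact M.lintegral_seed_delay_le hp hs ob fun h1 => by
      by_contra hc
      exact h ⟨h1, not_lt.1 hc⟩

/-- One step of the CUSUM statistic of `Y`. -/
def cusumStep (d : ℝ) (o : (𝒳 × 𝒴) × Seed) : ℝ := max (d + M.Y.llr o.1.2) 0

lemma measurable_cusumStep :
    Measurable fun q : ℝ × ((𝒳 × 𝒴) × Seed) => M.cusumStep q.1 q.2 :=
  (measurable_fst.add (M.Y.measurable_llr.comp (measurable_obsY.comp measurable_snd))).max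
    measurable_const

/-- The mean delay of the CUSUM algorithm started at `d`, after the change. -/
def cusumDelay (A : ℝ) : ℝ → ℝ≥0∞ := meanHit M.cusumStep M.coord₁ (Set.Ioi A)

lemma measurable_cusumDelay (A : ℝ) : Measurable (M.cusumDelay A) :=
  measurable_meanHit _ M.measurable_cusumStep measurableSet_Ioi

/-- The delay of the algorithm exceeds the delay of CUSUM by a constant. -/
lemma delay_le_cusumDelay_add (hp : p.Positive) {A : ℝ} (hA : 0 ≤ A) {ρ κ : ℝ}
    (hρ : ∫⁻ x, ENNReal.ofReal (Real.exp (-M.Y.llr x / 2)) ∂M.Y.law₁ = ENNReal.ofReal ρ)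
    (hκ : 0 ≤ κ) (hρκ : (κ + 1) * ρ ≤ κ) :
    M.delay p A (DEState.atY 0) ≤
      M.cusumDelay A 0 + p.maxExcursion * ENNReal.ofReal κ := by
  set B := p.maxExcursion with hB
  set g := M.cusumDelay A with hg
  set c : ℝ≥0∞ := g 0 + B * ENNReal.ofReal κ with hc
  -- The potential is the CUSUM delay plus `B` times a bound `κ exp(-D/2)` for the mean number of
  -- further falls. A fall counts `κ + 1`, which is at most `(κ + 1) exp(-(d + ℓ_Y)/2)` because the
  -- exponent is then positive; the mean of this is `(κ + 1) ρ exp(-d/2) ≤ κ exp(-d/2)`.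
  let Φ : DEState → ℝ≥0∞ := fun s => if s.next = .expY then
      g s.D + B * ENNReal.ofReal (κ * Real.exp (-s.D / 2)) else p.excursion s + c
  have hΦY : ∀ d, Φ (DEState.atY d) = g d + B * ENNReal.ofReal (κ * Real.exp (-d / 2)) :=
    fun d => by simp [Φ, DEState.atY]
  have hΦ0 : ∀ s, s = DEState.atY 0 ∨ s.next ≠ .expY → Φ s = p.excursion s + c := by
    rintro s (rfl | h)
    · rw [hΦY]; simp [DEParams.excursion, DEState.atY, hc]
    · simp [Φ, h]
  have hsuper : ∀ s ∈ DEState.Reachable p, s ∉ stopSet A →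
      1 + ∫⁻ o, (stopSet A)ᶜ.indicator Φ (M.deStep p s o) ∂M.coord₁ ≤ Φ s := by
    intro s hs hsA
    by_cases h : s.next = .expY
    · obtain ⟨hD, hsD⟩ := hs.1 h
      set d := s.D with hd
      rw [hsD, hΦY]
      have hmg : Measurable fun o : (𝒳 × 𝒴) × Seed => (Set.Ioi A)ᶜ.indicator g (M.cusumStep d o) :=
        ((M.measurable_cusumDelay A).indicator measurableSet_Ioi.compl).comp
          (M.measurable_cusumStep.of_uncurry_left (x := d) (f := M.cusumStep))
      have hme : Measurable fun y : 𝒴 =>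
          B * ENNReal.ofReal ((κ + 1) * Real.exp (-(d + M.Y.llr y) / 2)) :=
        (((((M.Y.measurable_llr.const_add d).neg.div_const 2).exp).const_mul
          (κ + 1)).ennreal_ofReal).const_mul B
      have hsum : Measurable fun o : (𝒳 × 𝒴) × Seed => (Set.Ioi A)ᶜ.indicator g (M.cusumStep d o) +
          B * ENNReal.ofReal ((κ + 1) * Real.exp (-(d + M.Y.llr o.1.2) / 2)) :=
        hmg.add (hme.comp measurable_obsY)
      have hpt : ∀ ob : 𝒳 × 𝒴, ∫⁻ u : Seed, (stopSet A)ᶜ.indicator Φ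
            (M.deStep p (DEState.atY d) (ob, u)) ≤
          ∫⁻ u : Seed, ((Set.Ioi A)ᶜ.indicator g (M.cusumStep d (ob, u)) +
            B * ENNReal.ofReal ((κ + 1) * Real.exp (-(d + M.Y.llr ob.2) / 2))) := by
        intro ob
        by_cases h0 : 0 ≤ d + M.Y.llr ob.2
        · refine lintegral_mono fun u => ?_
          rw [M.deStep_atY_of_nonneg d (ob, u) h0]
          have hcs : M.cusumStep d (ob, u) = d + M.Y.llr ob.2 := max_eq_left h0
          rw [hcs]
          by_cases hst : A < d + M.Y.llr ob.2
          · rw [Set.indicator_of_notMem (by simpa [stopSet, DEState.atY] using hst)]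
            exact zero_le
          · rw [Set.indicator_of_mem (show _ ∈ (stopSet A)ᶜ from
              atY_notMem_stopSet (not_lt.1 hst)), Set.indicator_of_mem (by simpa using hst), hΦY]
            gcongr
            linarith
        · push Not at h0
          have hcs : ∀ u : Seed, M.cusumStep d (ob, u) = 0 := fun u => max_eq_right h0.le
          simp only [hcs]
          rw [Set.indicator_of_mem (by simpa using hA)]
          calc _ ≤ ∫⁻ u : Seed, (p.excursion (M.deStep p (DEState.atY d) (ob, u)) + c) := by
                refine lintegral_mono fun u => (Set.indicator_le_self _ _ _).trans (le_of_eq ?_)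
                exact hΦ0 _ (M.deStep_atY_of_neg d (ob, u) h0)
            _ ≤ B + c := by
              rw [lintegral_add_right _ measurable_const, lintegral_const, measure_univ, mul_one]
              exact add_le_add (M.lintegral_seed_excursion_le hp _ ob fun _ => h0) le_rfl
            _ = g 0 + B * ENNReal.ofReal (κ + 1) := by
              rw [hc, ENNReal.ofReal_add hκ zero_le_one, ENNReal.ofReal_one]
              ring
            _ ≤ _ := by
              rw [lintegral_const, measure_univ, mul_one]
              gcongr
              have : 1 ≤ Real.exp (-(d + M.Y.llr ob.2) / 2) := Real.one_le_exp (by linarith)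
              nlinarith
      calc _ ≤ 1 + ∫⁻ ob, (∫⁻ u : Seed, ((Set.Ioi A)ᶜ.indicator g (M.cusumStep d (ob, u)) +
            B * ENNReal.ofReal ((κ + 1) * Real.exp (-(d + M.Y.llr ob.2) / 2)))) ∂M.joint₁ := by
            refine add_le_add le_rfl ?_
            rw [coord₁]
            exact (lintegral_prod_le_lintegral_lintegral _ _ _).trans (lintegral_mono hpt)
        _ = 1 + (∫⁻ o, (Set.Ioi A)ᶜ.indicator g (M.cusumStep d o) ∂M.coord₁ +
            ∫⁻ y, B * ENNReal.ofReal ((κ + 1) * Real.exp (-(d + M.Y.llr y) / 2)) ∂M.Y.law₁) := by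
            rw [← M.lintegral_Y₁ hme, ← lintegral_add_left hmg,
              M.lintegral_coord₁ hsum]
        _ = g d + ∫⁻ y, B * ENNReal.ofReal ((κ + 1) * Real.exp (-(d + M.Y.llr y) / 2))
              ∂M.Y.law₁ := by
            rw [← add_assoc]
            congr 1
            exact (meanHit_eq _ M.measurable_cusumStep measurableSet_Ioi d).symm
        _ ≤ _ := by
            refine add_le_add le_rfl ?_
            have hfac : ∀ y, B * ENNReal.ofReal ((κ + 1) * Real.exp (-(d + M.Y.llr y) / 2)) =
                B * ENNReal.ofReal ((κ + 1) * Real.exp (-d / 2)) *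
                  ENNReal.ofReal (Real.exp (-M.Y.llr y / 2)) := by
              intro y
              rw [mul_assoc, ← ENNReal.ofReal_mul (by positivity), mul_assoc, ← Real.exp_add]
              congr 4
              ring
            simp only [hfac]
            have hmexp : Measurable fun y => ENNReal.ofReal (Real.exp (-M.Y.llr y / 2)) :=
              (M.Y.measurable_llr.neg.div_const 2).exp.ennreal_ofReal
            rw [lintegral_const_mul _ hmexp, hρ,
              mul_assoc, ← ENNReal.ofReal_mul (by positivity)]
            refine mul_le_mul_right (ENNReal.ofReal_le_ofReal ?_) _
            have := mul_le_mul_of_nonneg_right hρκ (Real.exp_pos (-d / 2)).le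
            linarith
    · rw [hΦ0 s (Or.inr h), DEParams.excursion, if_neg h, add_assoc]
      refine add_le_add le_rfl ?_
      rw [coord₁]
      refine (lintegral_prod_le_lintegral_lintegral _ _ _).trans ?_
      calc _ ≤ ∫⁻ _, (p.remaining s + c) ∂M.joint₁ := by
            refine lintegral_mono fun ob => ?_
            calc _ ≤ ∫⁻ u : Seed, (p.excursion (M.deStep p s (ob, u)) + c) := by
                  refine lintegral_mono fun u => (Set.indicator_le_self _ _ _).trans (le_of_eq ?_)
                  exact hΦ0 _ (M.deStep_of_ne s h (ob, u))
              _ ≤ _ := by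
                rw [lintegral_add_right _ measurable_const, lintegral_const, measure_univ, mul_one]
                exact add_le_add
                  (M.lintegral_seed_excursion_le hp _ ob fun hc => absurd hc h) le_rfl
        _ = _ := by rw [lintegral_const, measure_univ, mul_one]
  have := meanHit_le_of_supersolution M.coord₁ (M.measurable_deStep p) (measurableSet_stopSet A)
    (M.deStep_mem hp) hsuper (DEState.atY_mem (p := p) le_rfl) (atY_notMem_stopSet hA)
  rw [hΦY] at this
  simpa [hc, delay] using this

/-- Wald's argument as a supersolution: `(A + M' - d)/I'` falls in mean by at least `1` per step,
since reflection at `0` only raises the statistic. The cap `M'` on the increments keeps the function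
nonnegative one step past the threshold. -/
lemma cusumDelay_le {A M' I' : ℝ} (hA : 0 ≤ A) (hM' : 0 ≤ M') (hI' : 0 < I')
    (hint : Integrable (fun y => min (M.Y.llr y) M') M.Y.law₁)
    (hI : I' ≤ ∫ y, min (M.Y.llr y) M' ∂M.Y.law₁) :
    M.cusumDelay A 0 ≤ ENNReal.ofReal ((A + M') / I') := by
  have hsuper : ∀ d ∈ (Set.univ : Set ℝ), d ∉ Set.Ioi A →
      1 + ∫⁻ o, (Set.Ioi A)ᶜ.indicator (fun d => ENNReal.ofReal ((A + M' - d) / I'))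
        (M.cusumStep d o) ∂M.coord₁ ≤ ENNReal.ofReal ((A + M' - d) / I') := by
    intro d _ hd
    simp only [Set.mem_Ioi, not_lt] at hd
    have hint' : Integrable (fun o : (𝒳 × 𝒴) × Seed => min (M.Y.llr o.1.2) M') M.coord₁ := by
      rw [← M.map_Y₁] at hint
      exact hint.comp_measurable measurable_obsY
    have hintegral : ∫ o : (𝒳 × 𝒴) × Seed, min (M.Y.llr o.1.2) M' ∂M.coord₁ =
        ∫ y, min (M.Y.llr y) M' ∂M.Y.law₁ := by
      rw [← M.map_Y₁, integral_map measurable_obsY.aemeasurable]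
      exact (M.Y.measurable_llr.min measurable_const).aestronglyMeasurable
    have hint2 : Integrable (fun o : (𝒳 × 𝒴) × Seed =>
        (A + M' - d) / I' - min (M.Y.llr o.1.2) M' / I') M.coord₁ :=
      (integrable_const _).sub (hint'.div_const I')
    have h := lintegral_ofReal_add_le (κ := M.coord₁)
      (g := fun o => (A + M' - d) / I' - min (M.Y.llr o.1.2) M' / I')
      (c := 1) (x := (A + M' - d) / I') (b := 0) hint2 (fun o => ?_) (fun o => le_rfl)
      zero_le_one (by apply div_nonneg _ hI'.le; linarith) le_rfl ?_
    · rw [ENNReal.ofReal_one, ENNReal.ofReal_zero, add_zero, add_comm] at h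
      refine le_trans (add_le_add le_rfl (lintegral_mono fun o => ?_)) h
      by_cases ho : M.cusumStep d o ∈ Set.Ioi A
      · rw [Set.indicator_of_notMem (by simpa using ho)]
        exact zero_le
      · rw [Set.indicator_of_mem (by exact ho), ← sub_div]
        refine ENNReal.ofReal_le_ofReal (div_le_div_of_nonneg_right ?_ hI'.le)
        have h1 : d + M.Y.llr o.1.2 ≤ M.cusumStep d o := le_max_left _ _
        have h2 := min_le_left (M.Y.llr o.1.2) M'
        linarith
    · rw [← sub_div]
      apply div_nonneg _ hI'.le
      have := min_le_right (M.Y.llr o.1.2) M'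
      linarith
    · rw [integral_sub (integrable_const _) (hint'.div_const I'),
        integral_div I' (fun o : (𝒳 × 𝒴) × Seed => min (M.Y.llr o.1.2) M'), hintegral]
      simp only [integral_const, probReal_univ, smul_eq_mul, one_mul, add_zero]
      have : 1 ≤ (∫ y, min (M.Y.llr y) M' ∂M.Y.law₁) / I' := by rwa [le_div_iff₀ hI', one_mul]
      linarith
  have := meanHit_le_of_supersolution M.coord₁ M.measurable_cusumStep
    (measurableSet_Ioi (a := A)) (fun _ _ _ => Set.mem_univ _) hsuper (Set.mem_univ (0 : ℝ))
    (by simpa using hA)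
  simpa [cusumDelay] using this

end Model

/-! ### The information of a policy and the past of the sample. -/

lemma mem_iff_of_measurableSet_iSup {Ω β : Type*} [MeasurableSpace β] {s : Finset ℕ}
    {f : ℕ → Ω → β} {B : Set Ω}
    (hB : MeasurableSet[⨆ k ∈ s, MeasurableSpace.comap (f k) inferInstance] B) {ω ω' : Ω}
    (h : ∀ k ∈ s, f k ω = f k ω') : ω ∈ B ↔ ω' ∈ B := by
  have hle : (⨆ k ∈ s, MeasurableSpace.comap (f k) inferInstance) ≤
      MeasurableSpace.comap (fun ω (k : s) => f k ω) ⊤ := by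
    refine iSup₂_le fun k hk => ?_
    rintro _ ⟨t, -, rfl⟩
    exact ⟨{g | g ⟨k, hk⟩ ∈ t}, trivial, rfl⟩
  obtain ⟨t, -, rfl⟩ := hle _ hB
  have : (fun k : s => f k ω) = fun k : s => f k ω' := funext fun k => h k k.2
  simp only [Set.mem_preimage, this]

section Past

variable (𝒳 𝒴 : Type*) [MeasurableSpace 𝒳] [MeasurableSpace 𝒴]

/-- The σ-algebra of the coordinates before `n`. -/
abbrev past (n : ℕ) : MeasurableSpace (Sample 𝒳 𝒴) :=
  ⨆ k ∈ Finset.range n, MeasurableSpace.comap (fun ω : Sample 𝒳 𝒴 => ω k) inferInstance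

lemma past_le (n : ℕ) : past 𝒳 𝒴 n ≤ MeasurableSpace.pi :=
  iSup₂_le fun k _ => (measurable_pi_apply k).comap_le

variable {𝒳 𝒴}

lemma past_mono {m n : ℕ} (h : m ≤ n) : past 𝒳 𝒴 m ≤ past 𝒳 𝒴 n :=
  biSup_mono fun _ hk => Finset.mem_range.2 ((Finset.mem_range.1 hk).trans_le h)

lemma measurable_past_eval {k n : ℕ} (h : k < n) :
    Measurable[past 𝒳 𝒴 n] fun ω : Sample 𝒳 𝒴 => ω k :=
  measurable_iff_comap_le.2 (le_iSup₂_of_le k (Finset.mem_range.2 h) le_rfl)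

lemma seedInfo_le_past (n : ℕ) : seedInfo 𝒳 𝒴 n ≤ past 𝒳 𝒴 (n + 1) :=
  iSup₂_le fun _ hk =>
    (measurable_snd.comp (measurable_past_eval (Finset.mem_range.1 hk))).comap_le

omit [MeasurableSpace 𝒳] [MeasurableSpace 𝒴] in
lemma measurable_seedInfo_eval {k n : ℕ} (h : k ≤ n) :
    Measurable[seedInfo 𝒳 𝒴 n] fun ω : Sample 𝒳 𝒴 => (ω k).2 :=
  measurable_iff_comap_le.2 (le_iSup₂_of_le k (Finset.mem_range.2 (by omega)) le_rfl)

omit [MeasurableSpace 𝒳] [MeasurableSpace 𝒴] in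
lemma seedInfo_mono {m n : ℕ} (h : m ≤ n) : seedInfo 𝒳 𝒴 m ≤ seedInfo 𝒳 𝒴 n :=
  biSup_mono fun _ hk => Finset.mem_range.2 ((Finset.mem_range.1 hk).trans_le (by omega))

namespace Policy

variable (Ψ : Policy 𝒳 𝒴)

lemma info_mono {m n : ℕ} (h : m ≤ n) : Ψ.info m ≤ Ψ.info n :=
  biSup_mono fun _ hk => by simp only [Finset.mem_Icc] at hk ⊢; omega

lemma measurable_record {k n : ℕ} (hk : 1 ≤ k) (h : k ≤ n) :
    Measurable[Ψ.info n] (Ψ.record k) :=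
  measurable_iff_comap_le.2 (le_iSup₂_of_le k (Finset.mem_Icc.2 ⟨hk, h⟩) le_rfl)

lemma info_zero : Ψ.info 0 = ⊥ := by simp [info]

lemma info_succ (n : ℕ) :
    Ψ.info (n + 1) = Ψ.info n ⊔ MeasurableSpace.comap (Ψ.record (n + 1)) inferInstance := by
  refine le_antisymm (iSup₂_le fun k hk => ?_) (sup_le (Ψ.info_mono n.le_succ)
    (Ψ.measurable_record (by omega) le_rfl).comap_le)
  rw [Finset.mem_Icc] at hk
  rcases Nat.lt_or_ge n k with h | h
  · obtain rfl : k = n + 1 := by omega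
    exact le_sup_right
  · exact (Ψ.measurable_record hk.1 h).comap_le.trans le_sup_left

/-- The record is measurable as soon as the choice and the outcome are. -/
lemma measurable_record_of {m : MeasurableSpace (Sample 𝒳 𝒴)} {k : ℕ}
    (hs : Measurable[m] (Ψ.select k)) (ho : Measurable[m] fun ω : Sample 𝒳 𝒴 => (ω k).1) :
    Measurable[m] (Ψ.record k) := by
  have : Ψ.record k = fun ω => if Ψ.select k ω = .expX then Sum.inl (ω k).1.1
      else if Ψ.select k ω = .expY then Sum.inr (Sum.inl (ω k).1.2) else Sum.inr (Sum.inr ()) := by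
    funext ω
    cases h : Ψ.select k ω <;> simp [record, h]
  rw [this]
  refine Measurable.ite (hs (measurableSet_singleton _)) (measurable_inl.comp ho.fst)
    (Measurable.ite (hs (measurableSet_singleton _))
      (measurable_inr.comp (measurable_inl.comp ho.snd)) measurable_const)

variable {Ψ}

lemma IsAdmissible.info_sup_le_past (hΨ : Ψ.IsAdmissible) (n : ℕ) :
    Ψ.info n ⊔ seedInfo 𝒳 𝒴 n ≤ past 𝒳 𝒴 (n + 1) := by
  refine sup_le ?_ (seedInfo_le_past n)
  induction n with
  | zero => rw [info_zero]; exact bot_le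
  | succ n ih =>
    rw [info_succ]
    refine sup_le (ih.trans (past_mono (by omega))) ?_
    have hs : Measurable[past 𝒳 𝒴 (n + 1 + 1)] (Ψ.select (n + 1)) :=
      (hΨ.1 n).mono ((sup_le ih (seedInfo_le_past n)).trans (past_mono (by omega))) le_rfl
    exact (Ψ.measurable_record_of hs
      (measurable_fst.comp (measurable_past_eval (Nat.lt_succ_self _)))).comap_le

lemma IsAdmissible.info_le (hΨ : Ψ.IsAdmissible) (n : ℕ) : Ψ.info n ≤ MeasurableSpace.pi :=
  le_sup_left.trans ((hΨ.info_sup_le_past n).trans (past_le 𝒳 𝒴 _))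

lemma IsAdmissible.measurable_select (hΨ : Ψ.IsAdmissible) (n : ℕ) :
    Measurable[past 𝒳 𝒴 (n + 1)] (Ψ.select (n + 1)) :=
  (hΨ.1 n).mono (hΨ.info_sup_le_past n) le_rfl

lemma IsAdmissible.select_eq (hΨ : Ψ.IsAdmissible) {n : ℕ} {ω ω' : Sample 𝒳 𝒴}
    (h : ∀ k ≤ n, ω k = ω' k) : Ψ.select (n + 1) ω = Ψ.select (n + 1) ω' := by
  have := hΨ.measurable_select n (measurableSet_singleton (Ψ.select (n + 1) ω))
  exact (((mem_iff_of_measurableSet_iSup this (ω := ω) (ω' := ω') fun k hk =>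
    h k (by have := Finset.mem_range.1 hk; omega)).1 rfl : _ = _)).symm

/-- The information of time `n` does not depend on the seeds of time `n`. -/
lemma IsAdmissible.mem_info_iff (hΨ : Ψ.IsAdmissible) {n : ℕ} {B : Set (Sample 𝒳 𝒴)}
    (hB : MeasurableSet[Ψ.info n] B) {ω ω' : Sample 𝒳 𝒴} (h : ∀ k < n, ω k = ω' k)
    (hn : (ω n).1 = (ω' n).1) : ω ∈ B ↔ ω' ∈ B := by
  refine mem_iff_of_measurableSet_iSup hB fun k hk => ?_
  rw [Finset.mem_Icc] at hk
  obtain ⟨k, rfl⟩ : ∃ j, k = j + 1 := ⟨k - 1, by omega⟩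
  have hsel := hΨ.select_eq (n := k) (ω := ω) (ω' := ω') fun i hi => h i (by omega)
  have ho : (ω (k + 1)).1 = (ω' (k + 1)).1 := by
    rcases hk.2.eq_or_lt with he | hl
    · rw [he, hn]
    · rw [h _ hl]
  simp only [record, hsel, ho]

end Policy

end Past

/-! ### Admissibility of the algorithm. -/

namespace Model

variable {𝒳 𝒴 : Type*} [MeasurableSpace 𝒳] [MeasurableSpace 𝒴] (M : Model 𝒳 𝒴)
  {p : DEParams}

/-- The increment of the statistic, read off from the record. -/
def recordLLR : 𝒳 ⊕ 𝒴 ⊕ Unit → ℝ := Sum.elim M.X.llr (Sum.elim M.Y.llr fun _ => 0)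

lemma measurable_recordLLR : Measurable M.recordLLR :=
  M.X.measurable_llr.sumElim (M.Y.measurable_llr.sumElim measurable_const)

lemma recordLLR_record (Ψ : Policy 𝒳 𝒴) (k : ℕ) (ω : Sample 𝒳 𝒴) :
    M.recordLLR (Ψ.record k ω) = M.obsLLR (Ψ.select k ω) (ω k).1 := by
  cases h : Ψ.select k ω <;> simp [Policy.record, recordLLR, obsLLR, h]

/-- The choice, read off from the record. -/
def recordChoice : 𝒳 ⊕ 𝒴 ⊕ Unit → Choice :=
  Sum.elim (fun _ => .expX) (Sum.elim (fun _ => .expY) fun _ => .idle)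

lemma measurable_recordChoice : Measurable (recordChoice : 𝒳 ⊕ 𝒴 ⊕ Unit → Choice) :=
  measurable_const.sumElim (measurable_const.sumElim measurable_const)

omit [MeasurableSpace 𝒳] [MeasurableSpace 𝒴] in
lemma recordChoice_record (Ψ : Policy 𝒳 𝒴) (k : ℕ) (ω : Sample 𝒳 𝒴) :
    recordChoice (Ψ.record k ω) = Ψ.select k ω := by
  cases h : Ψ.select k ω <;> simp [Policy.record, recordChoice, h]

/-- Whenever an answer about a limit affects the step, it can be read off from the next choice: an
exhausted `N_X` leads back to `Y`, an exhausted `N_0` to `X`. -/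
lemma stepB_eq_of_next (s : DEState) (x : ℝ) (bX bI : Bool) :
    stepB p s x bX bI = stepB p s x (decide ((stepB p s x bX bI).next = .expY))
      (decide ((stepB p s x bX bI).next = .expX)) := by
  cases h : s.next <;> cases bX <;> cases bI <;> simp only [stepB, h, DEState.atY] <;>
    split_ifs <;> simp_all

lemma select_de2e_succ (A : ℝ) (n : ℕ) (ω : Sample 𝒳 𝒴) :
    (M.de2e A p).select (n + 1) ω = (M.deState p ω n).next := rfl

lemma deState_succ_eq (A : ℝ) (n : ℕ) (ω : Sample 𝒳 𝒴) : M.deState p ω (n + 1) =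
    stepB p (M.deState p ω n) (M.recordLLR ((M.de2e A p).record (n + 1) ω))
      (decide (randRound p.NX (ω (n + 1)).2.1 ≤ (M.deState p ω n).cntX))
      (decide (randRound p.N0 (ω (n + 1)).2.2 ≤ (M.deState p ω n).cntI)) := by
  rw [recordLLR_record, select_de2e_succ, ← deStep_eq]
  rfl

lemma measurable_deState_info_sup (A : ℝ) (n : ℕ) :
    Measurable[(M.de2e A p).info n ⊔ seedInfo 𝒳 𝒴 n] fun ω => M.deState p ω n := by
  induction n with
  | zero => exact measurable_const
  | succ n ih =>
    have hs := ih.mono (sup_le_sup ((M.de2e A p).info_mono n.le_succ)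
      (seedInfo_mono n.le_succ)) le_rfl
    have hr := ((M.de2e A p).measurable_record (k := n + 1) (by omega) le_rfl).mono
      (le_sup_left (b := seedInfo 𝒳 𝒴 (n + 1))) le_rfl
    have hu := (measurable_seedInfo_eval (𝒳 := 𝒳) (𝒴 := 𝒴) (le_refl (n + 1))).mono
      (le_sup_right (a := (M.de2e A p).info (n + 1))) le_rfl
    simp only [M.deState_succ_eq A]
    exact (measurable_stepB p).comp (hs.prodMk ((M.measurable_recordLLR.comp hr).prodMk
      ((measurable_decide_le ((measurable_randRound _).comp hu.fst)
        (DEState.measurable_cntX.comp hs)).prodMk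
      (measurable_decide_le ((measurable_randRound _).comp hu.snd)
        (DEState.measurable_cntI.comp hs)))))

/-- The seeds are not observed, but the record of time `n + 1` contains the choice made then, and by
`stepB_eq_of_next` that choice replaces the seeds of time `n`. -/
lemma measurable_deState_info_succ (A : ℝ) (n : ℕ) :
    Measurable[(M.de2e A p).info (n + 1)] fun ω => M.deState p ω n := by
  induction n with
  | zero => exact measurable_const
  | succ n ih =>
    have hs := ih.mono ((M.de2e A p).info_mono (n + 1).le_succ) le_rfl
    have hr := (M.de2e A p).measurable_record (k := n + 1) (n := n + 1 + 1) (by omega) (by omega)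
    have hc : Measurable[(M.de2e A p).info (n + 1 + 1)] fun ω => (M.deState p ω (n + 1)).next := by
      have h : (fun ω => (M.deState p ω (n + 1)).next) =
          recordChoice ∘ (M.de2e A p).record (n + 1 + 1) :=
        funext fun ω => (recordChoice_record (M.de2e A p) (n + 1 + 1) ω).symm
      rw [h]
      exact measurable_recordChoice.comp
        ((M.de2e A p).measurable_record (k := n + 1 + 1) (n := n + 1 + 1) (by omega) le_rfl)
    have heq : (fun ω => M.deState p ω (n + 1)) = fun ω => stepB p (M.deState p ω n)
        (M.recordLLR ((M.de2e A p).record (n + 1) ω))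
        (decide ((M.deState p ω (n + 1)).next = .expY))
        (decide ((M.deState p ω (n + 1)).next = .expX)) := by
      funext ω
      conv_lhs => rw [M.deState_succ_eq A, stepB_eq_of_next, ← M.deState_succ_eq A]
    have hd : ∀ c : Choice, Measurable fun c' : Choice => decide (c' = c) := fun c =>
      measurable_from_top
    rw [heq]
    exact (measurable_stepB p).comp (hs.prodMk ((M.measurable_recordLLR.comp hr).prodMk
      (((hd .expY).comp hc).prodMk ((hd .expX).comp hc))))

/-- The threshold is positive and can be crossed only by an observation of `Y`. Hence crossing at
time `n + 1` depends on the state after time `n` and the new record, with no unseen seed; this makes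
the declaration a stopping time of `(I_n)`. -/
lemma lt_D_deStep_iff (hp : p.Positive) {A : ℝ} (hA : 0 < A) {s : DEState}
    (hs : s ∈ DEState.Reachable p) (o : (𝒳 × 𝒴) × Seed) :
    A < (M.deStep p s o).D ↔ s.next = .expY ∧ A < s.D + M.obsLLR s.next o.1 := by
  have hneg : ∀ {t : DEState}, t ∈ DEState.Reachable p → t = DEState.atY 0 ∨ t.next ≠ .expY →
      ¬ A < t.D := by
    rintro t ht (rfl | h)
    · simpa [DEState.atY] using hA.le
    · have := (ht.2.1 h).1
      linarith
  by_cases h : s.next = .expY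
  · simp only [h, true_and, obsLLR]
    by_cases h0 : 0 ≤ s.D + M.Y.llr o.1.2
    · rw [(hs.1 h).2, M.deStep_atY_of_nonneg _ _ h0]
      rfl
    · push Not at h0
      have hmem := M.deStep_mem hp s hs o
      have hor : M.deStep p s o = DEState.atY 0 ∨ (M.deStep p s o).next ≠ .expY := by
        rw [(hs.1 h).2]
        exact M.deStep_atY_of_neg _ _ h0
      exact iff_of_false (hneg hmem hor) (by linarith)
  · exact iff_of_false (hneg (M.deStep_mem hp s hs o) (M.deStep_of_ne s h o)) fun hc => h hc.1

lemma deState_mem (hp : p.Positive) (ω : Sample 𝒳 𝒴) (n : ℕ) :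
    M.deState p ω n ∈ DEState.Reachable p := by
  rw [deState_eq_run]
  exact run_mem (M.deStep_mem hp) (DEState.atY_mem le_rfl) _ _

/-- The algorithm is a policy: its choices and its stopping are based on what it has seen. -/
theorem isAdmissible_de2e (hp : p.Positive) {A : ℝ} (hA : 0 < A) :
    (M.de2e A p).IsAdmissible := by
  refine ⟨fun n => DEState.measurable_next.comp (M.measurable_deState_info_sup A n), fun n => ?_⟩
  have hset : {ω | (M.de2e A p).stopTime ω ≤ (n : ℕ∞)} = ⋃ j ∈ Finset.range n,
      {ω | (M.deState p ω j).next = .expY ∧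
        A < (M.deState p ω j).D + M.recordLLR ((M.de2e A p).record (j + 1) ω)} := by
    ext ω
    have : (M.de2e A p).stopTime ω = firstPassage (fun n => (M.deState p ω n).D) A := rfl
    simp only [Set.mem_ofPred_eq, this, firstPassage_le_iff, Set.mem_iUnion, Finset.mem_range,
      exists_prop]
    have key : ∀ j, A < (M.deState p ω (j + 1)).D ↔ (M.deState p ω j).next = .expY ∧
        A < (M.deState p ω j).D + M.recordLLR ((M.de2e A p).record (j + 1) ω) := fun j => by
      rw [recordLLR_record, select_de2e_succ]
      exact M.lt_D_deStep_iff hp hA (M.deState_mem hp ω j) (ω (j + 1))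
    constructor
    · rintro ⟨k, h1, h2, h3⟩
      obtain ⟨j, rfl⟩ : ∃ j, k = j + 1 := ⟨k - 1, by omega⟩
      exact ⟨j, by omega, (key j).1 h3⟩
    · rintro ⟨j, h1, h2⟩
      exact ⟨j + 1, by omega, by omega, (key j).2 h2⟩
  rw [hset]
  refine Finset.measurableSet_biUnion _ fun j hj => ?_
  rw [Finset.mem_range] at hj
  have hs := (M.measurable_deState_info_succ (p := p) A j).mono
    ((M.de2e A p).info_mono (show j + 1 ≤ n by omega)) le_rfl
  have hr := (M.de2e A p).measurable_record (k := j + 1) (n := n) (by omega) (by omega)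
  exact ((DEState.measurable_next.comp hs) (measurableSet_singleton _)).inter
    (measurableSet_lt measurable_const
      ((DEState.measurable_D.comp hs).add (M.measurable_recordLLR.comp hr)))

end Model

/-! ### The worst-case delay of the algorithm. -/

lemma essSup_condLExp_le {Ω : Type*} {m m₀ : MeasurableSpace Ω} (hm : m ≤ m₀)
    (P : Measure[m₀] Ω) [IsProbabilityMeasure P] {f : Ω → ℝ≥0∞} {c : ℝ≥0∞}
    (h : ∀ B, MeasurableSet[m] B → ∫⁻ ω in B, f ω ∂P ≤ c * P B) :
    essSup (condLExp m P f) P ≤ c := by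
  refine essSup_le_of_ae_le c (ae_le_of_ae_le_trim (hm := hm) ?_)
  refine ae_le_of_forall_setLIntegral_le_of_sigmaFinite (measurable_condLExp m P f)
    fun B hB _ => ?_
  rw [setLIntegral_condLExp_trim hm P f hB]
  refine (h B hB).trans (le_of_eq ?_)
  rw [setLIntegral_const, trim_measurableSet_eq hm hB]

namespace Model

variable {𝒳 𝒴 : Type*} [MeasurableSpace 𝒳] [MeasurableSpace 𝒴] (M : Model 𝒳 𝒴)
  {p : DEParams}

lemma setLIntegral_le_WADD_mul (Ψ : Policy 𝒳 𝒴) {n : ℕ} (hm : Ψ.info n ≤ MeasurableSpace.pi)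
    {B : Set (Sample 𝒳 𝒴)} (hB : MeasurableSet[Ψ.info n] B) :
    ∫⁻ ω in B, (((Ψ.stopTime ω : ℕ∞) : ℝ≥0∞) + 1 - ((n + 1 : ℕ) : ℝ≥0∞))
      ∂M.P ((n + 1 : ℕ) : ℕ∞) ≤ M.WADD Ψ * M.P ((n + 1 : ℕ) : ℕ∞) B := by
  rw [← setLIntegral_condLExp (hm := hm) (M.P ((n + 1 : ℕ) : ℕ∞)) _ hB, ← setLIntegral_const]
  refine lintegral_mono_ae (ae_restrict_of_ae ?_)
  have hle : essSup (condLExp (Ψ.info n) (M.P ((n + 1 : ℕ) : ℕ∞)) fun ω =>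
      ((Ψ.stopTime ω : ℕ∞) : ℝ≥0∞) + 1 - ((n + 1 : ℕ) : ℝ≥0∞)) (M.P ((n + 1 : ℕ) : ℕ∞)) ≤
      M.WADD Ψ :=
    le_iSup₂_of_le (f := fun (ν : ℕ) (_ : 1 ≤ ν) =>
      essSup (condLExp (Ψ.info (ν - 1)) (M.P (ν : ℕ∞))
        fun ω => ((Ψ.stopTime ω : ℕ∞) : ℝ≥0∞) + 1 - (ν : ℝ≥0∞)) (M.P (ν : ℕ∞)))
      (n + 1) (by omega) le_rfl
  exact (ENNReal.ae_le_essSup _).mono fun ω h => h.trans hle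

lemma meanStop₁_le_WADD (Ψ : Policy 𝒳 𝒴) : M.meanStop₁ Ψ ≤ M.WADD Ψ := by
  have h := M.setLIntegral_le_WADD_mul Ψ (n := 0) (Ψ.info_zero ▸ bot_le)
    (B := Set.univ) (@MeasurableSet.univ _ (Ψ.info 0))
  simp only [Nat.reduceAdd, Nat.cast_one, ENNReal.addLECancellable_iff_ne, ne_eq,
    ENNReal.one_ne_top, not_false_eq_true, AddLECancellable.add_tsub_cancel_right,
    Measure.restrict_univ, measure_univ, mul_one] at h
  exact h

lemma stopTime_le_add (A : ℝ) (n : ℕ) (ω : Sample 𝒳 𝒴) :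
    (M.de2e A p).stopTime ω ≤ n + firstPassage (fun k => (run (M.deStep p) (M.deState p ω n)
      (fun k => ω (n + (k + 1))) k).D) A := by
  have hτ : (M.de2e A p).stopTime ω = firstPassage (fun n => (M.deState p ω n).D) A := rfl
  set T := firstPassage (fun k => (run (M.deStep p) (M.deState p ω n)
      (fun k => ω (n + (k + 1))) k).D) A with hT
  rcases eq_or_ne T ⊤ with h | h
  · simp [h]
  obtain ⟨t, ht⟩ := ENat.ne_top_iff_exists.1 h
  obtain ⟨k, h1, h2, h3⟩ := firstPassage_le_iff.1 (hT ▸ ht.ge)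
  have hk : M.deState p ω (n + k) = run (M.deStep p) (M.deState p ω n)
      (fun k => ω (n + (k + 1))) k := by
    rw [deState_eq_run, run_add, ← deState_eq_run]
    rfl
  rw [← ht, hτ, ← Nat.cast_add, firstPassage_le_iff]
  exact ⟨n + k, by omega, by omega, by rwa [hk]⟩

lemma stopTime_le_of_mem_stopSet {A : ℝ} {n : ℕ} (hn : 1 ≤ n) {ω : Sample 𝒳 𝒴}
    (h : M.deState p ω n ∈ stopSet A) : (M.de2e A p).stopTime ω ≤ n :=
  firstPassage_le_iff.2 ⟨n, hn, le_rfl, h⟩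

lemma overrun_le {A : ℝ} {n : ℕ} (hn : 1 ≤ n) (ω : Sample 𝒳 𝒴) :
    (((M.de2e A p).stopTime ω : ℕ∞) : ℝ≥0∞) + 1 - ((n + 1 : ℕ) : ℝ≥0∞) ≤
      (stopSet A)ᶜ.indicator (fun s => ((firstPassage (fun k => (run (M.deStep p) s
        (fun k => ω (n + (k + 1))) k).D) A : ℕ∞) : ℝ≥0∞)) (M.deState p ω n) := by
  rw [Nat.cast_add, Nat.cast_one, tsub_le_iff_right, ← add_assoc]
  refine add_le_add ?_ le_rfl
  by_cases h : M.deState p ω n ∈ stopSet A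
  · rw [Set.indicator_of_notMem (by simpa using h), zero_add]
    simpa using ENat.toENNReal_le.2 (M.stopTime_le_of_mem_stopSet hn h)
  · rw [Set.indicator_of_mem h, add_comm]
    simpa using ENat.toENNReal_le.2 (M.stopTime_le_add A n ω)

lemma measurable_stopTime_de2e (A : ℝ) :
    Measurable fun ω => (((M.de2e A p).stopTime ω : ℕ∞) : ℝ≥0∞) := by
  have h := measurable_toENNReal_firstPassage_run_left (M.measurable_deStep p)
    DEState.measurable_D A (DEState.atY 0)
  have h2 : Measurable fun (ω : Sample 𝒳 𝒴) k => ω (k + 1) :=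
    measurable_pi_iff.2 fun k => measurable_pi_apply (k + 1)
  have heq : (fun ω => (((M.de2e A p).stopTime ω : ℕ∞) : ℝ≥0∞)) =
      (fun ω => ((firstPassage (fun n => (run (M.deStep p) (DEState.atY 0) ω n).D) A : ℕ∞) :
        ℝ≥0∞)) ∘ fun (ω : Sample 𝒳 𝒴) k => ω (k + 1) := by
    funext ω
    simp only [de2e, deState_eq_run, Function.comp]
  rw [heq]
  exact h.comp h2

lemma deState_congr {n : ℕ} {ω ω' : Sample 𝒳 𝒴} (h : ∀ k ≤ n, ω k = ω' k) :
    M.deState p ω n = M.deState p ω' n := by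
  induction n with
  | zero => rfl
  | succ n ih => rw [deState, deState, ih fun k hk => h k (by omega), h _ le_rfl]

/-- The integral is split into the past before `n`, the observation of time `n`, the seeds of time
`n` and the future. The event `B` ignores the last two, so for fixed past and observation the seeds
may be averaged before the remaining delay is bounded. -/
lemma setLIntegral_overrun_le (hp : p.Positive) {A : ℝ} (hA : 0 < A) {n : ℕ} (hn : 1 ≤ n)
    {B : Set (Sample 𝒳 𝒴)} (hB : MeasurableSet[(M.de2e A p).info n] B) :
    ∫⁻ ω in B, ((((M.de2e A p).stopTime ω : ℕ∞) : ℝ≥0∞) + 1 - ((n + 1 : ℕ) : ℝ≥0∞))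
      ∂M.P ((n + 1 : ℕ) : ℕ∞) ≤
      (M.delay p A (DEState.atY 0) + p.maxExcursion) * M.P ((n + 1 : ℕ) : ℕ∞) B := by
  set c := M.delay p A (DEState.atY 0) + p.maxExcursion with hc
  have hadm := M.isAdmissible_de2e hp hA
  have hB' := hadm.info_le n _ hB
  set f : Sample 𝒳 𝒴 → ℝ≥0∞ := fun ω =>
    (((M.de2e A p).stopTime ω : ℕ∞) : ℝ≥0∞) + 1 - ((n + 1 : ℕ) : ℝ≥0∞) with hf
  have hfm : Measurable f := ((M.measurable_stopTime_de2e A).add_const 1).sub_const _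
  -- The seeds `(0, 0)` and the tail `ω` are placeholders: membership in `B` does not depend on
  -- them.
  let b : Sample 𝒳 𝒴 → (𝒳 × 𝒴) → ℝ≥0∞ := fun ω ob =>
    B.indicator 1 (glue n ω (cons (ob, ((0, 0) : Seed)) ω))
  have hb1 : ∀ ω ob, b ω ob ≠ ∞ := fun ω ob =>
    ((Set.indicator_le_self B (fun _ => (1 : ℝ≥0∞)) _).trans_lt ENNReal.one_lt_top).ne
  have hbm2 : Measurable fun q : Sample 𝒳 𝒴 × (𝒳 × 𝒴) => b q.1 q.2 :=
    (measurable_one.indicator hB').comp ((measurable_glue n).comp (measurable_fst.prodMk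
      (measurable_cons.comp ((measurable_snd.prodMk measurable_const).prodMk measurable_fst))))
  have hbm : ∀ ω, Measurable (b ω) := fun ω => hbm2.of_uncurry_left (x := ω) (f := b)
  have hmem : ∀ ω o ω', B.indicator (1 : Sample 𝒳 𝒴 → ℝ≥0∞) (glue n ω (cons o ω')) = b ω o.1 := by
    intro ω o ω'
    have : glue n ω (cons o ω') ∈ B ↔ glue n ω (cons (o.1, ((0, 0) : Seed)) ω) ∈ B := by
      refine hadm.mem_info_iff hB (fun k hk => by rw [glue_lt hk, glue_lt hk]) ?_
      rw [glue_self, glue_self]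
      rfl
    simp only [b]
    by_cases h : glue n ω (cons o ω') ∈ B
    · rw [Set.indicator_of_mem h, Set.indicator_of_mem (this.1 h)]
      rfl
    · rw [Set.indicator_of_notMem h, Set.indicator_of_notMem (mt this.2 h)]
  have hcoord : M.coord ((n + 1 : ℕ) : ℕ∞) n = M.coord₀ := M.coord_of_lt _ _ n.lt_succ_self
  have hfut : (fun k => M.coord ((n + 1 : ℕ) : ℕ∞) (n + (k + 1))) = fun _ => M.coord₁ :=
    funext fun k => M.coord_of_le _ _ (by omega)
  have hPB : M.P ((n + 1 : ℕ) : ℕ∞) B =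
      ∫⁻ ω, (∫⁻ ob, b ω ob ∂M.joint₀) ∂M.P ((n + 1 : ℕ) : ℕ∞) := by
    rw [← lintegral_indicator_one hB']
    conv_lhs => rw [P_eq]
    rw [lintegral_glue_cons _ n (measurable_one.indicator hB'), hcoord, hfut, ← P_eq]
    refine lintegral_congr fun ω => ?_
    simp only [hmem, lintegral_const, measure_univ, mul_one]
    exact (measurePreserving_fst (μ := M.joint₀) (ν := (volume : Measure Seed))).lintegral_comp
      (hbm ω)
  rw [← lintegral_indicator hB']
  conv_lhs => rw [P_eq]
  rw [lintegral_glue_cons _ n (hfm.indicator hB'), hcoord, hfut, ← P_eq, hPB,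
    ← lintegral_const_mul _ hbm2.lintegral_prod_right']
  refine lintegral_mono fun ω => ?_
  rw [← lintegral_const_mul _ (hbm ω), coord₀]
  refine (lintegral_prod_le_lintegral_lintegral _ _ _).trans (lintegral_mono fun ob => ?_)
  set s := M.deState p ω (n - 1) with hs
  have hstate : ∀ o ω', M.deState p (glue n ω (cons o ω')) n = M.deStep p s o := by
    intro o ω'
    obtain ⟨m, rfl⟩ : ∃ m, n = m + 1 := ⟨n - 1, by omega⟩
    rw [deState, glue_self, hs]
    congr 1
    exact M.deState_congr fun k hk => glue_lt (by omega) _ _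
  have hfutω : ∀ o ω', (fun k => glue n ω (cons o ω') (n + (k + 1))) = ω' := fun o ω' =>
    funext fun k => glue_add n (k + 1) ω _
  calc ∫⁻ u : Seed, (∫⁻ ω', B.indicator f (glue n ω (cons (ob, u) ω'))
        ∂Measure.infinitePi fun _ => M.coord₁)
      ≤ ∫⁻ u : Seed, b ω ob * (stopSet A)ᶜ.indicator (M.delay p A) (M.deStep p s (ob, u)) := by
        refine lintegral_mono fun u => ?_
        calc _ ≤ ∫⁻ ω', b ω ob * (stopSet A)ᶜ.indicator (fun s => ((firstPassage
                (fun k => (run (M.deStep p) s ω' k).D) A : ℕ∞) : ℝ≥0∞)) (M.deStep p s (ob, u))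
                ∂Measure.infinitePi fun _ => M.coord₁ := by
              refine lintegral_mono fun ω' => ?_
              have h1 : B.indicator f (glue n ω (cons (ob, u) ω')) =
                  b ω ob * f (glue n ω (cons (ob, u) ω')) := by
                rw [← hmem ω (ob, u) ω']
                by_cases h : glue n ω (cons (ob, u) ω') ∈ B <;> simp [h]
              have h2 := M.overrun_le (p := p) (A := A) hn (glue n ω (cons (ob, u) ω'))
              rw [hstate, hfutω] at h2
              rw [h1]
              exact mul_le_mul_right h2 _
          _ = _ := by
              rw [lintegral_const_mul' _ _ (hb1 ω ob)]
              congr 1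
              by_cases h : M.deStep p s (ob, u) ∈ stopSet A
              · simp [h]
              · simp only [Set.indicator_of_mem (show _ ∈ (stopSet A)ᶜ from h)]
                exact lintegral_firstPassage_run M.coord₁ (M.measurable_deStep p)
                  DEState.measurable_D A _
    _ ≤ b ω ob * c := by
        rw [lintegral_const_mul' _ _ (hb1 ω ob)]
        exact mul_le_mul_right (M.lintegral_seed_delay_le_of_reachable hp hA.le
          (M.deState_mem hp ω (n - 1)) ob) _
    _ = _ := mul_comm _ _

/-- The worst-case delay is attained, up to the mean length of an excursion, by a change at the
first observation. -/
theorem WADD_de2e_le (hp : p.Positive) {A : ℝ} (hA : 0 < A) :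
    M.WADD (M.de2e A p) ≤ M.meanStop₁ (M.de2e A p) + p.maxExcursion := by
  have hadm := M.isAdmissible_de2e hp hA
  rw [meanStop₁_de2e]
  refine iSup₂_le fun ν hν => ?_
  obtain ⟨n, rfl⟩ : ∃ n, ν = n + 1 := ⟨ν - 1, by omega⟩
  refine essSup_condLExp_le (hadm.info_le n) _ fun B hB => ?_
  rcases Nat.eq_zero_or_pos n with rfl | hn
  · replace hB : MeasurableSet[(M.de2e A p).info 0] B := hB
    rw [Policy.info_zero, MeasurableSpace.measurableSet_bot_iff] at hB
    rcases hB with rfl | rfl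
    · simp
    · have : ∫⁻ ω, (((M.de2e A p).stopTime ω : ℕ∞) : ℝ≥0∞) ∂M.P 1 =
          meanHit (M.deStep p) M.coord₁ (stopSet A) (DEState.atY 0) := M.meanStop₁_de2e A
      simp [this]
  · exact M.setLIntegral_overrun_le hp hA hn hB

lemma cusumY_eq_run (ω : Sample 𝒳 𝒴) (n : ℕ) :
    M.cusumY ω n = run M.cusumStep 0 (fun k => ω (k + 1)) n := by
  induction n with
  | zero => rfl
  | succ n ih => rw [cusumY, ih]; rfl

lemma cusumDelay_le_WADD (A : ℝ) : M.cusumDelay A 0 ≤ M.WADD (M.cusumPolicy A) := by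
  refine le_trans (le_of_eq ?_) (M.meanStop₁_le_WADD _)
  have h := M.lintegral_shift 1 (measurable_toENNReal_firstPassage_run_left M.measurable_cusumStep
    measurable_id A 0)
  have hc : (fun k => M.coord 1 (k + 1)) = fun _ => M.coord₁ :=
    funext fun k => M.coord_of_le 1 (k + 1) (by omega)
  rw [hc, lintegral_firstPassage_run _ M.measurable_cusumStep measurable_id] at h
  rw [meanStop₁]
  refine Eq.trans h.symm (lintegral_congr fun ω => ?_)
  simp only [cusumPolicy, id]
  congr 2
  funext n
  exact (M.cusumY_eq_run ω n).symm

end Model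

/-! ### Change of measure on the information of a policy. -/

/-- Two measures that agree on the intersections `B ∩ g ⁻¹' C` agree on the σ-algebra that they
generate. -/
lemma measure_eq_of_forall_inter {Ω E : Type*} {m₁ m₀ : MeasurableSpace Ω} [MeasurableSpace E]
    (h₁ : m₁ ≤ m₀) {g : Ω → E} (hg : Measurable[m₀] g) {μ ν : Measure[m₀] Ω} [IsFiniteMeasure ν]
    (h : ∀ B, MeasurableSet[m₁] B → ∀ C : Set E, MeasurableSet C →
      μ (B ∩ g ⁻¹' C) = ν (B ∩ g ⁻¹' C))
    {B : Set Ω} (hB : MeasurableSet[m₁ ⊔ MeasurableSpace.comap g inferInstance] B) :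
    μ B = ν B := by
  have huniv : μ Set.univ = ν Set.univ := by
    simpa using h Set.univ (@MeasurableSet.univ _ m₁) Set.univ MeasurableSet.univ
  have : IsFiniteMeasure μ := ⟨huniv ▸ measure_lt_top ν _⟩
  set S : Set (Set Ω) := {D | ∃ B, MeasurableSet[m₁] B ∧ ∃ C : Set E, MeasurableSet C ∧
    D = B ∩ g ⁻¹' C} with hS
  have hle : m₁ ⊔ MeasurableSpace.comap g inferInstance ≤ m₀ := sup_le h₁ hg.comap_le
  have hgen : m₁ ⊔ MeasurableSpace.comap g inferInstance = MeasurableSpace.generateFrom S := by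
    refine le_antisymm (sup_le ?_ ?_) (MeasurableSpace.generateFrom_le ?_)
    · exact fun B hB => MeasurableSpace.measurableSet_generateFrom
        ⟨B, hB, Set.univ, MeasurableSet.univ, by simp⟩
    · rintro _ ⟨C, hC, rfl⟩
      exact MeasurableSpace.measurableSet_generateFrom
        ⟨Set.univ, @MeasurableSet.univ _ m₁, C, hC, by simp⟩
    · rintro _ ⟨B, hB, C, hC, rfl⟩
      exact MeasurableSet.inter (le_sup_left (b := MeasurableSpace.comap g inferInstance) _ hB)
        (le_sup_right (a := m₁) _ ⟨C, hC, rfl⟩)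
  have hpi : IsPiSystem S := by
    rintro _ ⟨B, hB, C, hC, rfl⟩ _ ⟨B', hB', C', hC', rfl⟩ -
    refine ⟨B ∩ B', @MeasurableSet.inter _ m₁ _ _ hB hB', C ∩ C', hC.inter hC', ?_⟩
    rw [Set.preimage_inter, Set.inter_inter_inter_comm]
  refine MeasurableSpace.induction_on_inter (C := fun B _ => μ B = ν B) hgen hpi (by simp) ?_ ?_ ?_
    B hB
  · rintro _ ⟨B, hB, C, hC, rfl⟩
    exact h B hB C hC
  · intro t ht hμ
    rw [measure_compl (hle _ ht) (measure_ne_top μ t), measure_compl (hle _ ht)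
      (measure_ne_top ν t), hμ, huniv]
  · intro f hd hf hμ
    rw [measure_iUnion hd fun i => hle _ (hf i), measure_iUnion hd fun i => hle _ (hf i)]
    exact tsum_congr hμ

section Past

variable {𝒳 𝒴 : Type*} [MeasurableSpace 𝒳] [MeasurableSpace 𝒴]

lemma measurable_past_dependsOn {β : Type*} [MeasurableSpace β] [MeasurableSingletonClass β]
    {n : ℕ} {f : Sample 𝒳 𝒴 → β} (hf : Measurable[past 𝒳 𝒴 n] f) :
    DependsOn f (Set.Iio n) := by
  intro ω ω' h
  have := hf (measurableSet_singleton (f ω))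
  exact ((mem_iff_of_measurableSet_iSup this (ω := ω) (ω' := ω') fun k hk =>
    h k (Finset.mem_range.1 hk)).1 rfl).symm

/-- The coordinate `n` is independent of the past. -/
lemma lintegral_past_mul_eval (μ : ℕ → Measure ((𝒳 × 𝒴) × Seed)) [∀ k, IsProbabilityMeasure (μ k)]
    (n : ℕ) {f : Sample 𝒳 𝒴 → ℝ≥0∞} (hf : Measurable[past 𝒳 𝒴 n] f)
    {g : (𝒳 × 𝒴) × Seed → ℝ≥0∞} (hg : Measurable g) :
    ∫⁻ ω, f ω * g (ω n) ∂Measure.infinitePi μ =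
      (∫⁻ ω, f ω ∂Measure.infinitePi μ) * ∫⁻ o, g o ∂μ n :=
  lintegral_mul_eval μ n (hf.mono (past_le 𝒳 𝒴 n) le_rfl) (measurable_past_dependsOn hf) hg

lemma map_eval_restrict_past (μ : ℕ → Measure ((𝒳 × 𝒴) × Seed)) [∀ k, IsProbabilityMeasure (μ k)]
    (n : ℕ) {D : Set (Sample 𝒳 𝒴)} (hD : MeasurableSet[past 𝒳 𝒴 n] D) :
    ((Measure.infinitePi μ).restrict D).map (fun ω => ω n) = Measure.infinitePi μ D • μ n := by
  have hD' := past_le 𝒳 𝒴 n _ hD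
  ext s hs
  rw [Measure.map_apply (measurable_pi_apply n) hs,
    Measure.restrict_apply (measurable_pi_apply n hs), Measure.smul_apply, smul_eq_mul]
  have h := lintegral_past_mul_eval μ n (f := D.indicator 1) (g := s.indicator 1)
    (Measurable.indicator (m := past 𝒳 𝒴 n) (f := fun _ => 1) measurable_const hD)
    (measurable_one.indicator hs)
  rw [lintegral_indicator_one hD', lintegral_indicator_one hs] at h
  rw [← h, ← lintegral_indicator_one ((measurable_pi_apply n hs).inter hD')]
  refine lintegral_congr fun ω => ?_
  by_cases h1 : ω ∈ D <;> by_cases h2 : ω n ∈ s <;> simp [h1, h2]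

lemma setIntegral_eval_past (μ : ℕ → Measure ((𝒳 × 𝒴) × Seed)) [∀ k, IsProbabilityMeasure (μ k)]
    (n : ℕ) {D : Set (Sample 𝒳 𝒴)} (hD : MeasurableSet[past 𝒳 𝒴 n] D)
    {g : (𝒳 × 𝒴) × Seed → ℝ} (hg : Measurable g) :
    ∫ ω in D, g (ω n) ∂Measure.infinitePi μ =
      (Measure.infinitePi μ D).toReal * ∫ o, g o ∂μ n := by
  rw [← smul_eq_mul, ← integral_smul_measure, ← map_eval_restrict_past μ n hD,
    integral_map (measurable_pi_apply n).aemeasurable hg.aestronglyMeasurable]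

/-- The measures of a past event under two product measures with the same initial factors. -/
lemma infinitePi_eq_of_past {μ μ' : ℕ → Measure ((𝒳 × 𝒴) × Seed)}
    [∀ k, IsProbabilityMeasure (μ k)] [∀ k, IsProbabilityMeasure (μ' k)] {n : ℕ}
    (h : ∀ k < n, μ k = μ' k) {B : Set (Sample 𝒳 𝒴)} (hB : MeasurableSet[past 𝒳 𝒴 n] B) :
    Measure.infinitePi μ B = Measure.infinitePi μ' B := by
  induction n generalizing B with
  | zero =>
    have hbot : past 𝒳 𝒴 0 = ⊥ := by simp [past]
    rw [hbot, MeasurableSpace.measurableSet_bot_iff] at hB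
    rcases hB with rfl | rfl <;> simp
  | succ n ih =>
    have hsup : past 𝒳 𝒴 (n + 1) ≤ past 𝒳 𝒴 n ⊔
        MeasurableSpace.comap (fun ω : Sample 𝒳 𝒴 => ω n) inferInstance := by
      refine iSup₂_le fun k hk => ?_
      rw [Finset.mem_range, Nat.lt_succ_iff_lt_or_eq] at hk
      rcases hk with hk | rfl
      · exact (measurable_past_eval hk).comap_le.trans le_sup_left
      · exact le_sup_right
    refine measure_eq_of_forall_inter (past_le 𝒳 𝒴 n) (measurable_pi_apply n)
      (fun D hD C hC => ?_) (hsup _ hB)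
    have key : ∀ (κ : ℕ → Measure ((𝒳 × 𝒴) × Seed)) [∀ k, IsProbabilityMeasure (κ k)],
        Measure.infinitePi κ (D ∩ (fun ω => ω n) ⁻¹' C) = Measure.infinitePi κ D * κ n C := by
      intro κ _
      have := congrArg (fun m => m C) (map_eval_restrict_past κ n hD)
      simp only [Measure.smul_apply, smul_eq_mul] at this
      rw [← this, Measure.map_apply (measurable_pi_apply n) hC,
        Measure.restrict_apply (measurable_pi_apply n hC), Set.inter_comm]
    rw [key μ, key μ', ih (fun k hk => h k (by omega)) hD, h n (by omega)]

end Past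

namespace Model

variable {𝒳 𝒴 : Type*} [MeasurableSpace 𝒳] [MeasurableSpace 𝒴] (M : Model 𝒳 𝒴)

/-- The record that the choice `c` produces. -/
def recordOf (c : Choice) (o : 𝒳 × 𝒴) : 𝒳 ⊕ 𝒴 ⊕ Unit :=
  match c with
  | .expX => Sum.inl o.1
  | .expY => Sum.inr (Sum.inl o.2)
  | .idle => Sum.inr (Sum.inr ())

lemma measurable_recordOf (c : Choice) :
    Measurable (recordOf c : 𝒳 × 𝒴 → 𝒳 ⊕ 𝒴 ⊕ Unit) := by
  cases c
  · exact measurable_inr.comp (measurable_inl.comp measurable_snd)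
  · exact measurable_inl.comp measurable_fst
  · exact measurable_const

omit [MeasurableSpace 𝒳] [MeasurableSpace 𝒴] in
lemma record_eq (Ψ : Policy 𝒳 𝒴) (k : ℕ) (ω : Sample 𝒳 𝒴) :
    Ψ.record k ω = recordOf (Ψ.select k ω) (ω k).1 := rfl

lemma measurable_obsLLR_right (c : Choice) : Measurable (M.obsLLR c) :=
  M.measurable_obsLLR.of_uncurry_left (x := c) (f := M.obsLLR)

variable (hX : M.X.FiniteLLR) (hY : M.Y.FiniteLLR)
include hX hY

/-- A record shows at most one of the two observations, so only a marginal density ratio enters and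
the joint laws are irrelevant. An idle step carries no information and has ratio `1`. -/
lemma lintegral_joint_change (c : Choice) {h : 𝒳 ⊕ 𝒴 ⊕ Unit → ℝ≥0∞} (hh : Measurable h) :
    ∫⁻ o, ENNReal.ofReal (Real.exp (-M.obsLLR c o)) * h (recordOf c o) ∂M.joint₁ =
      ∫⁻ o, h (recordOf c o) ∂M.joint₀ := by
  cases c
  · have hm : Measurable fun y : 𝒴 => h (Sum.inr (Sum.inl y)) :=
      hh.comp (measurable_inr.comp measurable_inl)
    have hexp : Measurable fun y => ENNReal.ofReal (Real.exp (-M.Y.llr y)) :=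
      M.Y.measurable_llr.neg.exp.ennreal_ofReal
    have := Experiment.lintegral_law₁_mul_exp_neg hY hm
    rw [← M.snd_joint₁, ← M.snd_joint₀, lintegral_map hm measurable_snd, lintegral_map
      (hm.fun_mul hexp) measurable_snd] at this
    simpa only [obsLLR, recordOf, mul_comm] using this
  · have hm : Measurable fun x : 𝒳 => h (Sum.inl x) := hh.comp measurable_inl
    have hexp : Measurable fun x => ENNReal.ofReal (Real.exp (-M.X.llr x)) :=
      M.X.measurable_llr.neg.exp.ennreal_ofReal
    have := Experiment.lintegral_law₁_mul_exp_neg hX hm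
    rw [← M.fst_joint₁, ← M.fst_joint₀, lintegral_map hm measurable_fst, lintegral_map
      (hm.fun_mul hexp) measurable_fst] at this
    simpa only [obsLLR, recordOf, mul_comm] using this
  · simp [obsLLR, recordOf]

lemma lintegral_coord_change (c : Choice) {h : (𝒳 ⊕ 𝒴 ⊕ Unit) × Seed → ℝ≥0∞}
    (hh : Measurable h) :
    ∫⁻ o, ENNReal.ofReal (Real.exp (-M.obsLLR c o.1)) * h (recordOf c o.1, o.2) ∂M.coord₁ =
      ∫⁻ o, h (recordOf c o.1, o.2) ∂M.coord₀ := by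
  have hm : Measurable fun o : (𝒳 × 𝒴) × Seed => h (recordOf c o.1, o.2) :=
    hh.comp (((measurable_recordOf c).comp measurable_fst).prodMk measurable_snd)
  have hm' : Measurable fun o : (𝒳 × 𝒴) × Seed =>
      ENNReal.ofReal (Real.exp (-M.obsLLR c o.1)) :=
    ((M.measurable_obsLLR_right c).comp measurable_fst).neg.exp.ennreal_ofReal
  rw [coord₀, coord₁, lintegral_prod_symm' _ hm, lintegral_prod_symm' _ (hm'.fun_mul hm)]
  refine lintegral_congr fun u => ?_
  exact M.lintegral_joint_change hX hY c (h := fun r => h (r, u))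
    (hh.comp (measurable_id.prodMk measurable_const))

end Model

instance : Fintype Choice := ⟨{.expY, .expX, .idle}, fun c => by cases c <;> simp⟩

lemma measure_eq_of_forall_choice {Ω : Type*} [MeasurableSpace Ω] {μ ν : Measure Ω}
    {sel : Ω → Choice} (hsel : Measurable sel) {E : Set Ω} (hE : MeasurableSet E)
    (h : ∀ c, μ (E ∩ sel ⁻¹' {c}) = ν (E ∩ sel ⁻¹' {c})) : μ E = ν E := by
  have hU : E = ⋃ c, E ∩ sel ⁻¹' {c} := by ext; simp
  have hd : Pairwise (Function.onFun Disjoint fun c => E ∩ sel ⁻¹' {c}) := fun c c' hc =>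
    Set.disjoint_left.2 fun ω h1 h2 => hc (h1.2.symm.trans h2.2)
  have hm : ∀ c, MeasurableSet (E ∩ sel ⁻¹' {c}) := fun c =>
    hE.inter (hsel (measurableSet_singleton c))
  rw [hU, measure_iUnion hd hm, measure_iUnion hd hm]
  exact tsum_congr h

namespace Model

variable {𝒳 𝒴 : Type*} [MeasurableSpace 𝒳] [MeasurableSpace 𝒴] (M : Model 𝒳 𝒴)
  (Ψ : Policy 𝒳 𝒴)

/-- The log-likelihood ratio of what the policy observes at time `k`. -/
def increment (k : ℕ) (ω : Sample 𝒳 𝒴) : ℝ := M.obsLLR (Ψ.select k ω) (ω k).1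

/-- The log-likelihood ratio of the observations at the times `n + 1, …, n + m`. -/
def logLR (n m : ℕ) (ω : Sample 𝒳 𝒴) : ℝ :=
  ∑ i ∈ Finset.range m, M.increment Ψ (n + 1 + i) ω

variable {Ψ} (hΨ : Ψ.IsAdmissible)
include hΨ

lemma measurable_increment (k : ℕ) : Measurable[past 𝒳 𝒴 (k + 1 + 1)] (M.increment Ψ (k + 1)) :=
  M.measurable_obsLLR.comp (((hΨ.measurable_select k).mono (past_mono (by omega)) le_rfl).prodMk
    (measurable_fst.comp (measurable_past_eval (Nat.lt_succ_self _))))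

lemma measurable_logLR (n m : ℕ) : Measurable[past 𝒳 𝒴 (n + m + 1)] (M.logLR Ψ n m) := by
  refine Finset.measurable_fun_sum _ fun i hi => ?_
  rw [Finset.mem_range] at hi
  have := M.measurable_increment hΨ (n + i)
  rw [show n + i + 1 = n + 1 + i by omega] at this
  exact this.mono (past_mono (by omega)) le_rfl

variable (hX : M.X.FiniteLLR) (hY : M.Y.FiniteLLR)
include hX hY

/-- Change of measure: on what the policy has seen, the law without a change has the density
`exp (-Λ)` with respect to the law with a change. -/
lemma setLIntegral_exp_neg_logLR (n m : ℕ) {B : Set (Sample 𝒳 𝒴)}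
    (hB : MeasurableSet[Ψ.info (n + m) ⊔ seedInfo 𝒳 𝒴 (n + m)] B) :
    ∫⁻ ω in B, ENNReal.ofReal (Real.exp (-M.logLR Ψ n m ω)) ∂M.P ((n + 1 : ℕ) : ℕ∞) =
      M.P ⊤ B := by
  induction m generalizing B with
  | zero =>
    simp only [logLR, Finset.range_zero, Finset.sum_empty, neg_zero, Real.exp_zero,
      ENNReal.ofReal_one, setLIntegral_const, one_mul]
    rw [P_eq, P_eq]
    -- The information of time `n` uses only the coordinates `0, …, n`, which have pre-change laws
    -- under both measures.
    refine infinitePi_eq_of_past (n := n + 1) (fun k hk => ?_) (hΨ.info_sup_le_past n _ hB)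
    rw [M.coord_of_lt _ _ hk, coord_top]
  | succ m ih =>
    set k := n + m + 1 with hk
    set ν : ℕ∞ := ((n + 1 : ℕ) : ℕ∞) with hν
    have hH := hΨ.info_sup_le_past (n + m)
    have hexp : Measurable fun ω => ENNReal.ofReal (Real.exp (-M.logLR Ψ n (m + 1) ω)) :=
      (((M.measurable_logLR hΨ n (m + 1)).mono (past_le 𝒳 𝒴 _) le_rfl).neg.exp).ennreal_ofReal
    have hexp' : Measurable[past 𝒳 𝒴 k] fun ω => ENNReal.ofReal (Real.exp (-M.logLR Ψ n m ω)) :=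
      (((M.measurable_logLR hΨ n m)).neg.exp).ennreal_ofReal
    have hsel : Measurable[Ψ.info (n + m) ⊔ seedInfo 𝒳 𝒴 (n + m)] (Ψ.select k) := hΨ.1 (n + m)
    have hsel0 : Measurable (Ψ.select k) := hsel.mono (hH.trans (past_le 𝒳 𝒴 _)) le_rfl
    have hg : Measurable fun ω : Sample 𝒳 𝒴 => (Ψ.record k ω, (ω k).2) :=
      (((Ψ.measurable_record (by omega) le_rfl).mono (hΨ.info_le k) le_rfl)).prodMk
        (measurable_snd.comp (measurable_pi_apply k))
    have hsup : Ψ.info (n + (m + 1)) ⊔ seedInfo 𝒳 𝒴 (n + (m + 1)) ≤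
        (Ψ.info (n + m) ⊔ seedInfo 𝒳 𝒴 (n + m)) ⊔
          MeasurableSpace.comap (fun ω : Sample 𝒳 𝒴 => (Ψ.record k ω, (ω k).2)) inferInstance := by
      have hpair : Measurable[MeasurableSpace.comap
          (fun ω : Sample 𝒳 𝒴 => (Ψ.record k ω, (ω k).2)) inferInstance]
          fun ω : Sample 𝒳 𝒴 => (Ψ.record k ω, (ω k).2) := comap_measurable _
      rw [show n + (m + 1) = n + m + 1 by omega, Ψ.info_succ]
      refine sup_le (sup_le (le_sup_left.trans le_sup_left) ?_) (iSup₂_le fun j hj => ?_)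
      · exact (measurable_fst.comp hpair).comap_le.trans le_sup_right
      · rw [Finset.mem_range, Nat.lt_succ_iff_lt_or_eq] at hj
        rcases hj with hj | rfl
        · exact (measurable_seedInfo_eval (by omega : j ≤ n + m)).comap_le.trans
            (le_sup_right.trans le_sup_left)
        · exact (measurable_snd.comp hpair).comap_le.trans le_sup_right
    have hB0 : MeasurableSet B := by
      refine (hsup.trans (sup_le (hH.trans (past_le 𝒳 𝒴 _)) hg.comap_le)) _ hB
    rw [← withDensity_apply _ hB0]
    -- The new information consists of the record and the seeds of time `k`, so it suffices to test
    -- an old event intersected with an event about this pair.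
    refine measure_eq_of_forall_inter (hH.trans (past_le 𝒳 𝒴 _)) hg (fun D hD C hC => ?_)
      (hsup _ hB)
    have hD0 := (hH.trans (past_le 𝒳 𝒴 _)) _ hD
    have hE0 := hD0.inter (hg hC)
    -- Once the choice at time `k` is fixed, the record is a function of the coordinate `k` alone,
    -- and the integrand is a function of the past times a function of that independent coordinate.
    refine measure_eq_of_forall_choice hsel0 hE0 fun c => ?_
    set Dc := D ∩ Ψ.select k ⁻¹' {c} with hDc
    have hDcH : MeasurableSet[Ψ.info (n + m) ⊔ seedInfo 𝒳 𝒴 (n + m)] Dc :=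
      @MeasurableSet.inter _ (Ψ.info (n + m) ⊔ seedInfo 𝒳 𝒴 (n + m)) _ _ hD
        (hsel (measurableSet_singleton c))
    have hDcp : MeasurableSet[past 𝒳 𝒴 k] Dc := hH _ hDcH
    have hDc0 := past_le 𝒳 𝒴 k _ hDcp
    have hEc0 := hE0.inter (hsel0 (measurableSet_singleton c))
    have hCm : Measurable (C.indicator (1 : (𝒳 ⊕ 𝒴 ⊕ Unit) × Seed → ℝ≥0∞)) :=
      measurable_one.indicator hC
    have hrec : Measurable fun o : (𝒳 × 𝒴) × Seed =>
        C.indicator (1 : (𝒳 ⊕ 𝒴 ⊕ Unit) × Seed → ℝ≥0∞) (recordOf c o.1, o.2) :=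
      hCm.comp (((measurable_recordOf c).comp measurable_fst).prodMk measurable_snd)
    have hlr : Measurable fun o : (𝒳 × 𝒴) × Seed =>
        ENNReal.ofReal (Real.exp (-M.obsLLR c o.1)) :=
      ((M.measurable_obsLLR_right c).comp measurable_fst).neg.exp.ennreal_ofReal
    have hset : D ∩ (fun ω : Sample 𝒳 𝒴 => (Ψ.record k ω, (ω k).2)) ⁻¹' C ∩ Ψ.select k ⁻¹' {c} =
        Dc ∩ (fun ω : Sample 𝒳 𝒴 => (recordOf c (ω k).1, (ω k).2)) ⁻¹' C := by
      ext ω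
      simp only [hDc, Set.mem_inter_iff, Set.mem_preimage, Set.mem_singleton_iff, record_eq]
      constructor
      · rintro ⟨⟨h1, h2⟩, h3⟩
        exact ⟨⟨h1, h3⟩, h3 ▸ h2⟩
      · rintro ⟨⟨h1, h3⟩, h2⟩
        exact ⟨⟨h1, h3 ▸ h2⟩, h3⟩
    have hleft : (M.P ν).withDensity (fun ω => ENNReal.ofReal (Real.exp (-M.logLR Ψ n (m + 1) ω)))
        (D ∩ (fun ω : Sample 𝒳 𝒴 => (Ψ.record k ω, (ω k).2)) ⁻¹' C ∩ Ψ.select k ⁻¹' {c}) =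
        ∫⁻ ω, Dc.indicator (fun ω => ENNReal.ofReal (Real.exp (-M.logLR Ψ n m ω))) ω *
          (fun o : (𝒳 × 𝒴) × Seed => ENNReal.ofReal (Real.exp (-M.obsLLR c o.1)) *
            C.indicator 1 (recordOf c o.1, o.2)) (ω k) ∂M.P ν := by
      rw [withDensity_apply _ hEc0, ← lintegral_indicator hEc0, hset]
      refine lintegral_congr fun ω => ?_
      by_cases h1 : ω ∈ Dc
      · have hsum : M.logLR Ψ n (m + 1) ω = M.logLR Ψ n m ω + M.obsLLR c (ω k).1 := by
          have : Ψ.select k ω = c := h1.2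
          rw [logLR, Finset.sum_range_succ, ← logLR, increment,
            show n + 1 + m = k by omega, this]
        by_cases h2 : (recordOf c (ω k).1, (ω k).2) ∈ C
        · rw [Set.indicator_of_mem (Set.mem_inter h1 h2), Set.indicator_of_mem h1]
          simp only [Set.indicator_of_mem h2, Pi.one_apply, mul_one]
          rw [hsum, ← ENNReal.ofReal_mul (Real.exp_pos _).le, ← Real.exp_add, neg_add]
        · rw [Set.indicator_of_notMem fun h => h2 h.2]
          simp [h2]
      · rw [Set.indicator_of_notMem fun h => h1 h.1]
        simp [h1]
    have hright : M.P ⊤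
        (D ∩ (fun ω : Sample 𝒳 𝒴 => (Ψ.record k ω, (ω k).2)) ⁻¹' C ∩ Ψ.select k ⁻¹' {c}) =
        ∫⁻ ω, Dc.indicator (fun _ => 1) ω *
          (fun o : (𝒳 × 𝒴) × Seed => C.indicator 1 (recordOf c o.1, o.2)) (ω k) ∂M.P ⊤ := by
      rw [← lintegral_indicator_one hEc0, hset]
      refine lintegral_congr fun ω => ?_
      by_cases h1 : ω ∈ Dc <;> by_cases h2 : (recordOf c (ω k).1, (ω k).2) ∈ C <;>
        simp [h1, h2]
    rw [hleft, hright, P_eq, P_eq, lintegral_past_mul_eval _ k (Measurable.indicator hexp' hDcp)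
      (hlr.fun_mul hrec), lintegral_past_mul_eval _ k (Measurable.indicator (m := past 𝒳 𝒴 k)
      measurable_const hDcp) hrec, ← P_eq, ← P_eq, M.coord_of_le (n + 1) k (by omega), coord_top,
      M.lintegral_coord_change hX hY c hCm]
    congr 1
    rw [lintegral_indicator hDc0, ih hDcH, lintegral_indicator hDc0]
    simp

end Model

/-! ### Lower bound on the delay of an arbitrary policy. -/

lemma ofReal_integral_le_lintegral_exp {Ω : Type*} [MeasurableSpace Ω] {μ : Measure Ω}
    {f : Ω → ℝ} (hf : Integrable f μ) (h1 : Integrable (fun _ : Ω => (1 : ℝ)) μ) :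
    ENNReal.ofReal (∫ ω, (1 + f ω) ∂μ) ≤ ∫⁻ ω, ENNReal.ofReal (Real.exp (f ω)) ∂μ := by
  have hi : Integrable (fun ω => max (1 + f ω) 0) μ := (h1.add hf).pos_part
  calc ENNReal.ofReal (∫ ω, (1 + f ω) ∂μ) ≤ ENNReal.ofReal (∫ ω, max (1 + f ω) 0 ∂μ) :=
        ENNReal.ofReal_le_ofReal (integral_mono (h1.add hf) hi fun ω => le_max_left _ _)
    _ = ∫⁻ ω, ENNReal.ofReal (max (1 + f ω) 0) ∂μ :=
        ofReal_integral_eq_lintegral_ofReal hi (Eventually.of_forall fun ω => le_max_right _ _)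
    _ ≤ _ := lintegral_mono fun ω => ENNReal.ofReal_le_ofReal (max_le
        (by rw [add_comm]; exact Real.add_one_le_exp _) (Real.exp_pos _).le)

lemma sum_lt_le_sub (τ : ℕ∞) (n m : ℕ) (h : (n : ℕ∞) < τ) :
    (∑ i ∈ Finset.range m, if ((n + i : ℕ) : ℕ∞) < τ then (1 : ℝ≥0∞) else 0) ≤
      (τ : ℝ≥0∞) + 1 - ((n + 1 : ℕ) : ℝ≥0∞) := by
  have hle : (n : ℝ≥0∞) + ∑ i ∈ Finset.range m,
      (if ((n + i : ℕ) : ℕ∞) < τ then (1 : ℝ≥0∞) else 0) ≤ τ := by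
    rw [toENNReal_eq_tsum τ]
    refine le_trans (le_of_eq ?_) (ENNReal.sum_le_tsum (Finset.range (n + m)))
    rw [Finset.sum_range_add]
    congr 1
    rw [Finset.sum_congr rfl fun i hi => if_pos ((Nat.cast_lt.2 (Finset.mem_range.1 hi)).trans h)]
    simp
  refine ENNReal.le_sub_of_add_le_left (ENNReal.natCast_ne_top _) ?_
  rw [Nat.cast_add, Nat.cast_one, add_right_comm]
  exact add_le_add hle le_rfl

namespace Model

variable {𝒳 𝒴 : Type*} [MeasurableSpace 𝒳] [MeasurableSpace 𝒴] (M : Model 𝒳 𝒴)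
  (Ψ : Policy 𝒳 𝒴)

/-- The log-likelihood ratio of the observations at the times `n + 1, …, n + m`, up to the
declaration. -/
def stoppedLLR (n m : ℕ) (ω : Sample 𝒳 𝒴) : ℝ :=
  ∑ i ∈ Finset.range m, {ω | ((n + i : ℕ) : ℕ∞) < Ψ.stopTime ω}.indicator
    (M.increment Ψ (n + 1 + i)) ω

variable {Ψ} (hΨ : Ψ.IsAdmissible)

include hΨ in
lemma measurableSet_lt_stopTime (n : ℕ) :
    MeasurableSet[Ψ.info n] {ω | (n : ℕ∞) < Ψ.stopTime ω} := by
  have : {ω | (n : ℕ∞) < Ψ.stopTime ω} = {ω | Ψ.stopTime ω ≤ (n : ℕ∞)}ᶜ := by ext; simp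
  rw [this]
  exact @MeasurableSet.compl _ _ (Ψ.info n) (hΨ.2 n)

include hΨ in
lemma measurableSet_lt_stopTime_past (n : ℕ) :
    MeasurableSet[past 𝒳 𝒴 (n + 1)] {ω | (n : ℕ∞) < Ψ.stopTime ω} :=
  (le_sup_left.trans (hΨ.info_sup_le_past n)) _ (measurableSet_lt_stopTime hΨ n)

include hΨ in
lemma measurableSet_lt_stopTime' (n : ℕ) : MeasurableSet {ω | (n : ℕ∞) < Ψ.stopTime ω} :=
  hΨ.info_le n _ (measurableSet_lt_stopTime hΨ n)

lemma stoppedLLR_succ_of_le {n m : ℕ} {ω : Sample 𝒳 𝒴}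
    (h : Ψ.stopTime ω ≤ ((n + m : ℕ) : ℕ∞)) :
    M.stoppedLLR Ψ n (m + 1) ω = M.stoppedLLR Ψ n m ω := by
  rw [stoppedLLR, Finset.sum_range_succ, Set.indicator_of_notMem (by simpa using h), add_zero,
    stoppedLLR]

lemma stoppedLLR_eq_logLR {n m : ℕ} {ω : Sample 𝒳 𝒴}
    (h : ∀ i < m, ((n + i : ℕ) : ℕ∞) < Ψ.stopTime ω) :
    M.stoppedLLR Ψ n m ω = M.logLR Ψ n m ω := by
  simp only [stoppedLLR, logLR]
  refine Finset.sum_congr rfl fun i hi => ?_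
  have hmem : ω ∈ {ω | ((n + i : ℕ) : ℕ∞) < Ψ.stopTime ω} := h i (Finset.mem_range.1 hi)
  rw [Set.indicator_of_mem hmem]

/-- The event that the policy stops at one of the times `n + 1, …, n + m`. -/
def stopBlock (Ψ : Policy 𝒳 𝒴) (n m : ℕ) : Set (Sample 𝒳 𝒴) :=
  {ω | (n : ℕ∞) < Ψ.stopTime ω ∧ Ψ.stopTime ω ≤ ((n + m : ℕ) : ℕ∞)}

omit [MeasurableSpace 𝒳] [MeasurableSpace 𝒴] in
lemma stopBlock_succ (n m : ℕ) : stopBlock Ψ n (m + 1) =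
    stopBlock Ψ n m ∪ {ω | ((n + m : ℕ) : ℕ∞) < Ψ.stopTime ω ∧
      Ψ.stopTime ω ≤ ((n + m + 1 : ℕ) : ℕ∞)} := by
  ext ω
  simp only [stopBlock, Set.mem_ofPred_eq, Set.mem_union]
  have h1 : ((n : ℕ) : ℕ∞) ≤ ((n + m : ℕ) : ℕ∞) := Nat.cast_le.2 (by omega)
  have h2 : ((n + m : ℕ) : ℕ∞) ≤ ((n + m + 1 : ℕ) : ℕ∞) := Nat.cast_le.2 (by omega)
  rw [show n + (m + 1) = n + m + 1 by omega]
  constructor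
  · rintro ⟨ha, hb⟩
    rcases le_or_gt (Ψ.stopTime ω) ((n + m : ℕ) : ℕ∞) with h | h
    · exact Or.inl ⟨ha, h⟩
    · exact Or.inr ⟨h, hb⟩
  · rintro (⟨ha, hb⟩ | ⟨ha, hb⟩)
    · exact ⟨ha, hb.trans h2⟩
    · exact ⟨h1.trans_lt ha, hb⟩

omit [MeasurableSpace 𝒳] [MeasurableSpace 𝒴] in
lemma lt_stopTime_eq_union (n m : ℕ) : {ω | (n : ℕ∞) < Ψ.stopTime ω} =
    stopBlock Ψ n m ∪ {ω | ((n + m : ℕ) : ℕ∞) < Ψ.stopTime ω} := by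
  ext ω
  simp only [stopBlock, Set.mem_ofPred_eq, Set.mem_union]
  have h1 : ((n : ℕ) : ℕ∞) ≤ ((n + m : ℕ) : ℕ∞) := Nat.cast_le.2 (by omega)
  rcases le_or_gt (Ψ.stopTime ω) ((n + m : ℕ) : ℕ∞) with h | h
  · exact ⟨fun h' => Or.inl ⟨h', h⟩, fun h' => h'.elim And.left fun h'' => absurd h (not_le.2 h'')⟩
  · exact ⟨fun _ => Or.inr h, fun _ => h1.trans_lt h⟩

omit [MeasurableSpace 𝒳] [MeasurableSpace 𝒴] in
lemma disjoint_stopBlock (n m : ℕ) :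
    Disjoint (stopBlock Ψ n m) {ω | ((n + m : ℕ) : ℕ∞) < Ψ.stopTime ω} :=
  Set.disjoint_left.2 fun _ h1 h2 => absurd h1.2 (not_le.2 h2)

include hΨ in
lemma measurableSet_stopBlock_info (n m : ℕ) :
    MeasurableSet[Ψ.info (n + m)] (stopBlock Ψ n m) :=
  @MeasurableSet.inter _ (Ψ.info (n + m)) _ _
    (Ψ.info_mono (by omega : n ≤ n + m) _ (measurableSet_lt_stopTime hΨ n)) (hΨ.2 (n + m))

include hΨ in
lemma measurableSet_stopBlock (n m : ℕ) : MeasurableSet (stopBlock Ψ n m) :=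
  hΨ.info_le _ _ (measurableSet_stopBlock_info hΨ n m)

section Change

variable (hX : M.X.FiniteLLR) (hY : M.Y.FiniteLLR)
include hΨ hX hY

lemma setLIntegral_exp_neg_stoppedLLR_of_lt (n m : ℕ) :
    ∫⁻ ω in {ω | ((n + m : ℕ) : ℕ∞) < Ψ.stopTime ω},
      ENNReal.ofReal (Real.exp (-M.stoppedLLR Ψ n m ω)) ∂M.P ((n + 1 : ℕ) : ℕ∞) =
      M.P ⊤ {ω | ((n + m : ℕ) : ℕ∞) < Ψ.stopTime ω} := by
  rw [← M.setLIntegral_exp_neg_logLR hΨ hX hY n m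
    (le_sup_left (b := seedInfo 𝒳 𝒴 (n + m)) _ (measurableSet_lt_stopTime hΨ (n + m)))]
  refine setLIntegral_congr_fun (measurableSet_lt_stopTime' hΨ _) fun ω hω => ?_
  have hs : M.stoppedLLR Ψ n m ω = M.logLR Ψ n m ω :=
    M.stoppedLLR_eq_logLR fun i hi => lt_of_le_of_lt (Nat.cast_le.2 (by omega)) hω
  simp only [hs]

/-- Slicing the block by the time of declaration: on each slice the stopped sum is a log-likelihood
ratio of fixed length, and the slice belongs to the information at its end. -/
lemma setLIntegral_exp_neg_stoppedLLR_stopBlock (n m : ℕ) :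
    ∫⁻ ω in stopBlock Ψ n m,
      ENNReal.ofReal (Real.exp (-M.stoppedLLR Ψ n m ω)) ∂M.P ((n + 1 : ℕ) : ℕ∞) =
      M.P ⊤ (stopBlock Ψ n m) := by
  induction m with
  | zero =>
    have : stopBlock Ψ n 0 = ∅ := by
      ext ω
      simp [stopBlock]
    simp [this]
  | succ m ih =>
    set E := {ω | ((n + m : ℕ) : ℕ∞) < Ψ.stopTime ω ∧
      Ψ.stopTime ω ≤ ((n + m + 1 : ℕ) : ℕ∞)} with hE
    have hEm : MeasurableSet[Ψ.info (n + (m + 1))] E :=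
      @MeasurableSet.inter _ (Ψ.info (n + (m + 1))) _ _
        (Ψ.info_mono (by omega : n + m ≤ n + (m + 1)) _ (measurableSet_lt_stopTime hΨ (n + m)))
        (hΨ.2 (n + (m + 1)))
    have hE0 := hΨ.info_le _ _ hEm
    have hd : Disjoint (stopBlock Ψ n m) E :=
      Set.disjoint_left.2 fun _ h1 h2 => absurd h1.2 (not_le.2 h2.1)
    rw [stopBlock_succ, lintegral_union hE0 hd, measure_union hd hE0, ← ih]
    congr 1
    · refine setLIntegral_congr_fun (measurableSet_stopBlock hΨ n m) fun ω hω => ?_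
      simp only [M.stoppedLLR_succ_of_le hω.2]
    · rw [← M.setLIntegral_exp_neg_logLR hΨ hX hY n (m + 1)
        (le_sup_left (b := seedInfo 𝒳 𝒴 (n + (m + 1))) _ hEm)]
      refine setLIntegral_congr_fun hE0 fun ω hω => ?_
      have hs : M.stoppedLLR Ψ n (m + 1) ω = M.logLR Ψ n (m + 1) ω :=
        M.stoppedLLR_eq_logLR fun i hi => lt_of_le_of_lt (Nat.cast_le.2 (by omega)) hω.1
      simp only [hs]

end Change

section Drift

variable (hiX : Integrable M.X.llr M.X.law₁) (hiY : Integrable M.Y.llr M.Y.law₁)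
include hiX hiY

lemma integrable_obsLLR (c : Choice) :
    Integrable (fun o : (𝒳 × 𝒴) × Seed => M.obsLLR c o.1) M.coord₁ := by
  cases c
  · rw [← M.map_Y₁] at hiY
    exact hiY.comp_measurable measurable_obsY
  · rw [← M.map_X₁] at hiX
    exact hiX.comp_measurable measurable_obsX
  · exact integrable_zero _ _ _

omit hiX hiY in
lemma integral_obsLLR_le {I : ℝ} (hI : 0 ≤ I) (hIX : ∫ x, M.X.llr x ∂M.X.law₁ ≤ I)
    (hIY : ∫ y, M.Y.llr y ∂M.Y.law₁ ≤ I) (c : Choice) :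
    ∫ o : (𝒳 × 𝒴) × Seed, M.obsLLR c o.1 ∂M.coord₁ ≤ I := by
  cases c
  · rwa [← M.map_Y₁, integral_map measurable_obsY.aemeasurable
      M.Y.measurable_llr.aestronglyMeasurable] at hIY
  · rwa [← M.map_X₁, integral_map measurable_obsX.aemeasurable
      M.X.measurable_llr.aestronglyMeasurable] at hIX
  · simpa [obsLLR] using hI

omit hiX hiY in
-- On the event that the choice is `c`, the increment depends on the coordinate `k` alone, so
-- independence from the past can be applied to each summand.
lemma increment_eq_sum (k : ℕ) (D : Set (Sample 𝒳 𝒴)) (ω : Sample 𝒳 𝒴) :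
    D.indicator (M.increment Ψ k) ω = ∑ c, (D ∩ Ψ.select k ⁻¹' {c}).indicator
      (fun ω => M.obsLLR c (ω k).1) ω := by
  by_cases h : ω ∈ D
  · rw [Finset.sum_eq_single (Ψ.select k ω)]
    · rw [Set.indicator_of_mem h, Set.indicator_of_mem (by exact ⟨h, rfl⟩)]
      rfl
    · intro c _ hc
      exact Set.indicator_of_notMem (fun h' => hc h'.2.symm) _
    · simp
  · simp [h]

include hΨ

lemma integrable_indicator_increment (n k : ℕ) (hnk : n < k + 1) {D : Set (Sample 𝒳 𝒴)}
    (hD : MeasurableSet[past 𝒳 𝒴 (k + 1)] D) :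
    Integrable (D.indicator (M.increment Ψ (k + 1))) (M.P ((n + 1 : ℕ) : ℕ∞)) := by
  have heq : D.indicator (M.increment Ψ (k + 1)) = fun ω =>
      ∑ c, (D ∩ Ψ.select (k + 1) ⁻¹' {c}).indicator (fun ω => M.obsLLR c (ω (k + 1)).1) ω :=
    funext fun ω => M.increment_eq_sum (k + 1) D ω
  rw [heq]
  refine integrable_finsetSum _ fun c _ => Integrable.indicator ?_ (past_le 𝒳 𝒴 (k + 1) _
    (@MeasurableSet.inter _ (past 𝒳 𝒴 (k + 1)) _ _ hD
      (hΨ.measurable_select k (measurableSet_singleton c))))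
  have hmp := measurePreserving_eval_infinitePi (M.coord ((n + 1 : ℕ) : ℕ∞)) (k + 1)
  rw [M.coord_of_le (n + 1) (k + 1) (by omega), ← P_eq] at hmp
  exact hmp.integrable_comp_of_integrable (M.integrable_obsLLR hiX hiY c)

lemma integral_indicator_increment_le {I : ℝ} (hI : 0 ≤ I)
    (hIX : ∫ x, M.X.llr x ∂M.X.law₁ ≤ I) (hIY : ∫ y, M.Y.llr y ∂M.Y.law₁ ≤ I) (n k : ℕ)
    (hnk : n < k + 1) {D : Set (Sample 𝒳 𝒴)} (hD : MeasurableSet[past 𝒳 𝒴 (k + 1)] D) :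
    ∫ ω, D.indicator (M.increment Ψ (k + 1)) ω ∂M.P ((n + 1 : ℕ) : ℕ∞) ≤
      (M.P ((n + 1 : ℕ) : ℕ∞) D).toReal * I := by
  set P := M.P ((n + 1 : ℕ) : ℕ∞) with hP
  have hDc : ∀ c, MeasurableSet[past 𝒳 𝒴 (k + 1)] (D ∩ Ψ.select (k + 1) ⁻¹' {c}) := fun c =>
    @MeasurableSet.inter _ (past 𝒳 𝒴 (k + 1)) _ _ hD
      (hΨ.measurable_select k (measurableSet_singleton c))
  have hint : ∀ c, Integrable ((D ∩ Ψ.select (k + 1) ⁻¹' {c}).indicator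
      (fun ω : Sample 𝒳 𝒴 => M.obsLLR c (ω (k + 1)).1)) P := fun c => by
    refine Integrable.indicator ?_ (past_le 𝒳 𝒴 (k + 1) _ (hDc c))
    have hmp := measurePreserving_eval_infinitePi (M.coord ((n + 1 : ℕ) : ℕ∞)) (k + 1)
    rw [M.coord_of_le (n + 1) (k + 1) (by omega), ← P_eq] at hmp
    exact hmp.integrable_comp_of_integrable (M.integrable_obsLLR hiX hiY c)
  have hval : ∀ c, ∫ ω, (D ∩ Ψ.select (k + 1) ⁻¹' {c}).indicator
      (fun ω : Sample 𝒳 𝒴 => M.obsLLR c (ω (k + 1)).1) ω ∂P ≤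
      (P (D ∩ Ψ.select (k + 1) ⁻¹' {c})).toReal * I := fun c => by
    rw [integral_indicator (past_le 𝒳 𝒴 (k + 1) _ (hDc c)), hP, P_eq,
      setIntegral_eval_past (M.coord ((n + 1 : ℕ) : ℕ∞)) (k + 1) (hDc c)
        (g := fun o => M.obsLLR c o.1) ((M.measurable_obsLLR_right c).comp measurable_fst),
      M.coord_of_le (n + 1) (k + 1) (by omega)]
    exact mul_le_mul_of_nonneg_left (M.integral_obsLLR_le hI hIX hIY c) ENNReal.toReal_nonneg
  simp only [M.increment_eq_sum (k + 1) D]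
  rw [integral_finsetSum _ fun c _ => hint c]
  refine (Finset.sum_le_sum fun c _ => hval c).trans (le_of_eq ?_)
  rw [← Finset.sum_mul]
  congr 1
  rw [← ENNReal.toReal_sum fun c _ => measure_ne_top _ _]
  congr 1
  rw [← tsum_fintype (L := .unconditional Choice), ← measure_iUnion]
  · congr 1
    ext; simp
  · exact fun c c' hc => Set.disjoint_left.2 fun ω h1 h2 => hc (h1.2.symm.trans h2.2)
  · exact fun c => past_le 𝒳 𝒴 (k + 1) _ (hDc c)

lemma integrable_stoppedLLR (n m : ℕ) :
    Integrable (M.stoppedLLR Ψ n m) (M.P ((n + 1 : ℕ) : ℕ∞)) := by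
  refine integrable_finsetSum _ fun i _ => ?_
  rw [show n + 1 + i = n + i + 1 by omega]
  exact M.integrable_indicator_increment hΨ hiX hiY n (n + i) (by omega)
    (measurableSet_lt_stopTime_past hΨ (n + i))

/-- The mean information collected before the declaration is at most `I` for each time step. -/
lemma integral_stoppedLLR_le {I : ℝ} (hI : 0 ≤ I)
    (hIX : ∫ x, M.X.llr x ∂M.X.law₁ ≤ I) (hIY : ∫ y, M.Y.llr y ∂M.Y.law₁ ≤ I) (n m : ℕ) :
    ∫ ω, M.stoppedLLR Ψ n m ω ∂M.P ((n + 1 : ℕ) : ℕ∞) ≤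
      (∑ i ∈ Finset.range m, (M.P ((n + 1 : ℕ) : ℕ∞)
        {ω | ((n + i : ℕ) : ℕ∞) < Ψ.stopTime ω}).toReal) * I := by
  have hint : ∀ i ∈ Finset.range m, Integrable ({ω | ((n + i : ℕ) : ℕ∞) < Ψ.stopTime ω}.indicator
      (M.increment Ψ (n + 1 + i))) (M.P ((n + 1 : ℕ) : ℕ∞)) := fun i _ => by
    rw [show n + 1 + i = n + i + 1 by omega]
    exact M.integrable_indicator_increment hΨ hiX hiY n (n + i) (by omega)
      (measurableSet_lt_stopTime_past hΨ (n + i))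
  simp only [stoppedLLR]
  rw [integral_finsetSum _ hint, Finset.sum_mul]
  refine Finset.sum_le_sum fun i _ => ?_
  have := M.integral_indicator_increment_le hΨ hiX hiY hI hIX hIY n (n + i) (by omega)
    (measurableSet_lt_stopTime_past hΨ (n + i))
  rwa [show n + i + 1 = n + 1 + i by omega] at this

end Drift

end Model

namespace Model

variable {𝒳 𝒴 : Type*} [MeasurableSpace 𝒳] [MeasurableSpace 𝒴] (M : Model 𝒳 𝒴)
  {Ψ : Policy 𝒳 𝒴} (hΨ : Ψ.IsAdmissible)

include hΨ

lemma P_lt_stopTime_eq (n : ℕ) : M.P ((n + 1 : ℕ) : ℕ∞) {ω | (n : ℕ∞) < Ψ.stopTime ω} =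
    M.P ⊤ {ω | (n : ℕ∞) < Ψ.stopTime ω} := by
  rw [P_eq, P_eq]
  refine infinitePi_eq_of_past (fun k hk => ?_) (measurableSet_lt_stopTime_past hΨ n)
  rw [M.coord_of_lt _ _ hk, coord_top]

/-- The event `{τ > n}` lies in `I_n`, so the worst-case delay bounds the mean of `(τ - n)⁺` on it,
and the left side is a part of the layer-cake sum of that mean. Up to time `n` the change is not
felt, hence the probability without a change on the right. -/
lemma sum_P_lt_stopTime_le (n m : ℕ) :
    ∑ i ∈ Finset.range m, M.P ((n + 1 : ℕ) : ℕ∞) {ω | ((n + i : ℕ) : ℕ∞) < Ψ.stopTime ω} ≤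
      M.WADD Ψ * M.P ⊤ {ω | (n : ℕ∞) < Ψ.stopTime ω} := by
  rw [← M.P_lt_stopTime_eq hΨ n]
  refine le_trans ?_ (M.setLIntegral_le_WADD_mul Ψ (hΨ.info_le n) (measurableSet_lt_stopTime hΨ n))
  have hm := fun i => measurableSet_lt_stopTime' hΨ (n + i)
  simp only [← lintegral_indicator_one (hm _)]
  rw [← lintegral_finsetSum _ fun i _ => measurable_one.indicator (hm i),
    ← lintegral_indicator (measurableSet_lt_stopTime' hΨ n)]
  refine lintegral_mono fun ω => ?_
  by_cases h : (n : ℕ∞) < Ψ.stopTime ω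
  · rw [Set.indicator_of_mem (by exact h)]
    refine le_trans (le_of_eq (Finset.sum_congr rfl fun i _ => ?_))
      (sum_lt_le_sub (Ψ.stopTime ω) n m h)
    simp [Set.indicator_apply]
  · rw [Set.indicator_of_notMem (by exact h)]
    refine le_of_eq (Finset.sum_eq_zero fun i _ => Set.indicator_of_notMem ?_ _)
    exact fun h' => h (lt_of_le_of_lt (Nat.cast_le.2 (by omega)) (Set.mem_ofPred_eq ▸ h'))

variable (hX : M.X.FiniteLLR) (hY : M.Y.FiniteLLR)
  (hiX : Integrable M.X.llr M.X.law₁) (hiY : Integrable M.Y.llr M.Y.law₁)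
include hX hY hiX hiY

/-- A policy with a small delay stops in each block of times, if it has not stopped before, with a
probability bounded from below also when there is no change. -/
lemma exp_mul_P_lt_stopTime_add_le {I J K θ : ℝ} (hI : 0 ≤ I)
    (hIX : ∫ x, M.X.llr x ∂M.X.law₁ ≤ I) (hIY : ∫ y, M.Y.llr y ∂M.Y.law₁ ≤ I)
    (hJ : 0 ≤ J) (hWJ : M.WADD Ψ ≤ ENNReal.ofReal J) (hK : 0 < K) (hθ : 0 ≤ θ)
    (hθJ : I * J + Real.log 2 ≤ θ * (1 - 1 / K)) {m : ℕ} (hm : 0 < m) (hKm : K * J ≤ m) (n : ℕ) :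
    ENNReal.ofReal (Real.exp θ) * M.P ⊤ {ω | ((n + m : ℕ) : ℕ∞) < Ψ.stopTime ω} +
      M.P ⊤ {ω | (n : ℕ∞) < Ψ.stopTime ω} ≤
      ENNReal.ofReal (Real.exp θ) * M.P ⊤ {ω | (n : ℕ∞) < Ψ.stopTime ω} := by
  set P := M.P ((n + 1 : ℕ) : ℕ∞) with hP
  set G := {ω | (n : ℕ∞) < Ψ.stopTime ω} with hG
  set L := {ω | ((n + m : ℕ) : ℕ∞) < Ψ.stopTime ω} with hL
  set A := stopBlock Ψ n m with hA
  have hGm : MeasurableSet G := measurableSet_lt_stopTime' hΨ n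
  have hLm : MeasurableSet L := measurableSet_lt_stopTime' hΨ (n + m)
  have hAm : MeasurableSet A := measurableSet_stopBlock hΨ n m
  have hGU : G = A ∪ L := lt_stopTime_eq_union n m
  have hdis : Disjoint A L := disjoint_stopBlock n m
  set r := (M.P ⊤ G).toReal with hr
  set a := (M.P ⊤ A).toReal with ha
  set b := (M.P ⊤ L).toReal with hb
  set q := fun i : ℕ => (P {ω | ((n + i : ℕ) : ℕ∞) < Ψ.stopTime ω}).toReal with hq
  have hrab : r = a + b := by
    rw [hr, hGU, measure_union hdis hLm, ENNReal.toReal_add (measure_ne_top _ _)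
      (measure_ne_top _ _)]
  have hrP : (P G).toReal = r := by rw [hP, hG, M.P_lt_stopTime_eq hΨ n]
  have hr0 : 0 ≤ r := ENNReal.toReal_nonneg
  have hsum : ∑ i ∈ Finset.range m, q i ≤ J * r := by
    have h := (M.sum_P_lt_stopTime_le hΨ n m).trans (mul_le_mul_left hWJ _)
    rw [← ENNReal.toReal_sum fun i _ => measure_ne_top _ _]
    refine (ENNReal.toReal_mono ?_ h).trans (le_of_eq ?_)
    · exact ENNReal.mul_ne_top ENNReal.ofReal_ne_top (measure_ne_top _ _)
    · rw [ENNReal.toReal_mul, ENNReal.toReal_ofReal hJ]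
  -- Markov's inequality: the event `L` is contained in each of the `m` events of the sum. With `m ≥
  -- K J` it has at most the share `1/K` of `G`.
  have hqm : (m : ℝ) * q m ≤ J * r := by
    refine le_trans ?_ hsum
    rw [← nsmul_eq_mul, ← Finset.card_range m, ← Finset.sum_const, Finset.card_range]
    refine Finset.sum_le_sum fun i hi => ENNReal.toReal_mono (measure_ne_top _ _)
      (measure_mono fun ω hω => ?_)
    have hω' : ((n + m : ℕ) : ℕ∞) < Ψ.stopTime ω := hω
    exact lt_of_le_of_lt (Nat.cast_le.2 (by have := Finset.mem_range.1 hi; omega)) hω'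
  have hqr : q m ≤ r * (1 / K) := by
    have hm' : (0 : ℝ) < m := Nat.cast_pos.2 hm
    rw [mul_one_div, le_div_iff₀ hK]
    have h1 : (m : ℝ) * (q m * K) ≤ m * r := by
      calc (m : ℝ) * (q m * K) = K * (m * q m) := by ring
        _ ≤ K * (J * r) := mul_le_mul_of_nonneg_left hqm hK.le
        _ = K * J * r := by ring
        _ ≤ m * r := mul_le_mul_of_nonneg_right hKm hr0
    exact le_of_mul_le_mul_left h1 hm'
  have hPA : (P A).toReal = r - q m := by
    have : P G = P A + P L := by rw [hGU, measure_union hdis hLm]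
    have h2 : (P G).toReal = (P A).toReal + (P L).toReal := by
      rw [this, ENNReal.toReal_add (measure_ne_top _ _) (measure_ne_top _ _)]
    have h3 : (P L).toReal = q m := rfl
    linarith
  set Λ := M.stoppedLLR Ψ n m with hΛ
  have hΛi : Integrable Λ P := M.integrable_stoppedLLR hΨ hiX hiY n m
  have hΛle : ∫ ω in G, Λ ω ∂P ≤ I * (J * r) := by
    have h0 : ∫ ω in G, Λ ω ∂P = ∫ ω, Λ ω ∂P := by
      refine setIntegral_eq_integral_of_forall_compl_eq_zero fun ω hω => ?_
      refine Finset.sum_eq_zero fun i _ => Set.indicator_of_notMem (fun h' => hω ?_) _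
      have hω' : ((n + i : ℕ) : ℕ∞) < Ψ.stopTime ω := h'
      exact lt_of_le_of_lt (Nat.cast_le.2 (by omega)) hω'
    rw [h0]
    refine (M.integral_stoppedLLR_le hΨ hiX hiY hI hIX hIY n m).trans ?_
    rw [mul_comm]
    exact mul_le_mul_of_nonneg_left hsum hI
  -- The inequality `1 + u ≤ exp u` is integrated over `G`. The term `-Λ` changes the measure to the
  -- one without a change, and `θ` rewards stopping in the block. The shift `log 2` halves the right
  -- side, so that the share `b / 2` of not stopping can be absorbed by `r = a + b`.
  let u : Sample 𝒳 𝒴 → ℝ := fun ω => A.indicator (fun _ => θ) ω - Λ ω - Real.log 2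
  have hui : Integrable u (P.restrict G) :=
    ((((integrable_const θ).indicator hAm).sub hΛi).sub (integrable_const _)).restrict
  have hui' : ∫ ω in G, (1 + u ω) ∂P = r * (1 - Real.log 2) + θ * (r - q m) - ∫ ω in G, Λ ω ∂P := by
    have e1 : ∀ ω, 1 + u ω = (A.indicator (fun _ => θ) ω - Λ ω) + (1 - Real.log 2) := fun ω => by
      simp only [u]; ring
    simp only [e1]
    have i1 : Integrable (A.indicator (fun _ : Sample 𝒳 𝒴 => θ)) (P.restrict G) :=
      ((integrable_const θ).indicator hAm).restrict
    have hAG : A ∩ G = A := Set.inter_eq_left.2 (hGU ▸ Set.subset_union_left)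
    have i2 : Integrable (fun ω => A.indicator (fun _ : Sample 𝒳 𝒴 => θ) ω - Λ ω) (P.restrict G) :=
      i1.sub hΛi.restrict
    rw [integral_add i2 (integrable_const _), integral_sub i1 hΛi.restrict,
      integral_indicator hAm, Measure.restrict_restrict hAm, hAG, setIntegral_const,
      setIntegral_const]
    simp only [Measure.real, smul_eq_mul, hPA, hrP]
    ring
  have hexp : ∫⁻ ω in G, ENNReal.ofReal (Real.exp (u ω)) ∂P =
      ENNReal.ofReal (Real.exp θ / 2 * a + 1 / 2 * b) := by
    have hΛm : Measurable fun ω => ENNReal.ofReal (Real.exp (-Λ ω)) := by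
      refine Measurable.ennreal_ofReal (Measurable.exp (Measurable.neg ?_))
      refine Finset.measurable_fun_sum _ fun i _ => ?_
      refine Measurable.indicator ?_ (measurableSet_lt_stopTime' hΨ (n + i))
      rw [show n + 1 + i = n + i + 1 by omega]
      exact (M.measurable_increment hΨ (n + i)).mono (past_le 𝒳 𝒴 _) le_rfl
    have hlog : Real.exp (-Real.log 2) = 1 / 2 := by
      rw [Real.exp_neg, Real.exp_log two_pos, one_div]
    have e1 : ∫⁻ ω in A, ENNReal.ofReal (Real.exp (u ω)) ∂P =
        ENNReal.ofReal (Real.exp θ / 2) * M.P ⊤ A := by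
      rw [← M.setLIntegral_exp_neg_stoppedLLR_stopBlock hΨ hX hY n m,
        ← lintegral_const_mul _ hΛm]
      refine setLIntegral_congr_fun hAm fun ω hω => ?_
      simp only [u, Set.indicator_of_mem hω]
      rw [← ENNReal.ofReal_mul (by positivity)]
      congr 1
      rw [show θ - Λ ω - Real.log 2 = θ + -Real.log 2 + -Λ ω by ring, Real.exp_add, Real.exp_add,
        hlog]
      ring
    have e2 : ∫⁻ ω in L, ENNReal.ofReal (Real.exp (u ω)) ∂P =
        ENNReal.ofReal (1 / 2) * M.P ⊤ L := by
      rw [← M.setLIntegral_exp_neg_stoppedLLR_of_lt hΨ hX hY n m, ← lintegral_const_mul _ hΛm]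
      refine setLIntegral_congr_fun hLm fun ω hω => ?_
      simp only [u, Set.indicator_of_notMem (Set.disjoint_right.1 hdis hω)]
      rw [← ENNReal.ofReal_mul (by positivity)]
      congr 1
      rw [show 0 - Λ ω - Real.log 2 = -Real.log 2 + -Λ ω by ring, Real.exp_add, hlog]
    rw [hGU, lintegral_union hLm hdis, e1, e2, ← ENNReal.ofReal_toReal (measure_ne_top (M.P ⊤) A),
      ← ENNReal.ofReal_toReal (measure_ne_top (M.P ⊤) L), ← ENNReal.ofReal_mul (by positivity),
      ← ENNReal.ofReal_mul (by positivity), ← ENNReal.ofReal_add (by positivity) (by positivity)]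
  have hb0 : 0 ≤ b := ENNReal.toReal_nonneg
  have ha0 : 0 ≤ a := ENNReal.toReal_nonneg
  have hmain := ofReal_integral_le_lintegral_exp hui (integrable_const 1)
  rw [hui', hexp, ENNReal.ofReal_le_ofReal_iff (by positivity)] at hmain
  have h1 : θ * q m ≤ θ * (r * (1 / K)) := mul_le_mul_of_nonneg_left hqr hθ
  have h2 : (I * J + Real.log 2) * r ≤ θ * (1 - 1 / K) * r :=
    mul_le_mul_of_nonneg_right hθJ hr0
  -- By the choice of `θ` the integral of `1 + u` is at least `r`, so `2r ≤ e^θ a + b`, which gives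
  -- `r ≤ e^θ a = e^θ (r - b)`.
  have hfin : Real.exp θ * b + r ≤ Real.exp θ * r := by
    rw [hrab] at *
    nlinarith
  rw [← ENNReal.ofReal_toReal (measure_ne_top (M.P ⊤) L),
    ← ENNReal.ofReal_toReal (measure_ne_top (M.P ⊤) G), ← ENNReal.ofReal_mul (Real.exp_pos _).le,
    ← ENNReal.ofReal_mul (Real.exp_pos _).le,
    ← ENNReal.ofReal_add (by positivity) ENNReal.toReal_nonneg]
  exact ENNReal.ofReal_le_ofReal hfin

/-- A policy with a small worst-case delay has a bounded run length to false alarm. -/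
theorem ARLFA_le {I J K θ : ℝ} (hI : 0 ≤ I)
    (hIX : ∫ x, M.X.llr x ∂M.X.law₁ ≤ I) (hIY : ∫ y, M.Y.llr y ∂M.Y.law₁ ≤ I)
    (hJ : 0 ≤ J) (hWJ : M.WADD Ψ ≤ ENNReal.ofReal J) (hK : 0 < K) (hθ : 0 ≤ θ)
    (hθJ : I * J + Real.log 2 ≤ θ * (1 - 1 / K)) {m : ℕ} (hm : 0 < m) (hKm : K * J ≤ m) :
    M.ARLFA Ψ ≤ m * ENNReal.ofReal (Real.exp θ) := by
  set E := ENNReal.ofReal (Real.exp θ) with hE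
  let f : ℕ → ℝ≥0∞ := fun n => M.P ⊤ {ω | (n : ℕ∞) < Ψ.stopTime ω}
  have hf1 : ∀ n, f n ≤ 1 := fun n => prob_le_one
  have hanti : Antitone f := fun i j hij => measure_mono fun ω hω =>
    lt_of_le_of_lt (Nat.cast_le.2 hij) (Set.mem_ofPred_eq ▸ hω)
  have hblock : ∀ n, E * f (n + m) + f n ≤ E * f n := fun n =>
    M.exp_mul_P_lt_stopTime_add_le hΨ hX hY hiX hiY hI hIX hIY hJ hWJ hK hθ hθJ hm hKm n
  -- The block inequality reads `f n ≤ E (f n - f (n + m))` and telescopes along multiples of `m`;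
  -- within a block `f` is at most its first value.
  have hind : ∀ j : ℕ, ∑ k ∈ Finset.range (m * j), f k + m * (E * f (m * j)) ≤ m * E := by
    intro j
    induction j with
    | zero =>
      simp only [mul_zero, Finset.range_zero, Finset.sum_empty, zero_add]
      exact mul_le_mul_right (mul_le_of_le_one_right' (hf1 0)) _
    | succ j ih =>
      refine le_trans ?_ ih
      rw [Nat.mul_succ, Finset.sum_range_add, add_assoc]
      refine add_le_add le_rfl ?_
      calc ∑ i ∈ Finset.range m, f (m * j + i) + m * (E * f (m * j + m))
          ≤ m * f (m * j) + m * (E * f (m * j + m)) := by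
            refine add_le_add ?_ le_rfl
            refine (Finset.sum_le_sum fun i _ => hanti (Nat.le_add_right (m * j) i)).trans ?_
            simp
        _ = m * (E * f (m * j + m) + f (m * j)) := by ring
        _ ≤ _ := mul_le_mul_right (hblock _) _
  rw [ARLFA, lintegral_toENNReal_eq_tsum _ fun n => hΨ.info_le n _ (hΨ.2 n), ENNReal.tsum_eq_iSup_nat]
  refine iSup_le fun j => le_trans ?_ (hind j)
  refine le_trans (Finset.sum_le_sum_of_subset (Finset.range_mono ?_)) le_self_add
  exact Nat.le_mul_of_pos_left j hm

end Model

/-! ### Matching the bounds: asymptotic optimality. -/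

lemma log_le_mul_sub {η x : ℝ} (hη : 0 < η) (hx : 0 < x) :
    Real.log x ≤ η * x - (Real.log η + 1) := by
  have := Real.log_le_sub_one_of_pos (mul_pos hη hx)
  rw [Real.log_mul hη.ne' hx.ne'] at this
  linarith

/-- The constants with which the two bounds on the delay match. -/
lemma exists_rate_constants {I ε : ℝ} (hI : 0 < I) (hε : 0 < ε) :
    ∃ K I' a b : ℝ, 1 < K ∧ 0 < I' ∧ I' < I ∧ 0 < a ∧ a / I' ≤ 1 + ε / 2 ∧
      ∀ J, 0 ≤ J → Real.log (K * J + 2) + (I * J + Real.log 2) / (1 - 1 / K) ≤ a * J + b := by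
  -- The choice `K = 1 + 1/δ` makes `1/(1 - 1/K) = 1 + δ`, and the slope `η` charges the logarithm
  -- at most `δ I J` plus a constant. With `I' = I/(1 + δ)` the ratio is `a / I' = (1 + 2δ)(1 + δ) ≤
  -- 1 + 5δ ≤ 1 + ε/2`.
  set δ := min 1 (ε / 10) with hδ
  have hδ0 : 0 < δ := lt_min one_pos (by positivity)
  have hδ1 : δ ≤ 1 := min_le_left _ _
  have hδε : δ ≤ ε / 10 := min_le_right _ _
  set K := 1 + 1 / δ with hK
  have hK0 : 0 < K := by positivity
  set η := δ * I / K with hη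
  have hη0 : 0 < η := by positivity
  refine ⟨K, I / (1 + δ), I * (1 + δ) + δ * I,
    η * 2 - (Real.log η + 1) + Real.log 2 * (1 + δ), ?_, by positivity, ?_, by positivity, ?_, ?_⟩
  · rw [hK]
    have : 0 < 1 / δ := by positivity
    linarith
  · exact div_lt_self hI (by linarith)
  · have : (I * (1 + δ) + δ * I) / (I / (1 + δ)) = (1 + 2 * δ) * (1 + δ) := by
      field_simp
      ring
    rw [this]
    nlinarith
  · intro J hJ
    have h1 : 1 / (1 - 1 / K) = 1 + δ := by
      rw [hK]
      field_simp
      ring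
    have h2 := log_le_mul_sub hη0 (show 0 < K * J + 2 by positivity)
    have h3 : η * (K * J) = δ * I * J := by
      rw [hη]; field_simp
    rw [div_eq_mul_one_div, h1]
    nlinarith

namespace Model

variable {𝒳 𝒴 : Type*} [MeasurableSpace 𝒳] [MeasurableSpace 𝒴] (M : Model 𝒳 𝒴)
  {p : DEParams}

/-- The delay of the algorithm exceeds the delay of CUSUM by at most a constant that does not
depend on the threshold. -/
theorem exists_WADD_de2e_le (hY : M.Y.FiniteLLR) (hne : M.Y.law₁ ≠ M.Y.law₀) (hp : p.Positive) :
    ∃ C : ℝ≥0, ∀ A : ℝ, 0 < A → M.WADD (M.de2e A p) ≤ M.cusumDelay A 0 + (C : ℝ≥0∞) := by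
  obtain ⟨ρ, hρ0, hρ1, hρ⟩ := Experiment.exists_hellinger_lt_one hY hne
  have h1 : 0 < 1 - ρ := by linarith
  have hκ : 0 ≤ ρ / (1 - ρ) := by positivity
  -- The mean of a geometric number of falls, `κ = ρ/(1 - ρ)`, solves `(κ + 1) ρ = κ`.
  have hρκ : (ρ / (1 - ρ) + 1) * ρ ≤ ρ / (1 - ρ) := le_of_eq (by field_simp; ring)
  have hfin : p.maxExcursion * ENNReal.ofReal (ρ / (1 - ρ)) + p.maxExcursion ≠ ∞ :=
    ENNReal.add_ne_top.2 ⟨ENNReal.mul_ne_top p.maxExcursion_ne_top ENNReal.ofReal_ne_top,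
      p.maxExcursion_ne_top⟩
  refine ⟨(p.maxExcursion * ENNReal.ofReal (ρ / (1 - ρ)) + p.maxExcursion).toNNReal,
    fun A hA => ?_⟩
  rw [ENNReal.coe_toNNReal hfin, ← add_assoc]
  refine (M.WADD_de2e_le hp hA).trans (add_le_add ?_ le_rfl)
  rw [meanStop₁_de2e]
  exact M.delay_le_cusumDelay_add hp hA.le hρ hκ hρκ

/-- The algorithm is asymptotically optimal among all policies with the same false alarm rate. -/
theorem WADD_de2e_le_mul (hX : M.X.FiniteLLR) (hY : M.Y.FiniteLLR)
    (hpos : 0 < InformationTheory.klDiv M.X.law₁ M.X.law₀)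
    (hle : InformationTheory.klDiv M.X.law₁ M.X.law₀ ≤ InformationTheory.klDiv M.Y.law₁ M.Y.law₀)
    (hfin : InformationTheory.klDiv M.Y.law₁ M.Y.law₀ < ∞) (hp : p.Positive) {ε : ℝ}
    (hε : 0 < ε) :
    ∃ γ₀ : ℝ, 1 < γ₀ ∧ ∀ γ : ℝ, γ₀ ≤ γ → ∀ Ψ : Policy 𝒳 𝒴, Ψ.IsAdmissible →
      ENNReal.ofReal γ ≤ M.ARLFA Ψ →
        M.WADD (M.de2e (Real.log γ) p) ≤ ENNReal.ofReal (1 + ε) * M.WADD Ψ := by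
  have hne : M.Y.law₁ ≠ M.Y.law₀ := fun h => by
    rw [h, InformationTheory.klDiv_self] at hle
    exact absurd hle (not_le.2 hpos)
  have hiY := Experiment.integrable_llr hY hfin.ne
  have hiX := Experiment.integrable_llr hX (hle.trans_lt hfin).ne
  have hIY := Experiment.integral_llr hY
  have hIX := Experiment.integral_llr hX
  set I := (InformationTheory.klDiv M.Y.law₁ M.Y.law₀).toReal with hI
  have hI0 : 0 < I := ENNReal.toReal_pos (hpos.trans_le hle).ne' hfin.ne
  obtain ⟨K, I', a, b, hK1, hI', hI'I, ha, haI, hab⟩ := exists_rate_constants hI0 hε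
  obtain ⟨M', hM', hint, hlt⟩ := Experiment.exists_lt_integral_min_llr hiY (I' := I')
    (by rwa [hIY])
  obtain ⟨C, hC⟩ := M.exists_WADD_de2e_le hY hne hp
  have hK0 : 0 < K := by linarith
  have hK : 0 < 1 - 1 / K := by
    rw [sub_pos, div_lt_one hK0]
    exact hK1
  -- Once `J ≥ T`, all additive constants are absorbed by `(ε/2) J`. The bound `log γ ≤ a J + b`
  -- forces this as soon as `log γ ≥ a T + b`; the maximum with `1` keeps the threshold positive.
  set T := 2 / ε * (b / I' + M' / I' + C) with hT
  refine ⟨Real.exp (max 1 (a * T + b)), Real.one_lt_exp_iff.2 (lt_max_of_lt_left one_pos),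
    fun γ hγ Ψ hΨ hARL => ?_⟩
  have hγ0 : 0 < γ := (Real.exp_pos _).trans_le hγ
  have hlog : max 1 (a * T + b) ≤ Real.log γ := (Real.le_log_iff_exp_le hγ0).2 hγ
  have hlog0 : 0 < Real.log γ := one_pos.trans_le ((le_max_left _ _).trans hlog)
  rcases eq_or_ne (M.WADD Ψ) ∞ with htop | htop
  · rw [htop, ENNReal.mul_top (by simp; linarith)]
    exact le_top
  set J := (M.WADD Ψ).toReal with hJ
  have hJ0 : 0 ≤ J := ENNReal.toReal_nonneg
  have hWJ : M.WADD Ψ = ENNReal.ofReal J := (ENNReal.ofReal_toReal htop).symm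
  set θ := (I * J + Real.log 2) / (1 - 1 / K) with hθ
  have hθ0 : 0 ≤ θ := by
    have := Real.log_pos one_lt_two
    positivity
  have hθJ : I * J + Real.log 2 ≤ θ * (1 - 1 / K) := (div_mul_cancel₀ _ hK.ne').ge
  -- The block length is `⌈K J⌉ + 1`, positive even for `J = 0` and at most `K J + 2`.
  have hle' := M.ARLFA_le hΨ hX hY hiX hiY hI0.le
    (hIX.trans_le (ENNReal.toReal_mono hfin.ne hle)) hIY.le hJ0 hWJ.le hK0 hθ0 hθJ
    (Nat.succ_pos ⌈K * J⌉₊) ((Nat.le_ceil _).trans (Nat.cast_le.2 (Nat.le_succ _)))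
  have hm0 : (0 : ℝ) < (⌈K * J⌉₊.succ : ℕ) := Nat.cast_pos.2 (Nat.succ_pos _)
  have hγle : γ ≤ (⌈K * J⌉₊.succ : ℕ) * Real.exp θ := by
    have := hARL.trans hle'
    rw [← ENNReal.ofReal_natCast, ← ENNReal.ofReal_mul hm0.le] at this
    exact (ENNReal.ofReal_le_ofReal_iff (by positivity)).1 this
  have hloga : Real.log γ ≤ a * J + b := by
    calc Real.log γ ≤ Real.log ((⌈K * J⌉₊.succ : ℕ) * Real.exp θ) := Real.log_le_log hγ0 hγle
      _ = Real.log (⌈K * J⌉₊.succ : ℕ) + θ := by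
        rw [Real.log_mul hm0.ne' (Real.exp_pos _).ne', Real.log_exp]
      _ ≤ Real.log (K * J + 2) + θ := by
        refine add_le_add (Real.log_le_log hm0 ?_) le_rfl
        have := Nat.ceil_lt_add_one (mul_nonneg hK0.le hJ0)
        push_cast
        linarith
      _ ≤ _ := hab J hJ0
  have hTJ : T ≤ J := by
    have h1 := (le_max_right _ _).trans hlog
    exact le_of_mul_le_mul_left (by linarith) ha
  refine (hC _ hlog0).trans ((add_le_add (M.cusumDelay_le hlog0.le hM' hI' hint hlt.le)
    le_rfl).trans ?_)
  rw [hWJ, ← ENNReal.ofReal_mul (by linarith), ← ENNReal.ofReal_coe_nnreal,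
    ← ENNReal.ofReal_add (by positivity) C.coe_nonneg]
  refine ENNReal.ofReal_le_ofReal ?_
  have h1 : (Real.log γ + M') / I' ≤ a / I' * J + (b / I' + M' / I') := by
    rw [add_div, ← add_assoc]
    refine add_le_add ?_ le_rfl
    rw [div_mul_eq_mul_div, ← add_div]
    exact div_le_div_of_nonneg_right hloga hI'.le
  have h2 : a / I' * J ≤ (1 + ε / 2) * J := mul_le_mul_of_nonneg_right haI hJ0
  have h3 : b / I' + M' / I' + C = ε / 2 * T := by
    rw [hT]
    field_simp
  have h4 : ε / 2 * T ≤ ε / 2 * J := mul_le_mul_of_nonneg_left hTJ (by positivity)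
  linarith

end Model

end

end QCD

theorem theorem4 {𝒳 𝒴 : Type*} [MeasurableSpace 𝒳] [MeasurableSpace 𝒴] (M : QCD.Model 𝒳 𝒴)
    (hX : M.X.FiniteLLR) (hY : M.Y.FiniteLLR)
    (hKL :
      (0 < InformationTheory.klDiv M.X.law₀ M.X.law₁ ∧
        InformationTheory.klDiv M.X.law₀ M.X.law₁ ≤ InformationTheory.klDiv M.Y.law₀ M.Y.law₁ ∧
        InformationTheory.klDiv M.Y.law₀ M.Y.law₁ < ∞) ∨
      (0 < InformationTheory.klDiv M.X.law₁ M.X.law₀ ∧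
        InformationTheory.klDiv M.X.law₁ M.X.law₀ ≤ InformationTheory.klDiv M.Y.law₁ M.Y.law₀ ∧
        InformationTheory.klDiv M.Y.law₁ M.Y.law₀ < ∞)) :
    -- (1) false alarms
    (∀ p : QCD.DEParams, p.Positive → ∀ γ : ℝ, 1 < γ →
      ENNReal.ofReal γ ≤ M.ARLFA (M.de2e (Real.log γ) p)) ∧
    -- (2) observation ratios and data efficiency
    (∀ βX βY : ℝ, 0 < βX → βX < 1 → 0 < βY → βY < 1 →
      ∃ p : QCD.DEParams, p.Positive ∧ ∀ A : ℝ, 0 < A →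
        M.POR (M.de2e A p) .expY ≤ ENNReal.ofReal βY ∧
        M.POR (M.de2e A p) .expX ≤ ENNReal.ofReal βX ∧
        (βX + βY < 1 → ENNReal.ofReal (1 - βX - βY) ≤
          liminf (M.meanFraction (M.de2e A p) .idle) atTop)) ∧
    -- (3) delay
    (∀ p : QCD.DEParams, p.Positive →
      (∀ A : ℝ, 0 < A →
        M.WADD (M.de2e A p) ≤ M.meanStop₁ (M.de2e A p) +
          ENNReal.ofReal p.NX + ENNReal.ofReal p.NX * ENNReal.ofReal p.N0) ∧
      (∃ K : ℝ≥0, ∀ A : ℝ, 0 < A →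
        M.WADD (M.de2e A p) ≤ M.WADD (M.cusumPolicy A) + (K : ℝ≥0∞)) ∧
      -- the algorithm is an admissible policy, and it is asymptotically optimal
      (∀ A : ℝ, 0 < A → (M.de2e A p).IsAdmissible) ∧
      ((0 < InformationTheory.klDiv M.X.law₁ M.X.law₀ ∧
          InformationTheory.klDiv M.X.law₁ M.X.law₀ ≤ InformationTheory.klDiv M.Y.law₁ M.Y.law₀ ∧
          InformationTheory.klDiv M.Y.law₁ M.Y.law₀ < ∞) →
        ∀ ε : ℝ, 0 < ε → ∃ γ₀ : ℝ, 1 < γ₀ ∧ ∀ γ : ℝ, γ₀ ≤ γ →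
          ∀ Ψ : QCD.Policy 𝒳 𝒴, Ψ.IsAdmissible → ENNReal.ofReal γ ≤ M.ARLFA Ψ →
            M.WADD (M.de2e (Real.log γ) p) ≤ ENNReal.ofReal (1 + ε) * M.WADD Ψ)) := by
  -- Under either alternative the divergence of `X` is positive and that of `Y` is no smaller, so
  -- the laws differ in both experiments; this gives the drift and the affinity bounds.
  have hne : M.X.law₁ ≠ M.X.law₀ ∧ M.Y.law₁ ≠ M.Y.law₀ := by
    rcases hKL with ⟨hpos, hle, -⟩ | ⟨hpos, hle, -⟩ <;> constructor <;> intro h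
    · simp [h] at hpos
    · simp [h] at hle
      simp [hle] at hpos
    · simp [h] at hpos
    · simp [h] at hle
      simp [hle] at hpos
  refine ⟨fun p hp γ hγ => ?_, fun βX βY hX0 _ hY0 _ => ?_, fun p hp => ⟨fun A hA => ?_, ?_,
    fun A hA => M.isAdmissible_de2e hp hA, fun ⟨hpos, hle, hfin⟩ ε hε =>
      M.WADD_de2e_le_mul hX hY hpos hle hfin hp hε⟩⟩
  · have := M.exp_le_ARLFA hY hp (Real.log_nonneg hγ.le)
    rwa [Real.exp_log (one_pos.trans hγ)] at this
  · have hβ : 0 < min βX βY := lt_min hX0 hY0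
    obtain ⟨p, hp, C, hC, h⟩ := M.exists_sparse_params hX hY hne.1 hne.2 hβ
    refine ⟨p, hp, fun A _ => ?_⟩
    obtain ⟨h1, h2, h3⟩ := M.por_le A hC hβ.le h
    refine ⟨h1.trans (ENNReal.ofReal_le_ofReal (min_le_right _ _)),
      h2.trans (ENNReal.ofReal_le_ofReal (min_le_left _ _)),
      fun _ => (ENNReal.ofReal_le_ofReal ?_).trans h3⟩
    linarith [min_le_left βX βY]
  · refine (M.WADD_de2e_le hp hA).trans (le_of_eq ?_)
    rw [QCD.DEParams.maxExcursion, QCD.DEParams.costX, mul_add, mul_one, add_assoc]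
  · obtain ⟨C, hC⟩ := M.exists_WADD_de2e_le hY hne.2 hp
    exact ⟨C, fun A hA => (hC A hA).trans (add_le_add (M.cusumDelay_le_WADD A) le_rfl)⟩
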